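/- **Notation.** Fix $N\ge 1$ and a compatible collection of complex roots of unity $(\zeta_m)_{m\ge1}$: $\zeta_m$ has exact order $m$, $\zeta_{mm'}=\zeta_m\zeta_{m'}$ for coprime $m,m'$, and $(\zeta_{\ell^{r}})^{\ell}=\zeta_{\ell^{r-1}}$ for primes $\ell$ and $r\ge1$. For $a\in\mathbb Q$ with denominator coprime to $m$, put $[a]_m=\frac{a+\langle -a\rangle_m}{m}$, where $\langle b\rangle_m\in\{0,\dots,m-1\}$ is the residue of $b$ modulo $m$. Let $\alpha,\beta\in\frac1N\mathbb Z$ be such that none of $\alpha,\beta,\alpha+\beta$ is a non-positive integer. For $m\ge1$ coprime to $N$ let $B_m(\alpha,\beta;q-\zeta_m)$ be the Laurent series in $q-\zeta_m$ which is the asymptotic expansion, at $q=\zeta_me^{\hbar}$ as $\hbar\to0^-$, of $$\frac{\Gamma([\alpha]_m+[\beta]_m)}{\Gamma([\alpha]_m)\Gamma([\beta]_m)}\cdot\frac{(q^{\alpha+\beta};q)_\infty\,(q;q)_\infty}{(q^{\alpha};q)_\infty\,(q^{\beta};q)_\infty},\qquad (x;q)_\infty=\prod_{k\ge0}(1-xq^k),\quad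 q^a=\zeta_m^{\langle a\rangle_m}e^{a\hbar}.$$ For a prime $p$ let $\Gamma_p$ be Morita's $p$-adic Gamma function, i.e. the continuous function on $\mathbb Z_p$ with $\Gamma_p(n)=(-1)^n\prod_{0<k<n,\,p\nmid k}k$ for $n\in\mathbb Z_{\ge0}$. Fix an embedding of the field generated by all roots of unity into $\mathbb C_p$, and let $\log(q)$ denote, near $\zeta_m$, the series $\sum_{k\ge1}\frac{(-1)^{k+1}}{k}\zeta_m^{-k}(q-\zeta_m)^k$. **Theorem.** For every $m\ge1$ coprime to $N$ this expansion exists and $B_m(\alpha,\beta;q-\zeta_m)\in(q-\zeta_m)^{-1}\mathbb Q(\zeta_m)[\![q-\zeta_m]\!]$. For every prime $p$ not dividing $N$, every such embedding and every $m\ge 1$ coprime to $N$: 1. $\log(q)\,B_m(\alpha,\beta;q-\zeta_m)$ is a power series in $q-\zeta_m$ that converges for all $q\in\mathbb C_p$ with $|q-\zeta_m|_p<1$. In particular $B_m$ defines a meromorphic function on this disc. 2. One has $|\zeta_{pm}-\zeta_m|_p<1$, and the Laurent expansion at $q=\zeta_{pm}$ of the meromorphic function $B_m(\alpha,\beta;q-\zeta_m)$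 equals $$p^{[[\alpha]_m+[\beta]_m]_p+1-[\alpha]_{pm}-[\beta]_{pm}}\;\frac{\Gamma_p([\alpha]_m+[\beta]_m)}{\Gamma_p([\alpha]_m)\,\Gamma_p([\beta]_m)}\;\frac{\Gamma([[\alpha]_m+[\beta]_m]_p)}{\Gamma([\alpha]_{pm}+[\beta]_{pm})}\;B_{pm}(\alpha,\beta;q-\zeta_{pm}),$$ where the exponent of $p$ is an integer and the last quotient of classical Gamma values is a rational number (so that the identity takes place in $(q-\zeta_{pm})^{-1}\mathbb Q_p(\zeta_{pm})[\![q-\zeta_{pm}]\!]$). -/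

import Mathlib

open Filter Topology Asymptotics
open scoped LaurentSeries PowerSeries

noncomputable section

/-- The field generated over `ℚ` by all complex roots of unity. -/
abbrev QCyc : IntermediateField ℚ ℂ :=
  IntermediateField.adjoin ℚ {z : ℂ | ∃ n : ℕ, 0 < n ∧ z ^ n = 1}

/-- A compatible collection of roots of unity: `ζ m` has exact order `m`,
`ζ (m m') = ζ m * ζ m'` for coprime `m, m'`, and `ζ (p ^ r) ^ p = ζ (p ^ (r - 1))`
for primes `p` and `r ≥ 1`. The value `ζ 0` plays no role. -/
structure IsCompatibleRoots (ζ : ℕ → QCyc) : Prop where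
  primitive : ∀ m : ℕ, 0 < m → IsPrimitiveRoot (ζ m) m
  mul : ∀ m m' : ℕ, 0 < m → 0 < m' → m.Coprime m' → ζ (m * m') = ζ m * ζ m'
  pow : ∀ p r : ℕ, p.Prime → ζ (p ^ (r + 1)) ^ p = ζ (p ^ r)

/-- For `b ∈ ℚ` with denominator coprime to `m ≥ 1`: the unique integer `0 ≤ ⟨b⟩ < m` congruent
to `b` modulo `m`. -/
def ratResidue (m : ℕ) (b : ℚ) : ℕ :=
  ((b.num : ZMod m) * (b.den : ZMod m)⁻¹).val

/-- `[a]_m = (a + ⟨-a⟩) / m`. -/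
def ratBracket (m : ℕ) (a : ℚ) : ℚ :=
  (a + ratResidue m (-a)) / m

/-- `(x; q)_∞ = ∏_{k ≥ 0} (1 - x q ^ k)`, for `|q| < 1`. -/
def qPochInf (x q : ℂ) : ℂ :=
  ∏' k : ℕ, (1 - x * q ^ k)

/-- `q ^ a` at `q = z * exp h`, where `z` is an `m`-th root of unity and the denominator of `a` is
coprime to `m`, so that `z ^ a` is an `m`-th root of unity. -/
def qPower (z : ℂ) (m : ℕ) (h : ℂ) (a : ℚ) : ℂ :=
  z ^ ratResidue m a * Complex.exp (a * h)

/-- The analytic function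
`Γ([α]+[β]) / (Γ([α]) Γ([β])) * (q^(α+β); q)_∞ (q; q)_∞ / ((q^α; q)_∞ (q^β; q)_∞)`,
`[·] = [·]_m`, at the point `q = z * exp h`, where `z` is a root of unity of order `m`
and `h < 0`. -/
def qBetaFun (z : ℂ) (m : ℕ) (α β : ℚ) (h : ℝ) : ℂ :=
  ((Real.Gamma (ratBracket m α + ratBracket m β : ℚ) /
      (Real.Gamma (ratBracket m α) * Real.Gamma (ratBracket m β)) : ℝ) : ℂ) *
    (qPochInf (qPower z m h (α + β)) (z * Complex.exp h) *
        qPochInf (z * Complex.exp h) (z * Complex.exp h) /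
      (qPochInf (qPower z m h α) (z * Complex.exp h) *
        qPochInf (qPower z m h β) (z * Complex.exp h)))

/-- `B = B_m(α, β; q - ζ_m)`: the Laurent series `B` (in the variable `q - z`, `z = ζ_m`) lies in
`(q - z)⁻¹ ℚ(z)⟦q - z⟧` and is the asymptotic expansion of the function above at `q = z * exp h`
as `h → 0⁻`. (An asymptotic expansion is unique, so this determines `B`.) -/
structure IsQBetaExpansion (z : QCyc) (m : ℕ) (α β : ℚ) (B : LaurentSeries QCyc) : Prop where
  coeff_eq_zero : ∀ n : ℤ, n < -1 → B.coeff n = 0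
  coeff_mem : ∀ n : ℤ, B.coeff n ∈ IntermediateField.adjoin ℚ ({z} : Set QCyc)
  asymptotic : ∀ M : ℕ,
    (fun h : ℝ => qBetaFun z m α β h -
        ∑ n ∈ Finset.Ico (-1 : ℤ) M,
          (B.coeff n : ℂ) * ((z : ℂ) * Complex.exp h - z) ^ n)
      =O[𝓝[<] 0] fun h : ℝ => h ^ M

/-- `(-1) ^ n * ∏_{0 < k < n, p ∤ k} k`. -/
def moritaGammaNat (p n : ℕ) : ℤ :=
  (-1) ^ n * ∏ k ∈ (Finset.Ico 1 n).filter (fun k => ¬ p ∣ k), (k : ℤ)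

/-- Morita's `p`-adic Gamma function at `x ∈ ℤ_p` (here a subset of `ℚ_p`): the limit of
`(-1) ^ n * ∏_{0 < k < n, p ∤ k} k` as the natural number `n` tends `p`-adically to `x`. -/
def moritaGamma (p : ℕ) [Fact p.Prime] (x : ℚ_[p]) : ℚ_[p] :=
  limUnder (comap (fun n : ℕ => (n : ℚ_[p])) (𝓝 x)) fun n : ℕ => (moritaGammaNat p n : ℚ_[p])

/-- The expansion of the logarithm `log q` (normalized to vanish at roots of unity) at a root of
unity `z`: the power series `∑_{k ≥ 1} (-1) ^ (k + 1) / k * z ^ (-k) * (q - z) ^ k`. -/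
def logAt {K : Type*} [Field K] (z : K) : K⟦X⟧ :=
  PowerSeries.mk fun k : ℕ => if k = 0 then 0 else (-1) ^ (k + 1) / (k : K) * z⁻¹ ^ k

section

variable {p : ℕ} [Fact p.Prime]

/-- The power series converges on the open unit disc of `ℂ_p`. -/
def ConvergesOnUnitDisc (f : ℂ_[p]⟦X⟧) : Prop :=
  ∀ x : ℂ_[p], ‖x‖ < 1 → Summable fun n : ℕ => PowerSeries.coeff n f * x ^ n

/-- `g(y) = f(δ + y)`: the power series `g` is the re-expansion of `f` at the point `δ`. -/
def IsReexpansion (δ : ℂ_[p]) (f g : ℂ_[p]⟦X⟧) : Prop :=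
  ∀ k : ℕ, HasSum (fun n : ℕ => PowerSeries.coeff n f * (n.choose k : ℂ_[p]) * δ ^ (n - k))
    (PowerSeries.coeff k g)

/-- The Laurent series `F` at `0` is a quotient `f / g` of power series converging on the open unit
disc, hence defines a meromorphic function there, and the Laurent expansion of this function at
the point `δ` of the disc is `G`. -/
def IsMeromorphicReexpansion (δ : ℂ_[p]) (F G : LaurentSeries ℂ_[p]) : Prop :=
  ∃ f g f' g' : ℂ_[p]⟦X⟧, ConvergesOnUnitDisc f ∧ ConvergesOnUnitDisc g ∧ g ≠ 0 ∧ g' ≠ 0 ∧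
    IsReexpansion δ f f' ∧ IsReexpansion δ g g' ∧
    (f : LaurentSeries ℂ_[p]) = (g : LaurentSeries ℂ_[p]) * F ∧
    (f' : LaurentSeries ℂ_[p]) = (g' : LaurentSeries ℂ_[p]) * G

end

end

/-! For positive integral parameters `a + 1`, `b + 1` everything is elementary: since `(q^(n+1);
q)_∞ = (q; q)_∞ / qFac q n`, the series `B_m` is the expansion at `ζ_m` of the rational function
`betaConst (a / m) (b / m) * qFac q a * qFac q b / qFac q (a + b + 1)`, with natural-number division
in the constant. Expanding at `ζ_{pm}` instead of `ζ_m` changes only the constant, so the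
re-expansion formula holds with the ratio of the two `betaConst` values. The general case follows
from this one by p-adic interpolation, which needs three ingredients.

Polynomiality (`exists_expansion`, `exists_coefficients`). For `α`, `β` in fixed residue classes
modulo `m`, each coefficient of `(q - ζ_m) B_m` is a polynomial in `α`, `β` with coefficients in
`ℚ(ζ_m)`. To see this, the logarithm of a truncated Pochhammer symbol is a Riemann-type sum of
smooth functions at the points `(x + k) t`, `t = -h`. Lagrange interpolation in `x` at natural
numbers of the given class has an error of high order in `t`, because derivatives of order at least
two decay quadratically. At the nodes the sums reduce to finite ones. The factors which vanish as `t
→ 0` are split off; they assemble to Gauss's limit for `Γ`, which explains the Gamma normalization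
(`exists_norm_normalizedPoch_sub_one_le`). Rationality of the coefficients is read off from the
integral parameters by interpolation on a grid.

Uniform bounds (`exists_gaussBound_qBeta`). Choose natural numbers `a_j`, `b_j` such that `a_j + 1`,
`b_j + 1` tend p-adically to `α`, `β`. The coefficients of `B_m(a_j + 1, b_j + 1)` then converge to
those of `B_m(α, β)`. To transport re-expansions to the limit one needs bounds on Gauss norms at
every radius below one. The logarithm is replaced by `(q^k - 1) / k` with `k = d p^n`, where `d` is
the prime-to-`p` part of `m`. Up to integral units, `qFac q n` is a product of `primePowFactor`s
with multiplicities `⌊n / (d p^i)⌋`. In the product with the approximate logarithm each level `i`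
occurs with exponent 0 or 1. The power of `p` lost at that level through `1 / k` is regained either
from the small Gauss norm of the surviving factor or from a carry in `betaConst`. Finally
`IsReexpansion.of_tendsto` passes to the limit.

The constant (`tendsto_betaConst_ratio`). Splitting the multiples of `p` off a factorial gives `n! =
± Γ_p(n + 1) p^⌊n/p⌋ ⌊n/p⌋!`. Hence the ratio of the two `betaConst` values is a quotient of Morita
values, times a power of `p`, times a ratio of factorials. Continuity of `Γ_p` gives its limit. -/

set_option linter.unusedSectionVars false

/-! ### Gauss norms and integral units among power series -/

section GaussBound

variable {K : Type*} [NormedField K] [IsUltrametricDist K]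

/-- The Gauss norm of `f` at radius `r` is at most `C`. -/
def GaussBound (r C : ℝ) (f : K⟦X⟧) : Prop :=
  ∀ n : ℕ, ‖PowerSeries.coeff n f‖ * r ^ n ≤ C

namespace GaussBound

variable {r C D : ℝ} {f g : K⟦X⟧}

theorem nonneg (hf : GaussBound r C f) : 0 ≤ C := by
  have := hf 0
  simp only [pow_zero, mul_one] at this
  exact (norm_nonneg _).trans this

theorem mono (hf : GaussBound r C f) (h : C ≤ D) : GaussBound r D f :=
  fun n => (hf n).trans h

theorem add (hr : 0 ≤ r) (hf : GaussBound r C f) (hg : GaussBound r C g) :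
    GaussBound r C (f + g) := by
  intro n
  rw [map_add]
  rcases le_total ‖PowerSeries.coeff n f‖ ‖PowerSeries.coeff n g‖ with h | h
  · refine le_trans (mul_le_mul_of_nonneg_right (IsUltrametricDist.norm_add_le_max _ _)
      (pow_nonneg hr n)) ?_
    rw [max_eq_right h]; exact hg n
  · refine le_trans (mul_le_mul_of_nonneg_right (IsUltrametricDist.norm_add_le_max _ _)
      (pow_nonneg hr n)) ?_
    rw [max_eq_left h]; exact hf n

theorem neg (hf : GaussBound r C f) : GaussBound r C (-f) := by
  intro n
  simpa using hf n

theorem sub (hr : 0 ≤ r) (hf : GaussBound r C f) (hg : GaussBound r C g) :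
    GaussBound r C (f - g) := by
  rw [sub_eq_add_neg]; exact hf.add hr hg.neg

theorem zero (hC : 0 ≤ C) : GaussBound r C (0 : K⟦X⟧) := by
  intro n; simpa using hC

theorem sum {ι : Type*} (hr : 0 ≤ r) (hC : 0 ≤ C) (s : Finset ι) (F : ι → K⟦X⟧)
    (h : ∀ i ∈ s, GaussBound r C (F i)) : GaussBound r C (∑ i ∈ s, F i) := by
  classical
  induction s using Finset.induction_on with
  | empty => simpa using zero hC
  | insert a s ha ih =>
    rw [Finset.sum_insert ha]
    exact (h a (by simp)).add hr (ih fun i hi => h i (by simp [hi]))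

theorem mul (hr : 0 ≤ r) (hf : GaussBound r C f) (hg : GaussBound r D g) :
    GaussBound r (C * D) (f * g) := by
  intro n
  have hC := hf.nonneg
  have hD := hg.nonneg
  rw [PowerSeries.coeff_mul]
  obtain ⟨x, hx, hle⟩ := IsUltrametricDist.exists_norm_finsetSum_le (Finset.HasAntidiagonal.antidiagonal n)
    (fun x : ℕ × ℕ => PowerSeries.coeff x.1 f * PowerSeries.coeff x.2 g)
  have hx' := Finset.HasAntidiagonal.mem_antidiagonal.mp (hx ⟨(0, n), by simp⟩)
  calc _ ≤ ‖PowerSeries.coeff x.1 f * PowerSeries.coeff x.2 g‖ * r ^ n :=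
        mul_le_mul_of_nonneg_right hle (pow_nonneg hr n)
    _ = (‖PowerSeries.coeff x.1 f‖ * r ^ x.1) * (‖PowerSeries.coeff x.2 g‖ * r ^ x.2) := by
        rw [norm_mul, ← hx', pow_add]; ring
    _ ≤ C * D := mul_le_mul (hf _) (hg _) (by positivity) hC

theorem const (c : K) : GaussBound r ‖c‖ (PowerSeries.C c) := by
  intro n
  rw [PowerSeries.coeff_C]
  split_ifs with h
  · simp [h]
  · simp

theorem one : GaussBound r 1 (1 : K⟦X⟧) := by
  have := const (r := r) (1 : K)
  simpa using this

theorem pow (hr : 0 ≤ r) (hf : GaussBound r C f) (n : ℕ) : GaussBound r (C ^ n) (f ^ n) := by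
  induction n with
  | zero => simpa using one
  | succ n ih => rw [pow_succ, pow_succ]; exact ih.mul hr hf

theorem prod {ι : Type*} (hr : 0 ≤ r) (s : Finset ι) (F : ι → K⟦X⟧) (B : ι → ℝ)
    (h : ∀ i ∈ s, GaussBound r (B i) (F i)) : GaussBound r (∏ i ∈ s, B i) (∏ i ∈ s, F i) := by
  classical
  induction s using Finset.induction_on with
  | empty => simpa using one
  | insert a s ha ih =>
    rw [Finset.prod_insert ha, Finset.prod_insert ha]
    exact (h a (by simp)).mul hr (ih fun i hi => h i (by simp [hi]))

theorem of_one (hr : 0 ≤ r) (hr1 : r ≤ 1) (hf : GaussBound 1 C f) : GaussBound r C f := by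
  intro n
  have := hf n
  rw [one_pow, mul_one] at this
  exact (mul_le_of_le_one_right (norm_nonneg _) (pow_le_one₀ hr hr1)).trans this

theorem coeff_norm_le (hf : GaussBound r C f) (hr : 0 < r) (n : ℕ) :
    ‖PowerSeries.coeff n f‖ ≤ C * (r⁻¹) ^ n := by
  have := hf n
  rw [inv_pow, ← div_eq_mul_inv, le_div_iff₀ (by positivity)]
  exact this

end GaussBound

/-- A power series with integral coefficients and unit constant coefficient. -/
def IntegralUnit (f : K⟦X⟧) : Prop :=
  GaussBound 1 1 f ∧ ‖PowerSeries.constantCoeff f‖ = 1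

namespace IntegralUnit

variable {f g : K⟦X⟧}

theorem one : IntegralUnit (1 : K⟦X⟧) := ⟨GaussBound.one, by simp⟩

theorem mul (hf : IntegralUnit f) (hg : IntegralUnit g) : IntegralUnit (f * g) := by
  refine ⟨?_, by rw [map_mul, norm_mul, hf.2, hg.2, one_mul]⟩
  have := hf.1.mul zero_le_one hg.1
  rwa [one_mul] at this

theorem constantCoeff_ne_zero (hf : IntegralUnit f) : PowerSeries.constantCoeff f ≠ 0 := by
  intro h
  have := hf.2
  rw [h, norm_zero] at this
  exact zero_ne_one this

/-- The recursion for the coefficients of the inverse divides only by the constant coefficient,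
which has norm one, so the ultrametric inequality keeps them integral. -/
theorem inv (hf : IntegralUnit f) : IntegralUnit f⁻¹ := by
  refine ⟨?_, by rw [PowerSeries.constantCoeff_inv, norm_inv, hf.2, inv_one]⟩
  intro n
  simp only [one_pow, mul_one]
  induction n using Nat.strong_induction_on with
  | _ n ih =>
    rw [PowerSeries.coeff_inv]
    split_ifs with hn
    · rw [norm_inv, hf.2, inv_one]
    · rw [norm_mul, norm_neg, norm_inv, hf.2, inv_one, one_mul]
      refine IsUltrametricDist.norm_sum_le_of_forall_le_of_nonneg zero_le_one ?_
      intro x hx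
      split_ifs with hlt
      · rw [norm_mul]
        have h1 := hf.1 x.1
        simp only [one_pow, mul_one] at h1
        exact mul_le_one₀ h1 (norm_nonneg _) (ih _ hlt)
      · simp

theorem mul_inv_self (hf : IntegralUnit f) : f * f⁻¹ = 1 :=
  PowerSeries.mul_inv_cancel _ hf.constantCoeff_ne_zero

theorem exists_mul_eq (hf : IntegralUnit f) (hg : IntegralUnit g) :
    ∃ u : K⟦X⟧, IntegralUnit u ∧ g * u = f :=
  ⟨g⁻¹ * f, hg.inv.mul hf, by rw [← mul_assoc, hg.mul_inv_self, one_mul]⟩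

end IntegralUnit

end GaussBound

/-! ### Re-expansion of power series at another point of the unit disc -/

section Reexpansion

variable {p : ℕ} [Fact p.Prime]

theorem GaussBound.summable_norm {f : ℂ_[p]⟦X⟧} {r C : ℝ} (hf : GaussBound r C f) {x : ℝ}
    (hx0 : 0 ≤ x) (hx : x < r) : Summable fun n : ℕ => ‖PowerSeries.coeff n f‖ * x ^ n := by
  have hr : 0 < r := hx0.trans_lt hx
  refine Summable.of_nonneg_of_le (fun n => by positivity) (fun n => ?_)
    ((summable_geometric_of_lt_one (r := x / r) (by positivity)
      ((div_lt_one hr).mpr hx)).mul_left C)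
  calc ‖PowerSeries.coeff n f‖ * x ^ n = (‖PowerSeries.coeff n f‖ * r ^ n) * (x / r) ^ n := by
        rw [div_pow]; field_simp
    _ ≤ C * (x / r) ^ n := mul_le_mul_of_nonneg_right (hf n) (by positivity)

theorem convergesOnUnitDisc_of_gaussBound {f : ℂ_[p]⟦X⟧}
    (hf : ∀ r : ℝ, 0 < r → r < 1 → ∃ C, GaussBound r C f) : ConvergesOnUnitDisc f := by
  intro x hx
  obtain ⟨r, h1, h2⟩ := exists_between hx
  obtain ⟨C, hC⟩ := hf r ((norm_nonneg x).trans_lt h1) h2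
  refine Summable.of_norm ?_
  simpa [norm_mul, norm_pow] using hC.summable_norm (norm_nonneg x) h1

/-- A bound for the terms of a re-expansion. -/
theorem norm_reexpansion_term_le {f : ℂ_[p]⟦X⟧} {r s C : ℝ} (hf : GaussBound r C f) (hr : 0 < r)
    {δ : ℂ_[p]} (hs : 0 < s) (hδ : ‖δ‖ ≤ s) (k n : ℕ) :
    ‖PowerSeries.coeff n f * (n.choose k : ℂ_[p]) * δ ^ (n - k)‖ ≤ C * s⁻¹ ^ k * (s / r) ^ n := by
  have hC := hf.nonneg
  rcases lt_or_ge n k with h | h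
  · rw [Nat.choose_eq_zero_of_lt h]
    simp only [Nat.cast_zero, mul_zero, zero_mul, norm_zero]
    positivity
  · rw [norm_mul, norm_mul, norm_pow]
    calc ‖PowerSeries.coeff n f‖ * ‖(n.choose k : ℂ_[p])‖ * ‖δ‖ ^ (n - k)
        ≤ (C * r⁻¹ ^ n) * 1 * s ^ (n - k) := by
          gcongr
          · exact hf.coeff_norm_le hr n
          · exact IsUltrametricDist.norm_natCast_le_one _ _
      _ = C * s⁻¹ ^ k * (s / r) ^ n := by
          rw [div_pow, inv_pow, inv_pow, ← Nat.sub_add_cancel h, pow_add s, Nat.sub_add_cancel h]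
          field_simp

theorem exists_radii {δ : ℂ_[p]} (hδ : ‖δ‖ < 1) :
    ∃ s r : ℝ, 0 < s ∧ ‖δ‖ ≤ s ∧ s < r ∧ 0 < r ∧ r < 1 := by
  obtain ⟨s, h1, h2⟩ := exists_between hδ
  obtain ⟨r, h3, h4⟩ := exists_between h2
  have hs : 0 < s := (norm_nonneg δ).trans_lt h1
  exact ⟨s, r, hs, h1.le, h3, hs.trans h3, h4⟩

theorem exists_isReexpansion {f : ℂ_[p]⟦X⟧} {δ : ℂ_[p]} (hδ : ‖δ‖ < 1)
    (hf : ∀ r : ℝ, 0 < r → r < 1 → ∃ C, GaussBound r C f) :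
    ∃ f' : ℂ_[p]⟦X⟧, IsReexpansion δ f f' := by
  obtain ⟨s, r, hs, hδs, hsr, hr, hr1⟩ := exists_radii hδ
  obtain ⟨C, hC⟩ := hf r hr hr1
  refine ⟨PowerSeries.mk fun k =>
    ∑' n, PowerSeries.coeff n f * (n.choose k : ℂ_[p]) * δ ^ (n - k), fun k => ?_⟩
  rw [PowerSeries.coeff_mk]
  refine Summable.hasSum (Summable.of_norm_bounded ?_
    (fun n => norm_reexpansion_term_le hC hr hs hδs k n))
  exact (summable_geometric_of_lt_one (by positivity) ((div_lt_one hr).mpr hsr)).mul_left _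

theorem HasSum.of_term_eq {E : Type*} [AddCommMonoid E] [TopologicalSpace E] {f g : ℕ → E} {a : E}
    (h : HasSum f a) (e : ∀ n, g n = f n) : HasSum g a := by
  rwa [funext e]

theorem IsReexpansion.unique {δ : ℂ_[p]} {f g g' : ℂ_[p]⟦X⟧} (h : IsReexpansion δ f g)
    (h' : IsReexpansion δ f g') : g = g' :=
  PowerSeries.ext fun k => (h k).unique (h' k)

theorem IsReexpansion.add {δ : ℂ_[p]} {f g f' g' : ℂ_[p]⟦X⟧} (hf : IsReexpansion δ f f')
    (hg : IsReexpansion δ g g') : IsReexpansion δ (f + g) (f' + g') := by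
  intro k
  rw [map_add]
  refine HasSum.of_term_eq ((hf k).add (hg k)) fun n => ?_
  rw [map_add]; ring

theorem IsReexpansion.C_mul {δ : ℂ_[p]} {f f' : ℂ_[p]⟦X⟧} (hf : IsReexpansion δ f f')
    (a : ℂ_[p]) : IsReexpansion δ (PowerSeries.C a * f) (PowerSeries.C a * f') := by
  intro k
  rw [PowerSeries.coeff_C_mul]
  refine HasSum.of_term_eq ((hf k).mul_left a) fun n => ?_
  rw [PowerSeries.coeff_C_mul]; ring

/-- This is Pascal's rule for the binomial coefficients in the re-expansion sums. -/
theorem IsReexpansion.X_mul {δ : ℂ_[p]} {f f' : ℂ_[p]⟦X⟧} (hf : IsReexpansion δ f f') :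
    IsReexpansion δ (PowerSeries.X * f) ((PowerSeries.C δ + PowerSeries.X) * f') := by
  intro k
  refine (hasSum_nat_add_iff' 1).mp ?_
  simp only [Finset.range_one, Finset.sum_singleton, PowerSeries.coeff_zero_X_mul, zero_mul,
    sub_zero, PowerSeries.coeff_succ_X_mul]
  rw [add_mul, map_add, PowerSeries.coeff_C_mul]
  have key : ∀ n k : ℕ, (n.choose k : ℂ_[p]) * δ ^ (n + 1 - k) =
      δ * ((n.choose k : ℂ_[p]) * δ ^ (n - k)) := by
    intro n k
    rcases lt_or_ge n k with h | h
    · simp [Nat.choose_eq_zero_of_lt h]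
    · rw [Nat.sub_add_comm h, pow_succ]; ring
  cases k with
  | zero =>
    rw [PowerSeries.coeff_zero_X_mul, add_zero]
    refine HasSum.of_term_eq ((hf 0).mul_left δ) fun n => ?_
    have := key n 0
    simp only [Nat.choose_zero_right, Nat.cast_one, one_mul] at this ⊢
    rw [mul_assoc, one_mul, this]; ring
  | succ k =>
    rw [PowerSeries.coeff_succ_X_mul]
    refine HasSum.of_term_eq (((hf (k + 1)).mul_left δ).add (hf k)) fun n => ?_
    rw [Nat.choose_succ_succ', Nat.add_sub_add_right]
    have := key n (k + 1)
    rw [Nat.add_sub_add_right] at this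
    push_cast
    linear_combination PowerSeries.coeff n f * this

/-- The variable `q` is `c + X` at the centre `c` and `(c + δ) + X` at the new centre. Compatibility
with multiplication by polynomials in `q` suffices to identify re-expansions of rational functions
after clearing denominators; a general product rule is not needed. -/
theorem IsReexpansion.aeval_mul {δ : ℂ_[p]} {f f' : ℂ_[p]⟦X⟧} (hf : IsReexpansion δ f f')
    (c : ℂ_[p]) (A : Polynomial ℂ_[p]) :
    IsReexpansion δ (Polynomial.aeval (PowerSeries.C c + PowerSeries.X : ℂ_[p]⟦X⟧) A * f)
      (Polynomial.aeval (PowerSeries.C (c + δ) + PowerSeries.X : ℂ_[p]⟦X⟧) A * f') := by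
  induction A using Polynomial.induction_on' with
  | add A B hA hB =>
    rw [map_add, map_add, add_mul, add_mul]
    exact hA.add hB
  | monomial n a =>
    induction n generalizing a with
    | zero =>
      simp only [Polynomial.monomial_zero_left, Polynomial.aeval_C]
      exact hf.C_mul a
    | succ n ih =>
      have h1 := (ih a).X_mul.add ((ih a).C_mul c)
      have h2 : Polynomial.monomial (n + 1) a = Polynomial.X * Polynomial.monomial n a := by
        rw [Polynomial.X_mul_monomial]
      rw [h2]
      simp only [map_mul, Polynomial.aeval_X]
      convert h1 using 1
      · ring
      · rw [map_add]; ring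

theorem isReexpansion_aeval {δ : ℂ_[p]} (c : ℂ_[p]) (A : Polynomial ℂ_[p]) :
    IsReexpansion δ (Polynomial.aeval (PowerSeries.C c + PowerSeries.X : ℂ_[p]⟦X⟧) A)
      (Polynomial.aeval (PowerSeries.C (c + δ) + PowerSeries.X : ℂ_[p]⟦X⟧) A) := by
  have h1 : IsReexpansion δ (1 : ℂ_[p]⟦X⟧) 1 := by
    intro k
    convert hasSum_single (f := fun n => PowerSeries.coeff n (1 : ℂ_[p]⟦X⟧) *
      (n.choose k : ℂ_[p]) * δ ^ (n - k)) 0 ?_ using 1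
    · cases k <;> simp [PowerSeries.coeff_one]
    · intro n hn
      simp [PowerSeries.coeff_one, hn]
  simpa using h1.aeval_mul c A

/-- Re-expansions pass to coefficientwise limits of uniformly bounded sequences. -/
theorem IsReexpansion.of_tendsto {δ : ℂ_[p]} (hδ : ‖δ‖ < 1) {F F' : ℕ → ℂ_[p]⟦X⟧}
    {f f' : ℂ_[p]⟦X⟧} (hF : ∀ r : ℝ, 0 < r → r < 1 → ∃ C, ∀ j, GaussBound r C (F j))
    (h : ∀ j, IsReexpansion δ (F j) (F' j))
    (hf : ∀ n, Tendsto (fun j => PowerSeries.coeff n (F j)) atTop (𝓝 (PowerSeries.coeff n f)))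
    (hf' : ∀ n, Tendsto (fun j => PowerSeries.coeff n (F' j)) atTop (𝓝 (PowerSeries.coeff n f'))) :
    (∀ r : ℝ, 0 < r → r < 1 → ∃ C, GaussBound r C f) ∧ IsReexpansion δ f f' := by
  have hb : ∀ r : ℝ, 0 < r → r < 1 → ∃ C, GaussBound r C f := by
    intro r h0 h1
    obtain ⟨C, hC⟩ := hF r h0 h1
    exact ⟨C, fun n => le_of_tendsto ((hf n).norm.mul_const _) (Eventually.of_forall fun j => hC j n)⟩
  refine ⟨hb, fun k => ?_⟩
  obtain ⟨f'', hf''⟩ := exists_isReexpansion hδ hb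
  obtain ⟨s, r, hs, hδs, hsr, hr, hr1⟩ := exists_radii hδ
  obtain ⟨C, hC⟩ := hF r hr hr1
  -- The geometric majorant with ratio `s / r < 1` does not depend on `j`; this is where uniformity
  -- of the Gauss bounds is used.
  have hlim := tendsto_tsum_of_dominated_convergence (𝓕 := atTop)
    (f := fun j n => PowerSeries.coeff n (F j) * (n.choose k : ℂ_[p]) * δ ^ (n - k))
    (g := fun n => PowerSeries.coeff n f * (n.choose k : ℂ_[p]) * δ ^ (n - k))
    (bound := fun n => C * s⁻¹ ^ k * (s / r) ^ n)
    ((summable_geometric_of_lt_one (by positivity) ((div_lt_one hr).mpr hsr)).mul_left _)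
    (fun n => ((hf n).mul_const _).mul_const _)
    (Eventually.of_forall fun j n => norm_reexpansion_term_le (hC j) hr hs hδs k n)
  simp only [(h _ k).tsum_eq, (hf'' k).tsum_eq] at hlim
  rw [tendsto_nhds_unique (hf' k) hlim]
  exact hf'' k

end Reexpansion

/-! ### Distances between roots of unity in `ℂ_p` -/

section RootsOfUnity

variable {p : ℕ} [hp : Fact p.Prime]

theorem PadicComplex.norm_natCast_eq (n : ℕ) : ‖(n : ℂ_[p])‖ = ‖(n : ℚ_[p])‖ := by
  rw [← map_natCast (algebraMap ℚ_[p] ℂ_[p]) n, norm_algebraMap']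

theorem PadicComplex.norm_p : ‖(p : ℂ_[p])‖ = (p : ℝ)⁻¹ := by
  rw [PadicComplex.norm_natCast_eq, Padic.norm_p]

theorem PadicComplex.norm_natCast_of_coprime {n : ℕ} (h : p.Coprime n) : ‖(n : ℂ_[p])‖ = 1 := by
  rw [PadicComplex.norm_natCast_eq]
  exact Padic.norm_natCast_eq_one_iff.mpr h

theorem PadicComplex.norm_eq_one_of_pow_eq_one {ξ : ℂ_[p]} {n : ℕ} (h : ξ ^ n = 1) (hn : n ≠ 0) :
    ‖ξ‖ = 1 := by
  refine (pow_eq_one_iff_of_nonneg (norm_nonneg ξ) hn).mp ?_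
  rw [← norm_pow, h, norm_one]

theorem norm_one_sub_le {ξ : ℂ_[p]} (h : ‖ξ‖ = 1) (l : ℕ) : ‖1 - ξ ^ l‖ ≤ 1 := by
  rw [sub_eq_add_neg]
  refine (IsUltrametricDist.norm_add_le_max _ _).trans ?_
  simp [h]

theorem norm_one_sub_pow_le {ξ : ℂ_[p]} (h : ‖ξ‖ = 1) (l : ℕ) : ‖1 - ξ ^ l‖ ≤ ‖1 - ξ‖ := by
  have : 1 - ξ ^ l = (1 - ξ) * ∑ i ∈ Finset.range l, ξ ^ i := by
    rw [mul_neg_geom_sum]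
  rw [this, norm_mul]
  refine mul_le_of_le_one_right (norm_nonneg _) ?_
  refine IsUltrametricDist.norm_sum_le_of_forall_le_of_nonneg zero_le_one fun i _ => ?_
  simp [h]

theorem norm_geom_sum_sub_natCast_le {ξ : ℂ_[p]} (h : ‖ξ‖ = 1) (l : ℕ) :
    ‖∑ i ∈ Finset.range l, ξ ^ i - l‖ ≤ ‖1 - ξ‖ := by
  have : ∑ i ∈ Finset.range l, ξ ^ i - l = ∑ i ∈ Finset.range l, (ξ ^ i - 1) := by
    simp
  rw [this]
  refine IsUltrametricDist.norm_sum_le_of_forall_le_of_nonneg (norm_nonneg _) fun i _ => ?_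
  rw [norm_sub_rev]
  exact norm_one_sub_pow_le h i

/-- Modulo `1 - ξ` the sum is `l`, a p-adic unit. -/
theorem norm_geom_sum_eq_one {ξ : ℂ_[p]} (h : ‖ξ‖ = 1) (h1 : ‖1 - ξ‖ < 1) {l : ℕ}
    (hl : p.Coprime l) : ‖∑ i ∈ Finset.range l, ξ ^ i‖ = 1 := by
  have h2 := PadicComplex.norm_natCast_of_coprime hl
  have h3 := (norm_geom_sum_sub_natCast_le h l).trans_lt h1
  rw [← h2, ← norm_neg (l : ℂ_[p])]
  refine IsUltrametricDist.norm_eq_of_add_norm_lt_max ?_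
  rw [← sub_eq_add_neg, norm_neg, h2]
  exact lt_max_of_lt_right h3

/-- If `ξ` were congruent to 1, the sum `1 + ξ + ⋯ + ξ^(n-1)` would be a unit, whereas it is zero.
-/
theorem norm_one_sub_eq_one_of_pow_eq_one {ξ : ℂ_[p]} {n : ℕ} (hn : p.Coprime n) (hn0 : n ≠ 0)
    (h : ξ ^ n = 1) (hξ : ξ ≠ 1) : ‖1 - ξ‖ = 1 := by
  have h1 : ‖ξ‖ = 1 := PadicComplex.norm_eq_one_of_pow_eq_one h hn0
  refine le_antisymm (by simpa using norm_one_sub_le h1 1) ?_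
  by_contra! hlt
  have h2 := norm_geom_sum_eq_one h1 hlt hn
  have h3 : (1 - ξ) * ∑ i ∈ Finset.range n, ξ ^ i = 0 := by rw [mul_neg_geom_sum, h, sub_self]
  rcases mul_eq_zero.mp h3 with h4 | h4
  · exact hξ (sub_eq_zero.mp h4).symm
  · rw [h4, norm_zero] at h2; exact zero_ne_one h2

/-- By the binomial theorem `(ξ - 1)^p` and `ξ^p - 1` agree modulo `p`. -/
theorem norm_one_sub_lt_one_of_pow {ξ : ℂ_[p]} (h1 : ‖ξ‖ = 1) (h : ‖1 - ξ ^ p‖ < 1) :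
    ‖1 - ξ‖ < 1 := by
  have hle : ‖1 - ξ‖ ≤ 1 := by simpa using norm_one_sub_le h1 1
  have hy : ‖ξ - 1‖ ≤ 1 := by rwa [norm_sub_rev]
  have hs : ξ ^ p - 1 - (ξ - 1) ^ p = ∑ j ∈ Finset.Ico 1 p, (ξ - 1) ^ j * (p.choose j : ℂ_[p]) := by
    have := add_pow (ξ - 1) 1 p
    rw [sub_add_cancel, Finset.sum_range_succ, Finset.range_eq_Ico,
      Finset.sum_eq_sum_Ico_succ_bot hp.out.pos] at this
    rw [this]
    simp only [pow_zero, one_pow, mul_one, Nat.choose_zero_right, Nat.cast_one, zero_add,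
      Nat.choose_self]
    ring
  have hb : ‖ξ ^ p - 1 - (ξ - 1) ^ p‖ ≤ (p : ℝ)⁻¹ := by
    rw [hs]
    refine IsUltrametricDist.norm_sum_le_of_forall_le_of_nonneg (by positivity) fun j hj => ?_
    rw [Finset.mem_Ico] at hj
    obtain ⟨d, hd⟩ := hp.out.dvd_choose_self (by omega) hj.2
    rw [hd, Nat.cast_mul, norm_mul, norm_mul, norm_pow, PadicComplex.norm_p]
    have := IsUltrametricDist.norm_natCast_le_one ℂ_[p] d
    have h3 : ‖ξ - 1‖ ^ j ≤ 1 := pow_le_one₀ (norm_nonneg _) hy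
    calc ‖ξ - 1‖ ^ j * ((p : ℝ)⁻¹ * ‖(d : ℂ_[p])‖) ≤ 1 * ((p : ℝ)⁻¹ * 1) := by gcongr
      _ = _ := by ring
  have hp1 : (p : ℝ)⁻¹ < 1 := inv_lt_one_of_one_lt₀ (by exact_mod_cast hp.out.one_lt)
  have h2 : ‖(ξ - 1) ^ p‖ < 1 := by
    have : (ξ - 1) ^ p = -(1 - ξ ^ p) + -(ξ ^ p - 1 - (ξ - 1) ^ p) := by ring
    rw [this]
    refine (IsUltrametricDist.norm_add_le_max _ _).trans_lt ?_
    rw [norm_neg, norm_neg]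
    exact max_lt h (hb.trans_lt hp1)
  rw [norm_pow] at h2
  rw [norm_sub_rev]
  by_contra! h3
  exact absurd (one_le_pow₀ h3) (not_le.mpr h2)

theorem norm_one_sub_lt_one_of_pow_prime_pow {ξ : ℂ_[p]} {k : ℕ} (h : ξ ^ p ^ k = 1) :
    ‖1 - ξ‖ < 1 := by
  have h1 : ‖ξ‖ = 1 := PadicComplex.norm_eq_one_of_pow_eq_one h (pow_ne_zero _ hp.out.ne_zero)
  induction k generalizing ξ with
  | zero => simp_all
  | succ k ih =>
    refine norm_one_sub_lt_one_of_pow h1 (ih ?_ (by simp [h1]))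
    rw [← pow_mul, ← pow_succ', h]

end RootsOfUnity

/-! ### Factorization of finite `q`-products up to integral units -/

/-- The finite product `(1 - q) (1 - q ^ 2) ⋯ (1 - q ^ n)`. -/
def qFac {R : Type*} [CommRing R] (q : R) (n : ℕ) : R :=
  ∏ k ∈ Finset.range n, (1 - q ^ (k + 1))

theorem map_qFac {R S F : Type*} [CommRing R] [CommRing S] [FunLike F R S] [RingHomClass F R S]
    (φ : F) (q : R) (n : ℕ) : φ (qFac q n) = qFac (φ q) n := by
  simp [qFac, map_prod]

theorem qFac_succ {R : Type*} [CommRing R] (q : R) (n : ℕ) :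
    qFac q (n + 1) = qFac q n * (1 - q ^ (n + 1)) := Finset.prod_range_succ _ _

/-- `(1 - q ^ (d * p ^ i)) / (1 - q ^ (d * p ^ (i - 1)))`, and `1 - q ^ d` for `i = 0`. -/
def primePowFactor {R : Type*} [CommRing R] (q : R) (p d : ℕ) : ℕ → R
  | 0 => 1 - q ^ d
  | i + 1 => ∑ l ∈ Finset.range p, (q ^ (d * p ^ i)) ^ l

/-- The product telescopes; no cyclotomic polynomials are needed. -/
theorem prod_primePowFactor {R : Type*} [CommRing R] (q : R) (p d n : ℕ) :
    ∏ i ∈ Finset.range (n + 1), primePowFactor q p d i = 1 - q ^ (d * p ^ n) := by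
  induction n with
  | zero => simp [primePowFactor]
  | succ n ih =>
    rw [Finset.prod_range_succ, ih, primePowFactor, mul_neg_geom_sum, ← pow_mul, pow_succ, mul_assoc]

section Factorization

variable {p : ℕ} [hp : Fact p.Prime] {c : ℂ_[p]} {d v : ℕ}

theorem gaussBound_C_add_X {r : ℝ} (hr : 0 ≤ r) (hr1 : r ≤ 1) (hc : ‖c‖ = 1) :
    GaussBound r 1 (PowerSeries.C c + PowerSeries.X : ℂ_[p]⟦X⟧) := by
  have h1 : GaussBound r 1 (PowerSeries.X : ℂ_[p]⟦X⟧) := by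
    intro n
    rw [PowerSeries.coeff_X]
    split_ifs with h
    · simpa [h] using hr1
    · simp
  exact ((GaussBound.const c).mono hc.le).add hr h1

theorem gaussBound_one_sub_pow {r : ℝ} (hr : 0 ≤ r) (hr1 : r ≤ 1) (hc : ‖c‖ = 1) (k : ℕ) :
    GaussBound r 1 (1 - (PowerSeries.C c + PowerSeries.X : ℂ_[p]⟦X⟧) ^ k) := by
  have := (gaussBound_C_add_X hr hr1 hc).pow hr k
  rw [one_pow] at this
  exact GaussBound.one.sub hr this

theorem gaussBound_geom_sum {r : ℝ} (hr : 0 ≤ r) (hr1 : r ≤ 1) (hc : ‖c‖ = 1) (k n : ℕ) :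
    GaussBound r 1 (∑ l ∈ Finset.range n,
      ((PowerSeries.C c + PowerSeries.X : ℂ_[p]⟦X⟧) ^ k) ^ l) := by
  refine GaussBound.sum hr zero_le_one _ _ fun l _ => ?_
  have := (gaussBound_C_add_X hr hr1 hc).pow hr (k * l)
  rwa [one_pow, pow_mul] at this

/-- Raising `c^k` to the power `p^v` removes its p-primary part and leaves a nontrivial root of
unity of order prime to `p`. Its distance to 1 is one, and `1 - c^k` divides the corresponding
difference integrally. -/
theorem integralUnit_one_sub_pow (hc : IsPrimitiveRoot c (d * p ^ v)) (hd : p.Coprime d)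
    (hd0 : 0 < d) {k : ℕ} (hk : ¬ d ∣ k) :
    IntegralUnit (1 - (PowerSeries.C c + PowerSeries.X : ℂ_[p]⟦X⟧) ^ k) := by
  have hpv : 0 < p ^ v := pow_pos hp.out.pos v
  have hc1 : ‖c‖ = 1 := PadicComplex.norm_eq_one_of_pow_eq_one hc.pow_eq_one (by positivity)
  refine ⟨gaussBound_one_sub_pow zero_le_one le_rfl hc1 k, ?_⟩
  simp only [map_sub, map_one, map_pow, map_add, PowerSeries.constantCoeff_C,
    PowerSeries.constantCoeff_X, add_zero]
  have h1 : ‖1 - (c ^ k) ^ p ^ v‖ = 1 := by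
    refine norm_one_sub_eq_one_of_pow_eq_one (n := d) hd hd0.ne' ?_ ?_
    · rw [← pow_mul, ← pow_mul, show k * (p ^ v * d) = d * p ^ v * k by ring, pow_mul, hc.pow_eq_one,
        one_pow]
    · rw [← pow_mul]
      intro h
      exact hk (Nat.dvd_of_mul_dvd_mul_right hpv (hc.dvd_of_pow_eq_one _ h))
  have hck : ‖c ^ k‖ = 1 := by simp [hc1]
  refine le_antisymm (by simpa using norm_one_sub_le hck 1) ?_
  rw [← h1]
  exact norm_one_sub_pow_le hck _

theorem norm_one_sub_pow_lt_one (hc : IsPrimitiveRoot c (d * p ^ v)) {k : ℕ} (hk : d ∣ k) :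
    ‖1 - c ^ k‖ < 1 := by
  obtain ⟨l, rfl⟩ := hk
  refine norm_one_sub_lt_one_of_pow_prime_pow (k := v) ?_
  rw [← pow_mul, show d * l * p ^ v = d * p ^ v * l by ring, pow_mul, hc.pow_eq_one, one_pow]

/-- For `k = d p^j l'` with `l'` prime to `p`, the quotient of `1 - q^k` by `1 - q^(d p^j)` is a
geometric sum with unit constant term `≡ l'`, and the denominator telescopes into the factors of
level at most `j`. If `d ∤ k`, all of `1 - q^k` is a unit. The bound on `k` only guarantees that the
range reaches level `j`. -/
theorem exists_integralUnit_one_sub_pow (hc : IsPrimitiveRoot c (d * p ^ v)) (hd : p.Coprime d)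
    (hd0 : 0 < d) {k I : ℕ} (hk0 : k ≠ 0) (hk : k < p ^ (I + 1)) :
    ∃ u : ℂ_[p]⟦X⟧, IntegralUnit u ∧ 1 - (PowerSeries.C c + PowerSeries.X : ℂ_[p]⟦X⟧) ^ k =
      u * ∏ i ∈ Finset.range (I + 1), if d * p ^ i ∣ k then
        primePowFactor (PowerSeries.C c + PowerSeries.X : ℂ_[p]⟦X⟧) p d i else 1 := by
  have hpv : 0 < p ^ v := pow_pos hp.out.pos v
  have hc1 : ‖c‖ = 1 := PadicComplex.norm_eq_one_of_pow_eq_one hc.pow_eq_one (by positivity)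
  by_cases hdk : d ∣ k
  · obtain ⟨l, rfl⟩ := hdk
    have hl0 : l ≠ 0 := fun h => hk0 (by simp [h])
    obtain ⟨j, l', hl', rfl⟩ := Nat.exists_eq_pow_mul_and_not_dvd hl0 p hp.out.ne_one
    have hl'0 : l' ≠ 0 := fun h => hl0 (by simp [h])
    have hj : j ≤ I := by
      by_contra! hlt
      have : p ^ (I + 1) ≤ d * (p ^ j * l') :=
        (Nat.pow_le_pow_right hp.out.pos hlt).trans ((Nat.le_mul_of_pos_right _ (by omega)).trans
          (Nat.le_mul_of_pos_left _ hd0))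
      omega
    have hcop : p.Coprime l' := (Nat.Prime.coprime_iff_not_dvd hp.out).mpr hl'
    have hiff : ∀ i, (d * p ^ i ∣ d * (p ^ j * l')) ↔ i < j + 1 := by
      intro i
      rw [Nat.mul_dvd_mul_iff_left hd0, Nat.lt_succ_iff]
      constructor
      · intro h
        exact (Nat.pow_dvd_pow_iff_le_right hp.out.one_lt).mp
          ((Nat.Coprime.pow_left i hcop).dvd_of_dvd_mul_right h)
      · intro h
        exact (pow_dvd_pow p h).mul_right l'
    refine ⟨∑ l ∈ Finset.range l',
      ((PowerSeries.C c + PowerSeries.X : ℂ_[p]⟦X⟧) ^ (d * p ^ j)) ^ l,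
      ⟨gaussBound_geom_sum zero_le_one le_rfl hc1 _ _, ?_⟩, ?_⟩
    · simp only [map_sum, map_pow, map_add, PowerSeries.constantCoeff_C,
        PowerSeries.constantCoeff_X, add_zero]
      exact norm_geom_sum_eq_one (by simp [hc1]) (norm_one_sub_pow_lt_one hc (Dvd.intro _ rfl)) hcop
    · simp only [hiff, ← Finset.mem_range]
      rw [Finset.prod_ite_mem, Finset.inter_eq_right.mpr
        (Finset.range_subset_range.mpr (Nat.succ_le_succ hj)), prod_primePowFactor,
        geom_sum_mul_neg, ← pow_mul, mul_assoc]
  · refine ⟨_, integralUnit_one_sub_pow hc hd hd0 hdk, ?_⟩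
    rw [Finset.prod_eq_one, mul_one]
    intro i _
    rw [if_neg fun h => hdk ((Dvd.intro _ rfl).trans h)]

/-- A `q`-analogue of Legendre's formula: level `i` occurs once for every multiple of `d p^i` up to
`n`. -/
theorem exists_integralUnit_qFac (hc : IsPrimitiveRoot c (d * p ^ v)) (hd : p.Coprime d)
    (hd0 : 0 < d) {n I : ℕ} (hn : n < p ^ (I + 1)) :
    ∃ u : ℂ_[p]⟦X⟧, IntegralUnit u ∧ qFac (PowerSeries.C c + PowerSeries.X : ℂ_[p]⟦X⟧) n =
      u * ∏ i ∈ Finset.range (I + 1),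
        primePowFactor (PowerSeries.C c + PowerSeries.X : ℂ_[p]⟦X⟧) p d i ^ (n / (d * p ^ i)) := by
  induction n with
  | zero => exact ⟨1, IntegralUnit.one, by simp [qFac]⟩
  | succ n ih =>
    obtain ⟨u, hu, h1⟩ := ih (by omega)
    obtain ⟨u', hu', h2⟩ := exists_integralUnit_one_sub_pow hc hd hd0 (Nat.succ_ne_zero n) hn
    refine ⟨u * u', hu.mul hu', ?_⟩
    rw [qFac_succ, h1, h2, mul_mul_mul_comm, ← Finset.prod_mul_distrib]
    congr 1
    refine Finset.prod_congr rfl fun i _ => ?_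
    rw [Nat.succ_div]
    split_ifs <;> simp [pow_succ]

end Factorization

theorem coeff_C_add_X_pow {K : Type*} [Field K] (c : K) (k n : ℕ) :
    PowerSeries.coeff n ((PowerSeries.C c + PowerSeries.X : K⟦X⟧) ^ k) =
      c ^ (k - n) * (k.choose n : K) := by
  have : (PowerSeries.C c + PowerSeries.X : K⟦X⟧) ^ k =
      (((Polynomial.X + Polynomial.C c) ^ k : Polynomial K) : K⟦X⟧) := by
    simp [add_comm]
  rw [this, Polynomial.coeff_coe, Polynomial.coeff_X_add_C_pow]

theorem one_sub_C_add_X_pow_ne_zero {K : Type*} [Field K] (c : K) {k : ℕ} (hk : k ≠ 0) :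
    1 - (PowerSeries.C c + PowerSeries.X : K⟦X⟧) ^ k ≠ 0 := by
  intro h
  have h1 := congrArg (PowerSeries.coeff k) h
  rw [map_sub, PowerSeries.coeff_one, if_neg hk, coeff_C_add_X_pow] at h1
  simp at h1

theorem qFac_C_add_X_ne_zero {K : Type*} [Field K] (c : K) (n : ℕ) :
    qFac (PowerSeries.C c + PowerSeries.X : K⟦X⟧) n ≠ 0 :=
  Finset.prod_ne_zero_iff.mpr fun k _ => one_sub_C_add_X_pow_ne_zero c (Nat.succ_ne_zero k)

/-! ### Gauss norm bounds uniform in integral parameters -/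

section UniformBound

variable {p : ℕ} [hp : Fact p.Prime] {c : ℂ_[p]} {d v : ℕ}

theorem gaussBound_primePowFactor_one (hc1 : ‖c‖ = 1) {r : ℝ} (hr : 0 ≤ r) (hr1 : r ≤ 1) (i : ℕ) :
    GaussBound r 1 (primePowFactor (PowerSeries.C c + PowerSeries.X : ℂ_[p]⟦X⟧) p d i) := by
  cases i with
  | zero => exact gaussBound_one_sub_pow hr hr1 hc1 d
  | succ i => exact gaussBound_geom_sum hr hr1 hc1 _ _

/-- With `Q = q^(d p^i)`, the sum of the `p` powers of `Q` differs from `p` by a multiple of `1 -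
Q`. -/
theorem gaussBound_primePowFactor_succ (hc1 : ‖c‖ = 1) {r : ℝ} (hr : 0 ≤ r) (hr1 : r ≤ 1) {i : ℕ}
    {ρ : ℝ} (h : GaussBound r ρ (1 - (PowerSeries.C c + PowerSeries.X : ℂ_[p]⟦X⟧) ^ (d * p ^ i))) :
    GaussBound r (max (p : ℝ)⁻¹ ρ)
      (primePowFactor (PowerSeries.C c + PowerSeries.X : ℂ_[p]⟦X⟧) p d (i + 1)) := by
  set Q := (PowerSeries.C c + PowerSeries.X : ℂ_[p]⟦X⟧) ^ (d * p ^ i) with hQ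
  have e : primePowFactor (PowerSeries.C c + PowerSeries.X : ℂ_[p]⟦X⟧) p d (i + 1) =
      (p : ℂ_[p]⟦X⟧) - (1 - Q) * ∑ l ∈ Finset.range p, ∑ j ∈ Finset.range l, Q ^ j := by
    rw [Finset.mul_sum]
    simp only [mul_neg_geom_sum, Finset.sum_sub_distrib]
    simp [primePowFactor, ← hQ]
  rw [e]
  have h1 : GaussBound r (p : ℝ)⁻¹ (p : ℂ_[p]⟦X⟧) := by
    have := GaussBound.const (r := r) (p : ℂ_[p])
    rwa [map_natCast, PadicComplex.norm_p] at this
  have h2 : GaussBound r 1 (∑ l ∈ Finset.range p, ∑ j ∈ Finset.range l, Q ^ j) :=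
    GaussBound.sum hr zero_le_one _ _ fun l _ => gaussBound_geom_sum hr hr1 hc1 _ _
  have h3 := h.mul hr h2
  rw [mul_one] at h3
  exact (h1.mono (le_max_left _ _)).sub hr (h3.mono (le_max_right _ _))

/-- On a disc of radius `r < 1`, `1 - q^d` has norm at most some `θ < 1`, and each passage from
`q^(d p^i)` to its p-th power gains another factor `θ`. Once `1 - q^(d p^i)` is smaller than `p`,
the next factor has norm at most `1 / p`. -/
theorem exists_gaussBound_primePowFactor (hc : IsPrimitiveRoot c (d * p ^ v)) (hd0 : 0 < d)
    {r : ℝ} (hr : 0 < r) (hr1 : r < 1) :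
    ∃ i₀ : ℕ, ∀ i, i₀ ≤ i → GaussBound r (p : ℝ)⁻¹
      (primePowFactor (PowerSeries.C c + PowerSeries.X : ℂ_[p]⟦X⟧) p d i) := by
  have hpv : 0 < p ^ v := pow_pos hp.out.pos v
  have hc1 : ‖c‖ = 1 := PadicComplex.norm_eq_one_of_pow_eq_one hc.pow_eq_one (by positivity)
  have hp1 : (p : ℝ)⁻¹ < 1 := inv_lt_one_of_one_lt₀ (by exact_mod_cast hp.out.one_lt)
  have hp0 : 0 < (p : ℝ)⁻¹ := inv_pos.mpr (by exact_mod_cast hp.out.pos)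
  set θ : ℝ := max (p : ℝ)⁻¹ (max ‖1 - c ^ d‖ r) with hθ
  have hθ1 : θ < 1 := max_lt hp1 (max_lt (norm_one_sub_pow_lt_one hc dvd_rfl) hr1)
  have hθ0 : 0 < θ := hp0.trans_le (le_max_left _ _)
  have hD : ∀ i : ℕ, GaussBound r (θ ^ (i + 1))
      (1 - (PowerSeries.C c + PowerSeries.X : ℂ_[p]⟦X⟧) ^ (d * p ^ i)) := by
    intro i
    induction i with
    | zero =>
      intro n
      rw [pow_zero, mul_one, zero_add, pow_one]
      rcases Nat.eq_zero_or_pos n with rfl | hn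
      · rw [pow_zero, mul_one, PowerSeries.coeff_zero_eq_constantCoeff]
        simp only [map_sub, map_one, map_pow, map_add, PowerSeries.constantCoeff_C,
          PowerSeries.constantCoeff_X, add_zero]
        exact (le_max_left _ _).trans (le_max_right _ _)
      · have h1 := gaussBound_one_sub_pow (c := c) zero_le_one le_rfl hc1 d n
        rw [one_pow, mul_one] at h1
        calc _ ≤ 1 * r ^ n := mul_le_mul_of_nonneg_right h1 (by positivity)
          _ ≤ 1 * r ^ 1 := by
            rw [one_mul, one_mul]; exact pow_le_pow_of_le_one hr.le hr1.le hn
          _ ≤ θ := by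
            rw [one_mul, pow_one]; exact (le_max_right _ _).trans (le_max_right _ _)
    | succ i ih =>
      have h1 := gaussBound_primePowFactor_succ hc1 hr.le hr1.le ih
      have h2 := ih.mul hr.le (h1.mono (D := θ) (max_le (le_max_left _ _)
        (pow_le_of_le_one hθ0.le hθ1.le (Nat.succ_ne_zero _))))
      rw [← pow_succ] at h2
      convert h2 using 1
      rw [primePowFactor, mul_neg_geom_sum, ← pow_mul, pow_succ, mul_assoc]
  obtain ⟨N, hN⟩ := exists_pow_lt_of_lt_one hp0 hθ1
  refine ⟨N + 1, fun i hi => ?_⟩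
  obtain ⟨i, rfl⟩ : ∃ j, i = j + 1 := ⟨i - 1, by omega⟩
  refine (gaussBound_primePowFactor_succ hc1 hr.le hr1.le (hD i)).mono (max_le le_rfl ?_)
  exact (pow_le_pow_of_le_one hθ0.le hθ1.le (by omega)).trans hN.le

/-- A bound, depending only on the radius, for normalized products of the prime power factors. -/
theorem exists_gaussBound_prod (hc : IsPrimitiveRoot c (d * p ^ v)) (hd0 : 0 < d)
    {r : ℝ} (hr : 0 < r) (hr1 : r < 1) (v' : ℕ) :
    ∃ C : ℝ, ∀ (I : ℕ) (δ : ℕ → ℕ) (a : ℂ_[p]), (∀ i, δ i ≤ 1) →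
      ‖a‖ ≤ (p : ℝ) ^ v' * ∏ i ∈ Finset.range (I + 1), (p : ℝ) ^ δ i →
      GaussBound r C (PowerSeries.C a * ∏ i ∈ Finset.range (I + 1),
        primePowFactor (PowerSeries.C c + PowerSeries.X : ℂ_[p]⟦X⟧) p d i ^ δ i) := by
  obtain ⟨i₀, hi₀⟩ := exists_gaussBound_primePowFactor hc hd0 hr hr1
  have hpv : 0 < p ^ v := pow_pos hp.out.pos v
  have hc1 : ‖c‖ = 1 := PadicComplex.norm_eq_one_of_pow_eq_one hc.pow_eq_one (by positivity)
  have hp1 : (1 : ℝ) ≤ p := by exact_mod_cast hp.out.one_lt.le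
  have hp0 : (0 : ℝ) < p := by linarith
  -- From level `i₀` on, the bound `1 / p` for a factor cancels the power `p ^ δ i` allowed in `a`;
  -- only the first `i₀` levels contribute to `C`, at most `p` each.
  set β : ℕ → ℝ := fun i => if i < i₀ then 1 else (p : ℝ)⁻¹ with hβ
  have hβ0 : ∀ i, 0 ≤ β i := by intro i; simp only [hβ]; split_ifs <;> positivity
  refine ⟨(p : ℝ) ^ v' * (p : ℝ) ^ i₀, fun I δ a hδ ha => ?_⟩
  have h1 := (GaussBound.const (r := r) a).mul hr.le
    (GaussBound.prod hr.le (Finset.range (I + 1))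
      (fun i => primePowFactor (PowerSeries.C c + PowerSeries.X : ℂ_[p]⟦X⟧) p d i ^ δ i)
      (fun i => β i ^ δ i) (fun i _ => GaussBound.pow hr.le (by
        simp only [hβ]
        split_ifs with h
        · exact gaussBound_primePowFactor_one hc1 hr.le hr1.le i
        · exact hi₀ i (not_lt.mp h)) _))
  refine h1.mono ?_
  calc ‖a‖ * ∏ i ∈ Finset.range (I + 1), β i ^ δ i
      ≤ ((p : ℝ) ^ v' * ∏ i ∈ Finset.range (I + 1), (p : ℝ) ^ δ i) *
          ∏ i ∈ Finset.range (I + 1), β i ^ δ i :=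
        mul_le_mul_of_nonneg_right ha (Finset.prod_nonneg fun i _ => pow_nonneg (hβ0 i) _)
    _ = (p : ℝ) ^ v' * ∏ i ∈ Finset.range (I + 1), (p * β i) ^ δ i := by
        rw [mul_assoc, ← Finset.prod_mul_distrib]
        simp only [mul_pow]
    _ ≤ (p : ℝ) ^ v' * ∏ i ∈ Finset.range (I + 1), (if i ∈ Finset.range i₀ then (p : ℝ) else 1) := by
        refine mul_le_mul_of_nonneg_left (Finset.prod_le_prod
          (fun i _ => pow_nonneg (mul_nonneg hp0.le (hβ0 i)) _) fun i _ => ?_) (by positivity)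
        have := hδ i
        simp only [hβ, Finset.mem_range]
        split_ifs
        · rw [mul_one]; exact (pow_le_pow_right₀ hp1 this).trans (pow_one _).le
        · rw [mul_inv_cancel₀ hp0.ne', one_pow]
    _ ≤ (p : ℝ) ^ v' * (p : ℝ) ^ i₀ := by
        refine mul_le_mul_of_nonneg_left ?_ (by positivity)
        rw [Finset.prod_ite_mem, Finset.prod_const]
        refine pow_le_pow_right₀ hp1 ?_
        exact (Finset.card_le_card Finset.inter_subset_right).trans (by simp)

/-- `Γ(A + B + 2) / (Γ(A + 1) Γ(B + 1))` as a rational number. -/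
def betaConst (A B : ℕ) : ℚ :=
  ((A + B + 1).factorial : ℚ) / ((A.factorial : ℚ) * (B.factorial : ℚ))

theorem norm_factorial_eq {n b : ℕ} (h : n < p ^ b) :
    ‖((n.factorial : ℕ) : ℂ_[p])‖ = ∏ i ∈ Finset.Ico 1 b, ((p : ℝ)⁻¹) ^ (n / p ^ i) := by
  rw [PadicComplex.norm_natCast_eq, Finset.prod_pow_eq_pow_sum]
  have h0 : ((n.factorial : ℕ) : ℚ_[p]) ≠ 0 := by exact_mod_cast n.factorial_ne_zero
  rw [Padic.norm_eq_zpow_neg_valuation h0, Padic.valuation_natCast, zpow_neg, inv_pow,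
    zpow_natCast]
  rcases Nat.eq_zero_or_pos n with rfl | hn
  · simp
  · rw [padicValNat_factorial (Nat.log_lt_of_lt_pow hn.ne' h)]

/-- Legendre's formula for the three factorials, together with `⌊(a + b + 1) / m⌋ ≤ ⌊a / m⌋ + ⌊b /
m⌋ + 1`. The exponents on the right are carries at the levels `m p^i`. -/
theorem norm_betaConst_le {a b m n : ℕ} (hm : 0 < m) (h : a + b + 1 < p ^ (n + 1)) :
    ‖(betaConst (a / m) (b / m) : ℂ_[p])‖ ≤ ∏ i ∈ Finset.Ico 1 (n + 1),
      ((p : ℝ)⁻¹) ^ ((a + b + 1) / (m * p ^ i) - a / (m * p ^ i) - b / (m * p ^ i)) := by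
  have h1 : a / m + b / m + 1 < p ^ (n + 1) := by
    have := Nat.div_le_self a m
    have := Nat.div_le_self b m
    omega
  have hp0 : (0 : ℝ) < (p : ℝ)⁻¹ := inv_pos.mpr (by exact_mod_cast hp.out.pos)
  have hp1 : (p : ℝ)⁻¹ ≤ 1 := inv_le_one_of_one_le₀ (by exact_mod_cast hp.out.one_lt.le)
  have h6 : a / m < p ^ (n + 1) := (Nat.div_le_self a m).trans_lt (by omega)
  have h7 : b / m < p ^ (n + 1) := (Nat.div_le_self b m).trans_lt (by omega)
  rw [betaConst]
  push_cast
  rw [norm_div, norm_mul, norm_factorial_eq h1, norm_factorial_eq h6, norm_factorial_eq h7, ← Finset.prod_mul_distrib, ← Finset.prod_div_distrib]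
  refine Finset.prod_le_prod (fun i _ => by positivity) fun i _ => ?_
  rw [← Nat.div_div_eq_div_mul, ← Nat.div_div_eq_div_mul, ← Nat.div_div_eq_div_mul, ← pow_add,
    div_le_iff₀ (by positivity), ← pow_add]
  refine pow_le_pow_of_le_one hp0.le hp1 ?_
  have h2 : (a + b + 1) / m ≤ a / m + b / m + 1 := by
    rw [Nat.div_le_iff_le_mul_add_pred hm]
    have := Nat.div_add_mod a m
    have := Nat.div_add_mod b m
    have := Nat.mod_lt a hm
    have := Nat.mod_lt b hm
    rw [mul_add, mul_add]
    omega
  have h3 := Nat.div_le_div_right (c := p ^ i) h2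
  have h4 := Nat.div_add_div_le_add_div (x := a / m) (y := b / m + 1) (z := p ^ i)
  rw [← add_assoc] at h4
  have h5 : b / m / p ^ i ≤ (b / m + 1) / p ^ i := Nat.div_le_div_right (by omega)
  omega

/-- The normalized `q`-beta function with positive integral parameters `a + 1`, `b + 1`, multiplied
by an approximation of the logarithm, has Gauss norms bounded independently of `a`, `b`. -/
theorem exists_gaussBound_qBeta (hc : IsPrimitiveRoot c (d * p ^ v)) (hd : p.Coprime d)
    (hd0 : 0 < d) {r : ℝ} (hr : 0 < r) (hr1 : r < 1) :
    ∃ C : ℝ, ∀ a b n : ℕ, a + b + 1 < p ^ (n + 1) → ∀ f : ℂ_[p]⟦X⟧,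
      qFac (PowerSeries.C c + PowerSeries.X : ℂ_[p]⟦X⟧) (a + b + 1) * f =
        PowerSeries.C ((betaConst (a / (d * p ^ v)) (b / (d * p ^ v)) : ℂ_[p]) /
            ((d * p ^ (v + n) : ℕ) : ℂ_[p])) *
          (1 - (PowerSeries.C c + PowerSeries.X : ℂ_[p]⟦X⟧) ^ (d * p ^ (v + n))) *
          qFac (PowerSeries.C c + PowerSeries.X) a * qFac (PowerSeries.C c + PowerSeries.X) b →
      GaussBound r C f := by
  obtain ⟨C, hC⟩ := exists_gaussBound_prod hc hd0 hr hr1 v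
  refine ⟨C, fun a b n hn f hf => ?_⟩
  have hpv : 0 < p ^ v := pow_pos hp.out.pos v
  have hp0 : (0 : ℝ) < p := by exact_mod_cast hp.out.pos
  have hp1 : (1 : ℝ) ≤ p := by exact_mod_cast hp.out.one_lt.le
  set q := (PowerSeries.C c + PowerSeries.X : ℂ_[p]⟦X⟧) with hq
  have hI : a + b + 1 < p ^ (v + n + 1) :=
    hn.trans_le (Nat.pow_le_pow_right hp.out.pos (by omega))
  obtain ⟨u₁, hu₁, e₁⟩ := exists_integralUnit_qFac hc hd hd0 hI
  obtain ⟨u₂, hu₂, e₂⟩ := exists_integralUnit_qFac hc hd hd0 (n := a) (I := v + n) (by omega)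
  obtain ⟨u₃, hu₃, e₃⟩ := exists_integralUnit_qFac hc hd hd0 (n := b) (I := v + n) (by omega)
  obtain ⟨u, hu, e⟩ := (hu₂.mul hu₃).exists_mul_eq hu₁
  set Ψ := primePowFactor q p d with hΨ
  -- The exponent of level `i` in `f`: the summand 1 comes from `1 - q^(d p^(v+n))`, the quotients
  -- from the three `qFac`s. It is 0 or 1.
  set δ : ℕ → ℕ := fun i =>
    1 + a / (d * p ^ i) + b / (d * p ^ i) - (a + b + 1) / (d * p ^ i) with hδ
  have hle : ∀ i, (a + b + 1) / (d * p ^ i) ≤ 1 + a / (d * p ^ i) + b / (d * p ^ i) := by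
    intro i
    have hD : 0 < d * p ^ i := Nat.mul_pos hd0 (pow_pos hp.out.pos i)
    generalize d * p ^ i = D at hD
    rw [Nat.div_le_iff_le_mul_add_pred hD]
    have := Nat.div_add_mod a D
    have := Nat.div_add_mod b D
    have := Nat.mod_lt a hD
    have := Nat.mod_lt b hD
    rw [mul_add, mul_add]
    omega
  have hδ1 : ∀ i, δ i ≤ 1 := by
    intro i
    have h1 := Nat.div_add_div_le_add_div (x := a) (y := b) (z := d * p ^ i)
    have h2 : (a + b) / (d * p ^ i) ≤ (a + b + 1) / (d * p ^ i) := Nat.div_le_div_right (by omega)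
    simp only [hδ]
    omega
  set κ : ℂ_[p] := (betaConst (a / (d * p ^ v)) (b / (d * p ^ v)) : ℂ_[p]) /
            ((d * p ^ (v + n) : ℕ) : ℂ_[p]) with hκ
  have hf' : f = u * (PowerSeries.C κ * ∏ i ∈ Finset.range (v + n + 1), Ψ i ^ δ i) := by
    refine mul_left_cancel₀ (qFac_C_add_X_ne_zero c (a + b + 1)) ?_
    rw [hf, e₁, e₂, e₃, ← prod_primePowFactor]
    have h1 : (∏ i ∈ Finset.range (v + n + 1), Ψ i) *
        (∏ i ∈ Finset.range (v + n + 1), Ψ i ^ (a / (d * p ^ i))) *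
        (∏ i ∈ Finset.range (v + n + 1), Ψ i ^ (b / (d * p ^ i))) =
        (∏ i ∈ Finset.range (v + n + 1), Ψ i ^ ((a + b + 1) / (d * p ^ i))) *
        ∏ i ∈ Finset.range (v + n + 1), Ψ i ^ δ i := by
      simp only [← Finset.prod_mul_distrib]
      refine Finset.prod_congr rfl fun i _ => ?_
      rw [← pow_add, Nat.add_sub_cancel' (hle i), pow_add, pow_add, pow_one]
    linear_combination PowerSeries.C κ * (u₂ * u₃) * h1 - PowerSeries.C κ * e *
      (∏ i ∈ Finset.range (v + n + 1), Ψ i ^ ((a + b + 1) / (d * p ^ i))) *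
      ∏ i ∈ Finset.range (v + n + 1), Ψ i ^ δ i
  rw [hf']
  have h2 := (hu.1.of_one hr.le hr1.le).mul hr.le (hC (v + n) δ κ hδ1 ?_)
  · rwa [one_mul] at h2
  have hκn : ‖κ‖ = ‖(betaConst (a / (d * p ^ v)) (b / (d * p ^ v)) : ℂ_[p])‖ *
      (p : ℝ) ^ (v + n) := by
    rw [hκ, norm_div, Nat.cast_mul, norm_mul, PadicComplex.norm_natCast_of_coprime hd, one_mul,
      Nat.cast_pow, norm_pow, PadicComplex.norm_p, inv_pow, div_inv_eq_mul]
  rw [hκn]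
  calc _ ≤ (∏ i ∈ Finset.Ico 1 (n + 1), ((p : ℝ)⁻¹) ^ ((a + b + 1) / (d * p ^ v * p ^ i) -
          a / (d * p ^ v * p ^ i) - b / (d * p ^ v * p ^ i))) * (p : ℝ) ^ (v + n) :=
        mul_le_mul_of_nonneg_right (norm_betaConst_le (Nat.mul_pos hd0 hpv) hn) (by positivity)
    _ = (p : ℝ) ^ v * ∏ i ∈ Finset.Ico 1 (n + 1), ((p : ℝ) * ((p : ℝ)⁻¹) ^
          ((a + b + 1) / (d * p ^ v * p ^ i) -
            a / (d * p ^ v * p ^ i) - b / (d * p ^ v * p ^ i))) := by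
        rw [Finset.prod_mul_distrib, Finset.prod_const, Nat.card_Ico, Nat.add_sub_cancel, pow_add]
        ring
    _ ≤ (p : ℝ) ^ v * ∏ i ∈ Finset.Ico 1 (n + 1), (p : ℝ) ^ δ (v + i) := by
        refine mul_le_mul_of_nonneg_left (Finset.prod_le_prod (fun i _ => by positivity)
          fun i _ => ?_) (by positivity)
        have hd1 := hδ1 (v + i)
        have hl := hle (v + i)
        have h1 := Nat.div_add_div_le_add_div (x := a) (y := b) (z := d * p ^ (v + i))
        have h2 : (a + b) / (d * p ^ (v + i)) ≤ (a + b + 1) / (d * p ^ (v + i)) :=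
          Nat.div_le_div_right (by omega)
        -- At each level exactly one of two things happens: the factor survives (`δ = 1`), or it has
        -- been cancelled and there is a carry, which puts a `p` into `betaConst`. So one power of
        -- `p` in the denominator is always accounted for.
        have hsum : δ (v + i) + ((a + b + 1) / (d * p ^ (v + i)) -
            a / (d * p ^ (v + i)) - b / (d * p ^ (v + i))) = 1 := by
          simp only [hδ] at hd1 ⊢
          omega
        rw [mul_assoc d, ← pow_add]
        refine le_of_eq ?_
        generalize (a + b + 1) / (d * p ^ (v + i)) -
            a / (d * p ^ (v + i)) - b / (d * p ^ (v + i)) = E at hsum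
        have h3 : (p : ℝ) = (p : ℝ) ^ δ (v + i) * (p : ℝ) ^ E := by
          rw [← pow_add, hsum, pow_one]
        rw [show (p : ℝ) * (p : ℝ)⁻¹ ^ E = (p : ℝ) ^ δ (v + i) * (p : ℝ) ^ E * (p : ℝ)⁻¹ ^ E by
          rw [← h3], mul_assoc, ← mul_pow, mul_inv_cancel₀ hp0.ne', one_pow, mul_one]
    _ ≤ (p : ℝ) ^ v * ∏ i ∈ Finset.range (v + n + 1), (p : ℝ) ^ δ i := by
        refine mul_le_mul_of_nonneg_left ?_ (by positivity)
        rw [add_assoc v n 1, Finset.prod_range_add, Finset.range_eq_Ico (a := n + 1),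
          Finset.prod_eq_prod_Ico_succ_bot (Nat.succ_pos n), ← mul_assoc]
        refine le_mul_of_one_le_left (Finset.prod_nonneg fun i _ => by positivity) ?_
        rw [Finset.prod_pow_eq_pow_sum]
        exact one_le_mul_of_one_le_of_one_le (one_le_pow₀ hp1) (one_le_pow₀ hp1)

end UniformBound

/-! ### Polynomial approximation of the logarithm and the p-adic limit -/

section LogApprox

/-- The expansion of `(q ^ n - 1) / n` at `q = c`. -/
noncomputable def logApprox {K : Type*} [Field K] (c : K) (n : ℕ) : K⟦X⟧ :=
  PowerSeries.C (n : K)⁻¹ * ((PowerSeries.C c + PowerSeries.X) ^ n - 1)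

theorem coeff_zero_logApprox {K : Type*} [Field K] {c : K} {n : ℕ} (hc : c ^ n = 1) :
    PowerSeries.coeff 0 (logApprox c n) = 0 := by
  simp [logApprox, hc]

variable {p : ℕ} [hp : Fact p.Prime]

/-- As `k → 0` p-adically, `binom(k, n) / k` tends to `(-1)^(n+1) / n` for `n ≥ 1`, and `c^(k-n) =
c^(-n)` because `c^k = 1`. -/
theorem tendsto_coeff_logApprox {c : ℂ_[p]} {k : ℕ → ℕ} (hk0 : ∀ j, k j ≠ 0)
    (hk : Tendsto (fun j => (k j : ℂ_[p])) atTop (𝓝 0)) (hc : ∀ j, c ^ k j = 1) (n : ℕ) :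
    Tendsto (fun j => PowerSeries.coeff n (logApprox c (k j))) atTop
      (𝓝 (PowerSeries.coeff n (logAt c))) := by
  have hc0 : c ≠ 0 := by
    intro h
    have := hc 0
    rw [h, zero_pow (hk0 0)] at this
    exact zero_ne_one this
  rcases Nat.eq_zero_or_pos n with rfl | hn
  · simp only [coeff_zero_logApprox (hc _)]
    simp [logAt]
  · obtain ⟨n, rfl⟩ : ∃ l, n = l + 1 := ⟨n - 1, by omega⟩
    have e : ∀ j, PowerSeries.coeff (n + 1) (logApprox c (k j)) =
        c⁻¹ ^ (n + 1) * (((k j).choose (n + 1) : ℂ_[p]) / (k j : ℂ_[p])) := by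
      intro j
      rw [logApprox, PowerSeries.coeff_C_mul, map_sub, coeff_C_add_X_pow, PowerSeries.coeff_one,
        if_neg (Nat.succ_ne_zero n), sub_zero]
      rcases lt_or_ge (k j) (n + 1) with h | h
      · simp [Nat.choose_eq_zero_of_lt h]
      · have : c ^ (k j - (n + 1)) = c⁻¹ ^ (n + 1) := by
          rw [pow_sub₀ c hc0 h, hc j, one_mul, inv_pow]
        rw [this]; ring
    have key : Tendsto (fun j => ((k j).choose (n + 1) : ℂ_[p]) / (k j : ℂ_[p])) atTop
        (𝓝 ((-1) ^ (n + 1 + 1) / ((n + 1 : ℕ) : ℂ_[p]))) := by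
      clear e hn
      induction n with
      | zero =>
        have : ∀ j, ((k j).choose (0 + 1) : ℂ_[p]) / (k j : ℂ_[p]) = 1 := by
          intro j
          rw [zero_add, Nat.choose_one_right, div_self (by exact_mod_cast hk0 j)]
        have h1 : (-1 : ℂ_[p]) ^ (0 + 1 + 1) / ((0 + 1 : ℕ) : ℂ_[p]) = 1 := by norm_num
        rw [h1]
        exact tendsto_const_nhds.congr fun j => (this j).symm
      | succ n ih =>
        have h1 : ∀ j, ((k j).choose (n + 1 + 1) : ℂ_[p]) / (k j : ℂ_[p]) =
            ((k j).choose (n + 1) : ℂ_[p]) / (k j : ℂ_[p]) *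
              (((k j : ℂ_[p]) - ((n + 1 : ℕ) : ℂ_[p])) / ((n + 1 + 1 : ℕ) : ℂ_[p])) := by
          intro j
          have h2 : ((k j).choose (n + 1 + 1) : ℂ_[p]) * ((n + 1 + 1 : ℕ) : ℂ_[p]) =
              ((k j).choose (n + 1) : ℂ_[p]) * ((k j : ℂ_[p]) - ((n + 1 : ℕ) : ℂ_[p])) := by
            have := Nat.choose_succ_right_eq (k j) (n + 1)
            rcases lt_or_ge (k j) (n + 1) with h | h
            · simp [Nat.choose_eq_zero_of_lt h, Nat.choose_eq_zero_of_lt (h.trans (Nat.lt_succ_self _))]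
            · rw [← Nat.cast_sub h]
              exact_mod_cast this
          have h3 : ((n + 1 + 1 : ℕ) : ℂ_[p]) ≠ 0 := Nat.cast_ne_zero.mpr (by omega)
          rw [div_mul_div_comm, ← h2, mul_div_mul_right _ _ h3]
        simp only [h1]
        have h4 := ih.mul ((hk.sub_const ((n + 1 : ℕ) : ℂ_[p])).div_const ((n + 1 + 1 : ℕ) : ℂ_[p]))
        convert h4 using 2
        have h3 : ((n + 1 + 1 : ℕ) : ℂ_[p]) ≠ 0 := Nat.cast_ne_zero.mpr (by omega)
        have h5 : ((n + 1 : ℕ) : ℂ_[p]) ≠ 0 := Nat.cast_ne_zero.mpr (by omega)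
        field_simp
        ring
    simp only [e]
    have h6 := key.const_mul (c⁻¹ ^ (n + 1))
    convert h6 using 2
    rw [logAt, PowerSeries.coeff_mk, if_neg (Nat.succ_ne_zero n), mul_comm]

variable {d v : ℕ}

theorem exists_gaussBound_logApprox {c : ℂ_[p]} (hc : IsPrimitiveRoot c (d * p ^ v))
    (hd : p.Coprime d) (hd0 : 0 < d) {r : ℝ} (hr : 0 < r) (hr1 : r < 1) :
    ∃ C : ℝ, ∀ n : ℕ, GaussBound r C (logApprox c (d * p ^ n)) := by
  obtain ⟨C, hC⟩ := exists_gaussBound_prod hc hd0 hr hr1 0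
  refine ⟨C, fun n => ?_⟩
  have h1 := hC n (fun _ => 1) ((d * p ^ n : ℕ) : ℂ_[p])⁻¹ (fun _ => le_rfl) ?_
  · simp only [pow_one] at h1
    rw [prod_primePowFactor] at h1
    convert h1.neg using 1
    rw [logApprox]; ring
  · have hp1 : (1 : ℝ) ≤ p := by exact_mod_cast hp.out.one_lt.le
    rw [norm_inv, Nat.cast_mul, norm_mul, PadicComplex.norm_natCast_of_coprime hd, one_mul,
      Nat.cast_pow, norm_pow, PadicComplex.norm_p, inv_pow, inv_inv, pow_zero, one_mul,
      Finset.prod_const, Finset.card_range, pow_one]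
    exact pow_le_pow_right₀ hp1 (Nat.le_succ n)

theorem IsPrimitiveRoot.pow_mul_prime_pow {c : ℂ_[p]} (hc : IsPrimitiveRoot c (d * p ^ v)) {n : ℕ}
    (hn : v ≤ n) : c ^ (d * p ^ n) = 1 := by
  obtain ⟨l, rfl⟩ := Nat.exists_eq_add_of_le hn
  rw [pow_add, ← mul_assoc, pow_mul, hc.pow_eq_one, one_pow]

theorem tendsto_natCast_mul_prime_pow {n : ℕ → ℕ} (hn : Tendsto n atTop atTop) :
    Tendsto (fun j => ((d * p ^ n j : ℕ) : ℂ_[p])) atTop (𝓝 0) := by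
  have hp1 : ‖(p : ℂ_[p])‖ < 1 := by
    rw [PadicComplex.norm_p]
    exact inv_lt_one_of_one_lt₀ (by exact_mod_cast hp.out.one_lt)
  have := ((tendsto_pow_atTop_nhds_zero_of_norm_lt_one hp1).comp hn).const_mul (d : ℂ_[p])
  simpa using this

theorem aeval_polynomial_logApprox {c : ℂ_[p]} (n : ℕ) :
    Polynomial.aeval (PowerSeries.C c + PowerSeries.X : ℂ_[p]⟦X⟧)
      (Polynomial.C ((n : ℂ_[p])⁻¹) * (Polynomial.X ^ n - 1)) = logApprox c n := by
  rw [logApprox]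
  simp only [map_mul, map_sub, map_pow, Polynomial.aeval_C, Polynomial.aeval_X, map_one]
  rfl

/-- Both logarithms are limits of the same polynomials `(q^k - 1) / k`, expanded at the two centres;
the exponents `k = d p^(v + v' + j)` kill both roots of unity. -/
theorem isReexpansion_logAt {c c' : ℂ_[p]} {v' : ℕ} (hc : IsPrimitiveRoot c (d * p ^ v))
    (hc' : IsPrimitiveRoot c' (d * p ^ v')) (hd : p.Coprime d) (hd0 : 0 < d)
    (hδ : ‖c' - c‖ < 1) :
    (∀ r : ℝ, 0 < r → r < 1 → ∃ C, GaussBound r C (logAt c)) ∧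
      IsReexpansion (c' - c) (logAt c) (logAt c') := by
  have hn : Tendsto (fun j : ℕ => v + v' + j) atTop atTop :=
    tendsto_atTop_mono (fun j => Nat.le_add_left j _) tendsto_id
  have hk0 : ∀ j, d * p ^ (v + v' + j) ≠ 0 := fun j =>
    (Nat.mul_pos hd0 (pow_pos hp.out.pos _)).ne'
  refine IsReexpansion.of_tendsto hδ (F := fun j => logApprox c (d * p ^ (v + v' + j)))
    (F' := fun j => logApprox c' (d * p ^ (v + v' + j))) ?_ ?_ ?_ ?_
  · intro r h0 h1
    obtain ⟨C, hC⟩ := exists_gaussBound_logApprox hc hd hd0 h0 h1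
    exact ⟨C, fun j => hC _⟩
  · intro j
    have := isReexpansion_aeval (δ := c' - c) c (Polynomial.C
      (((d * p ^ (v + v' + j) : ℕ) : ℂ_[p])⁻¹) * (Polynomial.X ^ (d * p ^ (v + v' + j)) - 1))
    rwa [add_sub_cancel, aeval_polynomial_logApprox, aeval_polynomial_logApprox] at this
  · exact tendsto_coeff_logApprox hk0 (tendsto_natCast_mul_prime_pow hn)
      fun j => hc.pow_mul_prime_pow (by omega)
  · exact tendsto_coeff_logApprox hk0 (tendsto_natCast_mul_prime_pow hn)
      fun j => hc'.pow_mul_prime_pow (by omega)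

/-- If `f` has vanishing constant coefficient, the quotient `f / X`. -/
noncomputable def PowerSeries.shiftDown {K : Type*} [Field K] (f : K⟦X⟧) : K⟦X⟧ :=
  PowerSeries.mk fun n => PowerSeries.coeff (n + 1) f

theorem PowerSeries.X_mul_shiftDown {K : Type*} [Field K] {f : K⟦X⟧}
    (hf : PowerSeries.coeff 0 f = 0) : PowerSeries.X * PowerSeries.shiftDown f = f := by
  ext n
  cases n with
  | zero => rw [PowerSeries.coeff_zero_X_mul, hf]
  | succ n => rw [PowerSeries.coeff_succ_X_mul, shiftDown, PowerSeries.coeff_mk]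

theorem tendsto_coeff_mul {F G : ℕ → ℂ_[p]⟦X⟧} {f g : ℂ_[p]⟦X⟧}
    (hF : ∀ n, Tendsto (fun j => PowerSeries.coeff n (F j)) atTop (𝓝 (PowerSeries.coeff n f)))
    (hG : ∀ n, Tendsto (fun j => PowerSeries.coeff n (G j)) atTop (𝓝 (PowerSeries.coeff n g)))
    (n : ℕ) : Tendsto (fun j => PowerSeries.coeff n (F j * G j)) atTop
      (𝓝 (PowerSeries.coeff n (f * g))) := by
  simp only [PowerSeries.coeff_mul]
  exact tendsto_finsetSum _ fun x _ => (hF x.1).mul (hG x.2)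

/-- The re-expansion of limits of normalized `q`-beta functions with integral parameters. -/
theorem isReexpansion_log_mul_of_tendsto {c c' : ℂ_[p]} {v' : ℕ}
    (hc : IsPrimitiveRoot c (d * p ^ v)) (hc' : IsPrimitiveRoot c' (d * p ^ v'))
    (hd : p.Coprime d) (hd0 : 0 < d) (hδ : ‖c' - c‖ < 1) {a b : ℕ → ℕ} {κ' : ℕ → ℂ_[p]}
    (hκ' : ∀ j, κ' j ≠ 0) {B B' : ℕ → ℂ_[p]⟦X⟧} {b₀ b₀' : ℂ_[p]⟦X⟧} {κ₀ : ℂ_[p]}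
    (hB : ∀ j, qFac (PowerSeries.C c + PowerSeries.X : ℂ_[p]⟦X⟧) (a j + b j + 1) * B j =
      PowerSeries.C ((betaConst (a j / (d * p ^ v)) (b j / (d * p ^ v)) : ℂ_[p])) * PowerSeries.X *
        qFac (PowerSeries.C c + PowerSeries.X) (a j) * qFac (PowerSeries.C c + PowerSeries.X) (b j))
    (hB' : ∀ j, qFac (PowerSeries.C c' + PowerSeries.X : ℂ_[p]⟦X⟧) (a j + b j + 1) * B' j =
      PowerSeries.C (κ' j) * PowerSeries.X * qFac (PowerSeries.C c' + PowerSeries.X) (a j) *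
        qFac (PowerSeries.C c' + PowerSeries.X) (b j))
    (hlim : ∀ n, Tendsto (fun j => PowerSeries.coeff n (B j)) atTop (𝓝 (PowerSeries.coeff n b₀)))
    (hlim' : ∀ n, Tendsto (fun j => PowerSeries.coeff n (B' j)) atTop
      (𝓝 (PowerSeries.coeff n b₀')))
    (hκ : Tendsto (fun j => (betaConst (a j / (d * p ^ v)) (b j / (d * p ^ v)) : ℂ_[p]) / κ' j)
      atTop (𝓝 κ₀)) :
    ∃ f f' : ℂ_[p]⟦X⟧, PowerSeries.X * f = logAt c * b₀ ∧
      PowerSeries.X * f' = PowerSeries.C κ₀ * (logAt c' * b₀') ∧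
      ConvergesOnUnitDisc f ∧ IsReexpansion (c' - c) f f' := by
  -- The summands ensure in turn that `c' ^ k j = 1`, that `a j + b j + 1 < p ^ (n j + 1)` as the
  -- uniform bound requires, and that `n j → ∞`.
  set n : ℕ → ℕ := fun j => v' + (a j + b j + 1 + j) with hn
  set k : ℕ → ℕ := fun j => d * p ^ (v + n j) with hk
  have hn' : Tendsto (fun j => v + n j) atTop atTop :=
    tendsto_atTop_mono (fun j => by simp only [hn, id]; omega) tendsto_id
  have hk0 : ∀ j, k j ≠ 0 := fun j => (Nat.mul_pos hd0 (pow_pos hp.out.pos _)).ne'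
  have hkc : ∀ j, c ^ k j = 1 := fun j => hc.pow_mul_prime_pow (by omega)
  have hkc' : ∀ j, c' ^ k j = 1 := fun j => hc'.pow_mul_prime_pow (by simp only [hn]; omega)
  have hL := tendsto_coeff_logApprox hk0 (tendsto_natCast_mul_prime_pow hn') hkc
  have hL' := tendsto_coeff_logApprox hk0 (tendsto_natCast_mul_prime_pow hn') hkc'
  set F : ℕ → ℂ_[p]⟦X⟧ := fun j => PowerSeries.shiftDown (logApprox c (k j)) * B j with hF
  set F' : ℕ → ℂ_[p]⟦X⟧ := fun j => PowerSeries.C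
    ((betaConst (a j / (d * p ^ v)) (b j / (d * p ^ v)) : ℂ_[p]) / κ' j) *
      (PowerSeries.shiftDown (logApprox c' (k j)) * B' j) with hF'
  have hqF : ∀ j, qFac (PowerSeries.C c + PowerSeries.X : ℂ_[p]⟦X⟧) (a j + b j + 1) * F j =
      PowerSeries.C ((betaConst (a j / (d * p ^ v)) (b j / (d * p ^ v)) : ℂ_[p])) *
        logApprox c (k j) * qFac (PowerSeries.C c + PowerSeries.X) (a j) *
          qFac (PowerSeries.C c + PowerSeries.X) (b j) := by
    intro j
    have h1 := hB j
    have h2 := PowerSeries.X_mul_shiftDown (coeff_zero_logApprox (hkc j))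
    simp only [hF]
    linear_combination PowerSeries.shiftDown (logApprox c (k j)) * h1 +
      PowerSeries.C (betaConst (a j / (d * p ^ v)) (b j / (d * p ^ v)) : ℂ_[p]) *
        qFac (PowerSeries.C c + PowerSeries.X) (a j) *
          qFac (PowerSeries.C c + PowerSeries.X) (b j) * h2
  have hqF' : ∀ j, qFac (PowerSeries.C c' + PowerSeries.X : ℂ_[p]⟦X⟧) (a j + b j + 1) * F' j =
      PowerSeries.C ((betaConst (a j / (d * p ^ v)) (b j / (d * p ^ v)) : ℂ_[p])) *
        logApprox c' (k j) * qFac (PowerSeries.C c' + PowerSeries.X) (a j) *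
          qFac (PowerSeries.C c' + PowerSeries.X) (b j) := by
    intro j
    have h1 := hB' j
    have h2 := PowerSeries.X_mul_shiftDown (coeff_zero_logApprox (hkc' j))
    have h3 : PowerSeries.C
        ((betaConst (a j / (d * p ^ v)) (b j / (d * p ^ v)) : ℂ_[p]) / κ' j) *
        PowerSeries.C (κ' j) =
        PowerSeries.C (betaConst (a j / (d * p ^ v)) (b j / (d * p ^ v)) : ℂ_[p]) := by
      rw [← map_mul, div_mul_cancel₀ _ (hκ' j)]
    simp only [hF']
    rw [← h3]
    linear_combination PowerSeries.C
      ((betaConst (a j / (d * p ^ v)) (b j / (d * p ^ v)) : ℂ_[p]) / κ' j) *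
        (PowerSeries.shiftDown (logApprox c' (k j)) * h1 + PowerSeries.C (κ' j) *
          qFac (PowerSeries.C c' + PowerSeries.X) (a j) *
            qFac (PowerSeries.C c' + PowerSeries.X) (b j) * h2)
  have hbd : ∀ r : ℝ, 0 < r → r < 1 → ∃ C, ∀ j, GaussBound r C (F j) := by
    intro r h0 h1
    obtain ⟨C, hC⟩ := exists_gaussBound_qBeta hc hd hd0 h0 h1
    refine ⟨C, fun j => ?_⟩
    have h2 := hC (a j) (b j) (n j) ?_ (-F j) ?_
    · simpa using h2.neg
    · refine (Nat.lt_pow_self hp.out.one_lt).trans_le (Nat.pow_le_pow_right hp.out.pos ?_)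
      simp only [hn]; omega
    · rw [mul_neg, hqF j, logApprox, div_eq_mul_inv, map_mul]
      ring
  -- The bound gives some re-expansion `G` of `F j`. Multiplied by `qFac`, it must equal the
  -- expansion at `c'` of a polynomial in `q`, as does `F' j`; cancelling `qFac` gives `G = F' j`.
  have hre : ∀ j, IsReexpansion (c' - c) (F j) (F' j) := by
    intro j
    obtain ⟨G, hG⟩ := exists_isReexpansion hδ (f := F j) fun r h0 h1 =>
      (hbd r h0 h1).imp fun C hC => hC j
    have h1 := hG.aeval_mul c (qFac Polynomial.X (a j + b j + 1))
    have h2 := isReexpansion_aeval (δ := c' - c) c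
      (Polynomial.C (betaConst (a j / (d * p ^ v)) (b j / (d * p ^ v)) : ℂ_[p]) *
        (Polynomial.C ((k j : ℂ_[p])⁻¹) * (Polynomial.X ^ k j - 1)) *
          qFac Polynomial.X (a j) * qFac Polynomial.X (b j))
    simp only [map_mul (Polynomial.aeval _), map_qFac, Polynomial.aeval_X, add_sub_cancel] at h1 h2
    simp only [← map_mul (Polynomial.aeval _), aeval_polynomial_logApprox] at h2
    simp only [Polynomial.aeval_C] at h2
    rw [hqF j] at h1
    have h3 := h1.unique h2
    have h4 : G = F' j := by
      refine mul_left_cancel₀ (qFac_C_add_X_ne_zero c' (a j + b j + 1)) ?_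
      rw [h3, hqF' j]
      rfl
    rw [← h4]
    exact hG
  have hFlim : ∀ i, Tendsto (fun j => PowerSeries.coeff i (F j)) atTop
      (𝓝 (PowerSeries.coeff i (PowerSeries.shiftDown (logAt c) * b₀))) := by
    refine tendsto_coeff_mul (fun i => ?_) hlim
    simpa only [PowerSeries.shiftDown, PowerSeries.coeff_mk] using hL (i + 1)
  have hF'lim : ∀ i, Tendsto (fun j => PowerSeries.coeff i (F' j)) atTop (𝓝 (PowerSeries.coeff i
      (PowerSeries.C κ₀ * (PowerSeries.shiftDown (logAt c') * b₀')))) := by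
    refine tendsto_coeff_mul (fun i => ?_) (tendsto_coeff_mul (fun i => ?_) hlim')
    · simp only [PowerSeries.coeff_C]
      split_ifs
      · exact hκ
      · exact tendsto_const_nhds
    · simpa only [PowerSeries.shiftDown, PowerSeries.coeff_mk] using hL' (i + 1)
  obtain ⟨h1, h2⟩ := IsReexpansion.of_tendsto hδ hbd hre hFlim hF'lim
  have hlog0 : ∀ c : ℂ_[p], PowerSeries.coeff 0 (logAt c) = 0 := fun c => by simp [logAt]
  refine ⟨_, _, ?_, ?_, convergesOnUnitDisc_of_gaussBound h1, h2⟩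
  · rw [← mul_assoc, PowerSeries.X_mul_shiftDown (hlog0 c)]
  · rw [← mul_assoc, mul_comm PowerSeries.X, mul_assoc, ← mul_assoc PowerSeries.X,
      PowerSeries.X_mul_shiftDown (hlog0 c')]

end LogApprox

/-! ### Products of periodic functions -/

section PeriodicProducts

variable {R : Type*} [CommMonoid R] {f : ℕ → R} {P : ℕ}

theorem prod_range_add_of_periodic (hf : ∀ j, f (j + P) = f j) (n : ℕ) :
    ∏ j ∈ Finset.range P, f (n + j) = ∏ j ∈ Finset.range P, f j := by
  induction n with
  | zero => simp
  | succ n ih =>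
    rw [← ih]
    cases P with
    | zero => simp
    | succ P =>
      rw [Finset.prod_range_succ, Finset.prod_range_succ', add_right_comm n 1 P, add_assoc n P 1,
        hf n, add_zero]
      simp only [add_assoc, add_comm 1]

theorem prod_range_mul_of_periodic (hf : ∀ j, f (j + P) = f j) (n l : ℕ) :
    ∏ j ∈ Finset.range (P * l), f (n + j) = (∏ j ∈ Finset.range P, f j) ^ l := by
  induction l with
  | zero => simp
  | succ l ih =>
    rw [Nat.mul_succ, Finset.prod_range_add, ih, pow_succ]
    simp only [← add_assoc]
    rw [prod_range_add_of_periodic hf]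

end PeriodicProducts

/-! ### Morita's Gamma function -/

section Morita

variable {p : ℕ}

/-- The factors of `moritaGammaNat`. -/
def moritaFactor (p j : ℕ) : ℤ := -(if p ∣ j then 1 else (j : ℤ))

theorem moritaGammaNat_eq_prod (p n : ℕ) :
    moritaGammaNat p n = ∏ j ∈ Finset.range n, moritaFactor p j := by
  simp only [moritaGammaNat, moritaFactor, Finset.prod_neg, Finset.card_range]
  congr 1
  cases n with
  | zero => simp
  | succ n =>
    rw [Finset.prod_range_succ', if_pos (dvd_zero p), mul_one, Finset.prod_filter,
      Finset.prod_Ico_eq_prod_range, Nat.add_sub_cancel]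
    refine Finset.prod_congr rfl fun j _ => ?_
    rw [add_comm 1 j, ite_not]

theorem moritaGammaNat_succ (p n : ℕ) :
    moritaGammaNat p (n + 1) = moritaGammaNat p n * moritaFactor p n := by
  rw [moritaGammaNat_eq_prod, moritaGammaNat_eq_prod, Finset.prod_range_succ]

theorem cast_moritaFactor_periodic {M : ℕ} (hM : p ∣ M) (j : ℕ) :
    ((moritaFactor p (j + M) : ℤ) : ZMod M) = (moritaFactor p j : ℤ) := by
  simp only [moritaFactor, (Nat.dvd_add_left hM)]
  split_ifs <;> simp

variable [hp : Fact p.Prime]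

/-- Wilson's theorem. The factor at `j = 0` is `-1`, which compensates the sign of `(p - 1)!`. -/
theorem prod_range_prime_moritaFactor :
    ((∏ j ∈ Finset.range p, moritaFactor p j : ℤ) : ZMod p) = 1 := by
  obtain ⟨q, rfl⟩ : ∃ q, p = q + 1 := ⟨p - 1, by have := hp.out.pos; omega⟩
  have h1 : ∀ j ∈ Finset.range q, moritaFactor (q + 1) (j + 1) = -((j + 1 : ℕ) : ℤ) := by
    intro j hj
    rw [moritaFactor, if_neg]
    intro h
    have := Nat.le_of_dvd (Nat.succ_pos j) h
    have := Finset.mem_range.mp hj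
    omega
  rw [Finset.prod_range_succ', Finset.prod_congr rfl h1, Finset.prod_neg, Finset.card_range,
    moritaFactor, if_pos (dvd_zero _), ← Nat.cast_prod, Finset.prod_range_add_one_eq_factorial]
  push_cast
  have hw := ZMod.wilsons_lemma (q + 1)
  rw [Nat.add_sub_cancel] at hw
  rw [hw]
  rcases hp.out.eq_two_or_odd' with h | h
  · obtain rfl : q = 1 := by omega
    simp only [pow_one, mul_neg, mul_one, neg_neg]
    exact (rfl : (-1 : ZMod 2) = 1)
  · have : Even q := by
      rcases h with ⟨l, hl⟩
      exact ⟨l, by omega⟩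
    simp [this.neg_one_pow]

theorem prod_range_prime_pow_moritaFactor (k : ℕ) :
    (p : ℤ) ∣ ∏ j ∈ Finset.range (p ^ (k + 1)), moritaFactor p j - 1 := by
  rw [← ZMod.intCast_zmod_eq_zero_iff_dvd, Int.cast_sub, Int.cast_one, sub_eq_zero, Int.cast_prod]
  have h1 := prod_range_mul_of_periodic (P := p) (f := fun j => ((moritaFactor p j : ℤ) : ZMod p))
    (cast_moritaFactor_periodic dvd_rfl) 0 (p ^ k)
  simp only [zero_add] at h1
  rw [pow_succ', h1, ← Int.cast_prod, prod_range_prime_moritaFactor, one_pow]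

/-- A period of length `p^(k+1)` has product `≡ 1` modulo `p` only, but its `p^k`-th power is `≡ 1`
modulo `p^(k+1)`. Taking `p^(k+1) l` periods, hence the exponent `2 (k + 1)`, replaces Wilson's
theorem modulo prime powers and treats `p = 2` on the same footing. -/
theorem moritaGammaNat_add_mul_sub (k n l : ℕ) :
    ((p : ℤ) ^ (k + 1)) ∣ moritaGammaNat p (n + p ^ (2 * (k + 1)) * l) - moritaGammaNat p n := by
  rw [moritaGammaNat_eq_prod, Finset.prod_range_add, ← moritaGammaNat_eq_prod, ← mul_sub_one]
  refine Dvd.dvd.mul_left ?_ _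
  have hE := dvd_sub_pow_of_dvd_sub (prod_range_prime_pow_moritaFactor (p := p) k) k
  rw [one_pow] at hE
  have hdvd : p ∣ p ^ (k + 1) := dvd_pow_self p (Nat.succ_ne_zero k)
  have h1 := prod_range_mul_of_periodic (P := p ^ (k + 1))
    (f := fun j => ((moritaFactor p j : ℤ) : ZMod (p ^ (k + 1))))
    (cast_moritaFactor_periodic hdvd) n (p ^ (k + 1) * l)
  have h2 : (((∏ j ∈ Finset.range (p ^ (k + 1)), moritaFactor p j) ^ p ^ k - 1 : ℤ) :
      ZMod (p ^ (k + 1))) = 0 := by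
    rw [ZMod.intCast_zmod_eq_zero_iff_dvd]
    exact_mod_cast hE
  rw [Int.cast_sub, Int.cast_one, sub_eq_zero, Int.cast_pow, Int.cast_prod] at h2
  have h3 : ((∏ x ∈ Finset.range (p ^ (2 * (k + 1)) * l), moritaFactor p (n + x) - 1 : ℤ) :
      ZMod (p ^ (k + 1))) = 0 := by
    rw [Int.cast_sub, Int.cast_one, sub_eq_zero, Int.cast_prod,
      show p ^ (2 * (k + 1)) * l = p ^ (k + 1) * (p ^ (k + 1) * l) by ring, h1,
      show p ^ (k + 1) * l = p ^ k * (p * l) by rw [pow_succ, mul_assoc], pow_mul, h2, one_pow]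
  rw [ZMod.intCast_zmod_eq_zero_iff_dvd] at h3
  exact_mod_cast h3

theorem norm_moritaGammaNat_sub_le {k n n' : ℕ}
    (h : ‖((n : ℚ_[p]) - (n' : ℚ_[p]))‖ ≤ (p : ℝ) ^ (-((2 * (k + 1) : ℕ) : ℤ))) :
    ‖((moritaGammaNat p n : ℚ_[p]) - (moritaGammaNat p n' : ℚ_[p]))‖ ≤
      (p : ℝ) ^ (-((k + 1 : ℕ) : ℤ)) := by
  wlog hle : n' ≤ n generalizing n n'
  · rw [norm_sub_rev]
    exact this (by rwa [norm_sub_rev]) (by omega)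
  rw [← Nat.cast_sub hle, ← Int.cast_natCast (n - n'), Padic.norm_int_le_pow_iff_dvd] at h
  obtain ⟨l, hl⟩ : p ^ (2 * (k + 1)) ∣ n - n' := by exact_mod_cast h
  rw [← Int.cast_sub, Padic.norm_int_le_pow_iff_dvd, ← Nat.sub_add_cancel hle, hl, add_comm _ n']
  exact moritaGammaNat_add_mul_sub k n' l

theorem norm_moritaGammaNat (n : ℕ) : ‖(moritaGammaNat p n : ℚ_[p])‖ = 1 := by
  induction n with
  | zero => simp [moritaGammaNat]
  | succ n ih =>
    rw [moritaGammaNat_succ, Int.cast_mul, norm_mul, ih, one_mul, moritaFactor]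
    split_ifs with h
    · simp
    · push_cast
      rw [norm_neg]
      exact Padic.norm_natCast_eq_one_iff.mpr ((Nat.Prime.coprime_iff_not_dvd hp.out).mpr h)

/-- Uniform continuity on the natural numbers makes the image filter Cauchy, so the limit defining
`moritaGamma` exists. It has norm one because all approximating values are units. -/
theorem tendsto_moritaGamma {A : ℕ → ℕ} {x : ℚ_[p]}
    (hA : Tendsto (fun j => (A j : ℚ_[p])) atTop (𝓝 x)) :
    Tendsto (fun j => (moritaGammaNat p (A j) : ℚ_[p])) atTop (𝓝 (moritaGamma p x)) ∧
      moritaGamma p x ≠ 0 := by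
  have hA' : Tendsto A atTop (comap (fun n : ℕ => (n : ℚ_[p])) (𝓝 x)) := tendsto_comap_iff.mpr hA
  have hne : (comap (fun n : ℕ => (n : ℚ_[p])) (𝓝 x)).NeBot := hA'.neBot
  have hp1 : (1 : ℝ) < p := by exact_mod_cast hp.out.one_lt
  have hc : Cauchy (map (fun n : ℕ => (moritaGammaNat p n : ℚ_[p]))
      (comap (fun n : ℕ => (n : ℚ_[p])) (𝓝 x))) := by
    rw [Metric.cauchy_iff]
    refine ⟨hne.map _, fun ε hε => ?_⟩
    obtain ⟨k, hk⟩ := exists_pow_lt_of_lt_one hε (inv_lt_one_of_one_lt₀ hp1)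
    have hpos : (0 : ℝ) < (p : ℝ) ^ (-((2 * (k + 1) : ℕ) : ℤ)) := by positivity
    refine ⟨_, image_mem_map (preimage_mem_comap (Metric.ball_mem_nhds x hpos)), ?_⟩
    rintro _ ⟨n, hn, rfl⟩ _ ⟨n', hn', rfl⟩
    rw [Set.mem_preimage, mem_ball_iff_norm] at hn hn'
    rw [dist_eq_norm]
    refine (norm_moritaGammaNat_sub_le (k := k) ?_).trans_lt ?_
    · rw [← sub_sub_sub_cancel_right _ _ x]
      rw [sub_eq_add_neg]
      refine (IsUltrametricDist.norm_add_le_max _ _).trans (max_le hn.le ?_)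
      rw [norm_neg]
      exact hn'.le
    · rw [zpow_neg, zpow_natCast, ← inv_pow]
      exact (pow_le_pow_of_le_one (by positivity) (inv_lt_one_of_one_lt₀ hp1).le
        (Nat.le_succ k)).trans_lt hk
  obtain ⟨y, hy⟩ := CompleteSpace.complete hc
  have h1 : Tendsto (fun n : ℕ => (moritaGammaNat p n : ℚ_[p]))
      (comap (fun n : ℕ => (n : ℚ_[p])) (𝓝 x)) (𝓝 (moritaGamma p x)) :=
    tendsto_nhds_limUnder ⟨y, hy⟩
  refine ⟨h1.comp hA', fun h0 => ?_⟩
  have h2 := h1.norm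
  simp only [norm_moritaGammaNat] at h2
  rw [h0, norm_zero] at h2
  exact one_ne_zero (tendsto_nhds_unique tendsto_const_nhds h2)

/-- The multiples of `p` up to `n` contribute `p^⌊n/p⌋ ⌊n/p⌋!`. -/
theorem factorial_eq_moritaGammaNat (n : ℕ) :
    (n.factorial : ℤ) = (-1) ^ (n + 1) * moritaGammaNat p (n + 1) *
      ((p : ℤ) ^ (n / p) * ((n / p).factorial : ℤ)) := by
  induction n with
  | zero => simp [moritaGammaNat]
  | succ n ih =>
    rw [moritaGammaNat_succ, Nat.factorial_succ, Nat.cast_mul, ih, Nat.succ_div, moritaFactor]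
    split_ifs with h
    · have h2 : ((n + 1 : ℕ) : ℤ) = p * ((n / p : ℕ) + 1) := by
        have h3 : (n + 1) / p = n / p + 1 := by rw [Nat.succ_div, if_pos h]
        have h4 := Nat.mul_div_cancel' h
        rw [h3] at h4
        exact_mod_cast h4.symm
      rw [h2, Nat.factorial_succ]
      push_cast
      ring
    · push_cast
      ring_nf

/-- The comparison of the normalizing constants for integral parameters. -/
theorem betaConst_eq_morita (A B : ℕ) :
    (betaConst A B : ℚ) = (moritaGammaNat p (A + B + 2) /
        (moritaGammaNat p (A + 1) * moritaGammaNat p (B + 1)) : ℚ) *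
      (p : ℚ) ^ ((((A + B + 1) / p : ℕ) : ℤ) - ((A / p : ℕ) : ℤ) - ((B / p : ℕ) : ℤ)) *
        (((A + B + 1) / p).factorial / (A / p + B / p + 1).factorial : ℚ) *
          betaConst (A / p) (B / p) := by
  have hp0 : (p : ℚ) ≠ 0 := by exact_mod_cast hp.out.ne_zero
  have h1 := congrArg (Int.cast : ℤ → ℚ) (factorial_eq_moritaGammaNat (p := p) (A + B + 1))
  have h2 := congrArg (Int.cast : ℤ → ℚ) (factorial_eq_moritaGammaNat (p := p) A)
  have h3 := congrArg (Int.cast : ℤ → ℚ) (factorial_eq_moritaGammaNat (p := p) B)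
  push_cast at h1 h2 h3
  have hm : ∀ n, (moritaGammaNat p n : ℚ) ≠ 0 := by
    intro n h0
    have := norm_moritaGammaNat (p := p) n
    rw [Int.cast_eq_zero.mp h0] at this
    simp at this
  have hf : ∀ n : ℕ, (n.factorial : ℚ) ≠ 0 := fun n => by exact_mod_cast n.factorial_ne_zero
  rw [betaConst, betaConst, h1, h2, h3]
  rw [zpow_sub₀ hp0, zpow_sub₀ hp0, zpow_natCast, zpow_natCast, zpow_natCast]
  have := hm (A + 1)
  have := hm (B + 1)
  have := hf (A / p)
  have := hf (B / p)
  have := hf (A / p + B / p + 1)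
  have h4 : ((-1 : ℚ) ^ (A + 1)) ≠ 0 := by simp
  have h5 : ((-1 : ℚ) ^ (B + 1)) ≠ 0 := by simp
  have h6 : ((-1 : ℚ) ^ (A + B + 1 + 1)) = (-1) ^ (A + 1) * (-1) ^ (B + 1) := by
    rw [← pow_add]; congr 1; omega
  rw [h6]
  field_simp

end Morita

/-! ### Residues, brackets and integral approximations of the parameters -/

section Residues

variable {N m : ℕ}

theorem ratResidue_lt (hm : 0 < m) (α : ℚ) : ratResidue m α < m := by
  have : NeZero m := ⟨hm.ne'⟩
  exact ZMod.val_lt _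

/-- Clearing the common denominator `N` turns residues of rationals into integer congruences; with
`ratResidue_eq` this characterizes them. -/
theorem ratResidue_spec (hN : 0 < N) (hm : 0 < m) (hmN : m.Coprime N) {α : ℚ} {a : ℤ}
    (hα : α = a / N) : (m : ℤ) ∣ a - ratResidue m α * N := by
  have : NeZero m := ⟨hm.ne'⟩
  have hden : (α.den : ℤ) ∣ N := by
    have h := Rat.den_dvd a N
    rw [Rat.divInt_eq_div] at h
    rw [hα]
    exact_mod_cast h
  have hcop : α.den.Coprime m :=
    (Nat.Coprime.coprime_dvd_right (by exact_mod_cast hden) hmN).symm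
  have h1 : α.num * (N : ℤ) = a * α.den := by
    have hN' : (N : ℚ) ≠ 0 := by exact_mod_cast hN.ne'
    have h2 : (α.num : ℚ) / α.den = a / N := by rw [Rat.num_div_den, hα]
    have hd : (α.den : ℚ) ≠ 0 := by exact_mod_cast α.den_ne_zero
    rw [div_eq_div_iff hd hN'] at h2
    exact_mod_cast h2
  have h2 := congrArg (Int.cast : ℤ → ZMod m) h1
  push_cast at h2
  rw [← ZMod.intCast_zmod_eq_zero_iff_dvd]
  push_cast
  rw [ratResidue, ZMod.natCast_zmod_val]
  have h3 := ZMod.coe_mul_inv_eq_one α.den hcop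
  linear_combination (-(α.den : ZMod m)⁻¹) * h2 - (a : ZMod m) * h3

theorem ratResidue_eq (hN : 0 < N) (hm : 0 < m) (hmN : m.Coprime N) {α : ℚ} {a : ℤ}
    (hα : α = a / N) {r : ℕ} (hr : r < m) (h : (m : ℤ) ∣ a - r * N) : ratResidue m α = r := by
  have h1 := ratResidue_spec hN hm hmN hα
  have h2 : (m : ℤ) ∣ ((ratResidue m α : ℤ) - r) * N := by
    have := dvd_sub h h1
    exact this.trans (dvd_of_eq (by ring))
  have h3 : (m : ℤ) ∣ (ratResidue m α : ℤ) - r :=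
    (Int.isCoprime_iff_gcd_eq_one.mpr (by simpa using hmN)).dvd_of_dvd_mul_right h2
  have h4 : (ratResidue m α : ℤ) - r = 0 := by
    refine Int.eq_zero_of_abs_lt_dvd h3 ?_
    have := ratResidue_lt hm α
    rw [abs_lt]
    constructor <;> omega
  omega

theorem ratResidue_congr (hN : 0 < N) (hm : 0 < m) (hmN : m.Coprime N) {α β : ℚ} {a b : ℤ}
    (hα : α = a / N) (hβ : β = b / N) (h : (m : ℤ) ∣ a - b) : ratResidue m α = ratResidue m β := by
  refine ratResidue_eq hN hm hmN hα (ratResidue_lt hm β) ?_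
  have := dvd_add h (ratResidue_spec hN hm hmN hβ)
  exact this.trans (dvd_of_eq (by ring))

theorem neg_eq_div {α : ℚ} {a : ℤ} (hα : α = a / N) : -α = ((-a : ℤ) : ℚ) / N := by
  rw [hα]; push_cast; ring

theorem natCast_eq_div (hN : 0 < N) (n : ℕ) : (n : ℚ) = ((n * N : ℤ) : ℚ) / N := by
  have hN' : (N : ℚ) ≠ 0 := by exact_mod_cast hN.ne'
  push_cast
  field_simp

theorem ratBracket_sub (hN : 0 < N) (hm : 0 < m) (hmN : m.Coprime N) {α β : ℚ} {a b : ℤ}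
    (hα : α = a / N) (hβ : β = b / N) (h : (m : ℤ) ∣ a - b) :
    ratBracket m α - ratBracket m β = (α - β) / m := by
  have h1 := ratResidue_congr hN hm hmN (neg_eq_div hα) (neg_eq_div hβ)
    (by rw [neg_sub_neg]; exact (dvd_sub_comm).mp h)
  rw [ratBracket, ratBracket, h1]
  ring

/-- `[a / N]_m` is again a fraction with denominator `N`. -/
theorem ratBracket_eq_div (hN : 0 < N) (hm : 0 < m) (hmN : m.Coprime N) {α : ℚ} {a : ℤ}
    (hα : α = a / N) :
    ∃ b : ℤ, a + ratResidue m (-α) * N = m * b ∧ ratBracket m α = b / N := by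
  have h1 := ratResidue_spec hN hm hmN (neg_eq_div hα)
  obtain ⟨b, hb⟩ := (dvd_neg.mpr h1)
  have hb' : a + ratResidue m (-α) * N = m * b := by rw [← hb]; ring
  refine ⟨b, hb', ?_⟩
  have hm' : (m : ℚ) ≠ 0 := by exact_mod_cast hm.ne'
  have hN' : (N : ℚ) ≠ 0 := by exact_mod_cast hN.ne'
  have h2 : (a : ℚ) + ratResidue m (-α) * N = m * b := by exact_mod_cast hb'
  have hα' : α * N = a := by rw [hα, div_mul_cancel₀ _ hN']
  rw [ratBracket, div_eq_div_iff hm' hN', add_mul, hα', h2, mul_comm]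

theorem ratBracket_natCast_succ (hm : 0 < m) (a : ℕ) :
    ratBracket m ((a + 1 : ℕ) : ℚ) = ((a / m + 1 : ℕ) : ℚ) := by
  have hm' : (m : ℚ) ≠ 0 := by exact_mod_cast hm.ne'
  have h0 : ((a + 1 : ℕ) : ℚ) = ((a + 1 : ℕ) : ℤ) / (1 : ℕ) := by simp
  have hdm := Nat.div_add_mod a m
  have hlt := Nat.mod_lt a hm
  have h1 : ratResidue m (-((a + 1 : ℕ) : ℚ)) = m - 1 - a % m := by
    refine ratResidue_eq one_pos hm (Nat.coprime_one_right m) (neg_eq_div h0) (by omega) ?_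
    refine ⟨-(a / m : ℕ) - 1, ?_⟩
    have h2 : ((m - 1 - a % m : ℕ) : ℤ) = m - 1 - (a % m : ℕ) := by omega
    have h3 : (m : ℤ) * (a / m : ℕ) + (a % m : ℕ) = a := by exact_mod_cast hdm
    rw [h2]
    push_cast at h3 ⊢
    linear_combination h3
  rw [ratBracket, h1, div_eq_iff hm', Nat.cast_sub (by omega), Nat.cast_sub hm]
  have h3 : (m : ℚ) * (a / m : ℕ) + (a % m : ℕ) = a := by exact_mod_cast hdm
  push_cast at h3 ⊢
  linear_combination -h3

theorem ratBracket_ne_neg (hm : 0 < m) {α : ℚ} (hα : ∀ n : ℕ, α ≠ -n) (n : ℕ) :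
    ratBracket m α ≠ -n := by
  have hm' : (m : ℚ) ≠ 0 := by exact_mod_cast hm.ne'
  intro h
  rw [ratBracket, div_eq_iff hm'] at h
  refine hα (n * m + ratResidue m (-α)) ?_
  push_cast
  linear_combination h

theorem ratBracket_add_ratBracket_ne_neg (hm : 0 < m) {α β : ℚ} (h : ∀ n : ℕ, α + β ≠ -n) (n : ℕ) :
    ratBracket m α + ratBracket m β ≠ -n := by
  have hm' : (m : ℚ) ≠ 0 := by exact_mod_cast hm.ne'
  intro h1
  rw [ratBracket, ratBracket, ← add_div, div_eq_iff hm'] at h1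
  refine h (n * m + ratResidue m (-α) + ratResidue m (-β)) ?_
  push_cast
  linear_combination h1

/-- A positive integer congruent to `α` modulo `M`. -/
def natApprox (M : ℕ) (α : ℚ) : ℕ := ratResidue M α + M - 1

/-- The integer congruent to `α` is `natApprox M α + 1`; the shift by one matches the parameters `a
+ 1` of the integral case, and the added `M` makes it positive. -/
theorem natApprox_spec (hN : 0 < N) {M : ℕ} (hM : 0 < M) (hMN : M.Coprime N) {α : ℚ} {a : ℤ}
    (hα : α = a / N) : (M : ℤ) ∣ ((natApprox M α + 1 : ℕ) : ℤ) * N - a := by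
  have h1 := ratResidue_spec hN hM hMN hα
  have h2 : natApprox M α + 1 = ratResidue M α + M := by rw [natApprox]; omega
  rw [h2]
  have := dvd_sub (dvd_mul_right (M : ℤ) N) h1
  exact this.trans (dvd_of_eq (by push_cast; ring))

variable {p : ℕ} [hp : Fact p.Prime]

theorem tendsto_natApprox (hN : 0 < N) (hpN : p.Coprime N) {M : ℕ} (hM : 0 < M)
    (hMN : M.Coprime N) {α : ℚ} {a : ℤ} (hα : α = a / N) :
    Tendsto (fun j => (((natApprox (M * p ^ j) α + 1 : ℕ) : ℚ) : ℚ_[p])) atTop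
      (𝓝 (α : ℚ_[p])) := by
  rw [tendsto_iff_norm_sub_tendsto_zero]
  have hp1 : (1 : ℝ) < p := by exact_mod_cast hp.out.one_lt
  refine squeeze_zero (fun _ => norm_nonneg _) (fun j => ?_)
    (tendsto_pow_atTop_nhds_zero_of_lt_one (r := (p : ℝ)⁻¹) (by positivity)
      (inv_lt_one_of_one_lt₀ hp1))
  obtain ⟨l, hl⟩ := natApprox_spec hN (Nat.mul_pos hM (pow_pos hp.out.pos j))
    (Nat.Coprime.mul_left hMN (hpN.pow_left j)) hα
  have hN' : (N : ℚ_[p]) ≠ 0 := by exact_mod_cast hN.ne'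
  have hl' := congrArg (Int.cast : ℤ → ℚ_[p]) hl
  push_cast at hl'
  have h1 : (((natApprox (M * p ^ j) α + 1 : ℕ) : ℚ) : ℚ_[p]) - (α : ℚ_[p]) =
      (M * l : ℤ) * (p : ℚ_[p]) ^ j / N := by
    have hα' : (α : ℚ_[p]) * N = a := by rw [hα]; push_cast; rw [div_mul_cancel₀ _ hN']
    rw [eq_div_iff hN', sub_mul, hα']
    push_cast
    linear_combination hl'
  rw [h1, norm_div, norm_mul, norm_pow, Padic.norm_p, Padic.norm_natCast_eq_one_iff.mpr hpN, div_one]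
  exact mul_le_of_le_one_left (by positivity) (Padic.norm_int_le_one _)

end Residues

/-! ### Convergence of the ratio of normalizing constants -/

section Constants

variable {N m p : ℕ} [hp : Fact p.Prime]

/-- The bracket of an approximating integer. -/
theorem natApprox_div_add_one (hN : 0 < N) (hm : 0 < m) (hmN : m.Coprime N) (hpN : p.Coprime N)
    {α : ℚ} {a : ℤ} (hα : α = a / N) (j : ℕ) {d : ℕ} (hd : d ∣ p * m) :
    ((natApprox (p * m * p ^ j) α / d + 1 : ℕ) : ℚ) =
      ratBracket d α + (((natApprox (p * m * p ^ j) α + 1 : ℕ) : ℚ) - α) / d := by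
  have hM : 0 < p * m * p ^ j := Nat.mul_pos (Nat.mul_pos hp.out.pos hm) (pow_pos hp.out.pos j)
  have hMN : (p * m * p ^ j).Coprime N :=
    Nat.Coprime.mul_left (Nat.Coprime.mul_left hpN hmN) (hpN.pow_left j)
  have hd' : d ∣ p * m * p ^ j := hd.mul_right _
  have hd0 : 0 < d := Nat.pos_of_dvd_of_pos hd' hM
  have h1 := natApprox_spec hN hM hMN hα
  have h2 : (d : ℤ) ∣ ((natApprox (p * m * p ^ j) α + 1 : ℕ) : ℤ) * N - a :=
    (Int.natCast_dvd_natCast.mpr hd').trans h1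
  have h3 := ratBracket_sub hN hd0 (Nat.Coprime.coprime_dvd_left hd' hMN)
    (natCast_eq_div hN (natApprox (p * m * p ^ j) α + 1)) hα h2
  rw [ratBracket_natCast_succ hd0] at h3
  rw [← h3]
  ring

/-- The sum of the two inner brackets of the approximants is congruent modulo `p` to that of `α`,
`β`, since the error is divisible by `p m` before division by `m`. This is why the modulus contains
the extra factor `p`. -/
theorem ratBracket_add_eq_of_natApprox (hN : 0 < N) (hm : 0 < m) (hmN : m.Coprime N)
    (hpN : p.Coprime N) {α β : ℚ} {a b : ℤ} (hα : α = a / N) (hβ : β = b / N) (j : ℕ) :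
    (((natApprox (p * m * p ^ j) α / m + natApprox (p * m * p ^ j) β / m + 1) / p + 1 : ℕ) : ℚ) =
      ratBracket p (ratBracket m α + ratBracket m β) +
      ((((natApprox (p * m * p ^ j) α + 1 : ℕ) : ℚ) - α) / m +
        (((natApprox (p * m * p ^ j) β + 1 : ℕ) : ℚ) - β) / m) / p := by
  have hM : 0 < p * m * p ^ j := Nat.mul_pos (Nat.mul_pos hp.out.pos hm) (pow_pos hp.out.pos j)
  have hMN : (p * m * p ^ j).Coprime N :=
    Nat.Coprime.mul_left (Nat.Coprime.mul_left hpN hmN) (hpN.pow_left j)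
  have hm' : (m : ℚ) ≠ 0 := by exact_mod_cast hm.ne'
  have hN' : (N : ℚ) ≠ 0 := by exact_mod_cast hN.ne'
  have h1 := natApprox_div_add_one hN hm hmN hpN hα j (dvd_mul_left m p)
  have h2 := natApprox_div_add_one hN hm hmN hpN hβ j (dvd_mul_left m p)
  obtain ⟨a', ha', ha''⟩ := ratBracket_eq_div hN hm hmN hα
  obtain ⟨b', hb', hb''⟩ := ratBracket_eq_div hN hm hmN hβ
  have hs : ratBracket m α + ratBracket m β = ((a' + b' : ℤ) : ℚ) / N := by
    rw [ha'', hb'']; push_cast; ring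
  set A := natApprox (p * m * p ^ j) α / m with hA
  set B := natApprox (p * m * p ^ j) β / m with hB
  have key : ∀ {γ : ℚ} {c c' : ℤ}, γ = c / N → ratBracket m γ = c' / N →
      (p : ℤ) ∣ ((natApprox (p * m * p ^ j) γ / m + 1 : ℕ) : ℤ) * N - c' := by
    intro γ c c' hγ hγ'
    have h3 := natApprox_spec hN hM hMN hγ
    have h4 := natApprox_div_add_one hN hm hmN hpN hγ j (dvd_mul_left m p)
    obtain ⟨l, hl⟩ := h3
    refine ⟨p ^ j * l, ?_⟩
    have hl' := congrArg (Int.cast : ℤ → ℚ) hl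
    have h5 : ((((natApprox (p * m * p ^ j) γ / m + 1 : ℕ) : ℤ) * N - c' : ℤ) : ℚ) =
        ((p * (p ^ j * l) : ℤ) : ℚ) := by
      have h6 : γ * N = c := by rw [hγ, div_mul_cancel₀ _ hN']
      have h7 : ratBracket m γ * N = c' := by rw [hγ', div_mul_cancel₀ _ hN']
      push_cast at hl'
      rw [Int.cast_sub, Int.cast_mul, Int.cast_natCast, Int.cast_natCast, h4, add_mul, h7]
      push_cast
      have h8 : ((natApprox (p * m * p ^ j) γ : ℚ) + 1 - γ) / m * N = p * (p ^ j * l) := by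
        rw [div_mul_eq_mul_div, div_eq_iff hm', sub_mul, h6, hl']
        ring
      linear_combination h8
    exact_mod_cast h5
  have h3 : (p : ℤ) ∣ ((A + B + 1 + 1 : ℕ) : ℤ) * N - (a' + b') := by
    have := dvd_add (key hα ha'') (key hβ hb'')
    rw [← hA, ← hB] at this
    exact this.trans (dvd_of_eq (by push_cast; ring))
  have h4 := ratBracket_sub hN hp.out.pos hpN (natCast_eq_div hN (A + B + 1 + 1)) hs h3
  rw [ratBracket_natCast_succ hp.out.pos] at h4
  have h5 : ((A + B + 1 + 1 : ℕ) : ℚ) = ((A + 1 : ℕ) : ℚ) + ((B + 1 : ℕ) : ℚ) := by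
    push_cast; ring
  rw [h5, h1, h2] at h4
  linear_combination h4

/-- The exponent of `p` in the comparison of two expansions. -/
theorem exists_exponent (hN : 0 < N) (hm : 0 < m) (hmN : m.Coprime N) (hpN : p.Coprime N)
    {α β : ℚ} {a b : ℤ} (hα : α = a / N) (hβ : β = b / N) :
    ∃ e : ℤ, (e = 0 ∨ e = 1) ∧
      (e : ℚ) = ratBracket p (ratBracket m α + ratBracket m β) + 1
        - ratBracket (p * m) α - ratBracket (p * m) β ∧
      ∀ j, ((((natApprox (p * m * p ^ j) α / m + natApprox (p * m * p ^ j) β / m + 1) / p : ℕ) : ℤ) -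
        ((natApprox (p * m * p ^ j) α / m / p : ℕ) : ℤ) -
        ((natApprox (p * m * p ^ j) β / m / p : ℕ) : ℤ)) = e := by
  set u : ℕ → ℕ := fun j => natApprox (p * m * p ^ j) α with hu
  set v : ℕ → ℕ := fun j => natApprox (p * m * p ^ j) β with hv
  set E : ℕ → ℤ := fun j => (((u j / m + v j / m + 1) / p : ℕ) : ℤ) - ((u j / m / p : ℕ) : ℤ) -
    ((v j / m / p : ℕ) : ℤ) with hE
  have hm' : (m : ℚ) ≠ 0 := by exact_mod_cast hm.ne'
  have hp' : (p : ℚ) ≠ 0 := by exact_mod_cast hp.out.ne_zero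
  -- The three approximation errors cancel, so the integer `E j` does not depend on `j`. In
  -- particular the right-hand side is an integer.
  have h1 : ∀ j, (E j : ℚ) = ratBracket p (ratBracket m α + ratBracket m β) + 1
        - ratBracket (p * m) α - ratBracket (p * m) β := by
    intro j
    have h2 := ratBracket_add_eq_of_natApprox hN hm hmN hpN hα hβ j
    have h3 := natApprox_div_add_one hN hm hmN hpN hα j (d := p * m) dvd_rfl
    have h4 := natApprox_div_add_one hN hm hmN hpN hβ j (d := p * m) dvd_rfl
    simp only [hE, Nat.div_div_eq_div_mul (_) m p, mul_comm m p, Int.cast_sub, Int.cast_natCast]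
    simp only [hu, hv]
    push_cast at h2 h3 h4
    have e1 : ∀ x : ℚ, x / (p * m) = x / m / p := fun x => by rw [div_div, mul_comm]
    rw [e1] at h3 h4
    linear_combination h2 - h3 - h4
  refine ⟨E 0, ?_, h1 0, fun j => ?_⟩
  · have h2 := Nat.div_add_div_le_add_div (x := u 0 / m) (y := v 0 / m) (z := p)
    have h3 : (u 0 / m + v 0 / m) / p ≤ (u 0 / m + v 0 / m + 1) / p :=
      Nat.div_le_div_right (by omega)
    have h4 : (u 0 / m + v 0 / m + 1) / p ≤ u 0 / m / p + v 0 / m / p + 1 := by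
      rw [Nat.div_le_iff_le_mul_add_pred hp.out.pos]
      have := Nat.div_add_mod (u 0 / m) p
      have := Nat.div_add_mod (v 0 / m) p
      have := Nat.mod_lt (u 0 / m) hp.out.pos
      have := Nat.mod_lt (v 0 / m) hp.out.pos
      rw [mul_add, mul_add]
      omega
    simp only [hE]
    omega
  · have : (E j : ℚ) = E 0 := by rw [h1, h1]
    exact Int.cast_injective this

theorem tendsto_natApprox_div (hN : 0 < N) (hm : 0 < m) (hmN : m.Coprime N) (hpN : p.Coprime N)
    {α : ℚ} {a : ℤ} (hα : α = a / N) :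
    Tendsto (fun j => ((natApprox (p * m * p ^ j) α / m + 1 : ℕ) : ℚ_[p])) atTop
      (𝓝 (ratBracket m α : ℚ_[p])) := by
  have h1 := tendsto_natApprox (p := p) hN hpN (Nat.mul_pos hp.out.pos hm)
    (Nat.Coprime.mul_left hpN hmN) hα
  have h2 := ((h1.sub_const (α : ℚ_[p])).div_const (m : ℚ_[p])).const_add (ratBracket m α : ℚ_[p])
  rw [sub_self, zero_div, add_zero] at h2
  refine h2.congr fun j => ?_
  have h3 := natApprox_div_add_one hN hm hmN hpN hα j (dvd_mul_left m p)
  have h4 := congrArg (Rat.cast : ℚ → ℚ_[p]) h3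
  push_cast at h4 ⊢
  exact h4.symm

/-- The ratio of normalizing constants converges to the constant in the re-expansion formula. -/
theorem tendsto_betaConst_ratio (hN : 0 < N) (hm : 0 < m) (hmN : m.Coprime N) (hpN : p.Coprime N)
    {α β : ℚ} {a b : ℤ} (hα : α = a / N) (hβ : β = b / N) (hαβ : ∀ n : ℕ, α + β ≠ -n) :
    ∃ (e : ℤ) (c : ℚ),
      (e : ℚ) = ratBracket p (ratBracket m α + ratBracket m β) + 1
        - ratBracket (p * m) α - ratBracket (p * m) β ∧
      (c : ℝ) = Real.Gamma (ratBracket p (ratBracket m α + ratBracket m β)) /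
        Real.Gamma (ratBracket (p * m) α + ratBracket (p * m) β : ℚ) ∧
      Tendsto (fun j => ((betaConst (natApprox (p * m * p ^ j) α / m)
          (natApprox (p * m * p ^ j) β / m) : ℚ_[p]) /
        (betaConst (natApprox (p * m * p ^ j) α / (p * m))
          (natApprox (p * m * p ^ j) β / (p * m)) : ℚ_[p]))) atTop
        (𝓝 ((p : ℚ_[p]) ^ e *
                  (moritaGamma p (ratBracket m α + ratBracket m β : ℚ) /
                    (moritaGamma p (ratBracket m α) * moritaGamma p (ratBracket m β))) *
                  (c : ℚ_[p]))) := by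
  obtain ⟨e, he01, he, hej⟩ := exists_exponent hN hm hmN hpN hα hβ
  set S := ratBracket p (ratBracket m α + ratBracket m β) with hS
  have hSne : ∀ n : ℕ, S ≠ -n :=
    ratBracket_ne_neg hp.out.pos (ratBracket_add_ratBracket_ne_neg hm hαβ)
  have hS0 : S ≠ 0 := by simpa using hSne 0
  have hSΓ : Real.Gamma (S : ℝ) ≠ 0 := by
    refine Real.Gamma_ne_zero fun n h => hSne n ?_
    exact_mod_cast h
  have hp0 : (p : ℚ) ≠ 0 := by exact_mod_cast hp.out.ne_zero
  set u : ℕ → ℕ := fun j => natApprox (p * m * p ^ j) α with hu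
  set v : ℕ → ℕ := fun j => natApprox (p * m * p ^ j) β with hv
  have hA := tendsto_natApprox_div (p := p) hN hm hmN hpN hα
  have hB := tendsto_natApprox_div (p := p) hN hm hmN hpN hβ
  have hAB : Tendsto (fun j => ((u j / m + v j / m + 2 : ℕ) : ℚ_[p])) atTop
      (𝓝 ((ratBracket m α + ratBracket m β : ℚ) : ℚ_[p])) := by
    have := hA.add hB
    push_cast at this ⊢
    refine this.congr fun j => ?_
    simp only [hu, hv]
    ring
  have hSj : Tendsto (fun j => (((u j / m + v j / m + 1) / p + 1 : ℕ) : ℚ_[p])) atTop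
      (𝓝 (S : ℚ_[p])) := by
    have h1 := ((hA.sub_const (ratBracket m α : ℚ_[p])).add
      (hB.sub_const (ratBracket m β : ℚ_[p]))).div_const (p : ℚ_[p]) |>.const_add (S : ℚ_[p])
    rw [sub_self, sub_self, add_zero, zero_div, add_zero] at h1
    refine h1.congr fun j => ?_
    have h2 := ratBracket_add_eq_of_natApprox hN hm hmN hpN hα hβ j
    have h3 := natApprox_div_add_one hN hm hmN hpN hα j (dvd_mul_left m p)
    have h4 := natApprox_div_add_one hN hm hmN hpN hβ j (dvd_mul_left m p)
    have h5 : (((u j / m + v j / m + 1) / p + 1 : ℕ) : ℚ) = S +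
        ((((u j / m + 1 : ℕ) : ℚ) - ratBracket m α) + (((v j / m + 1 : ℕ) : ℚ) - ratBracket m β)) /
          p := by
      rw [h2, h3, h4]; ring
    have h6 := congrArg (Rat.cast : ℚ → ℚ_[p]) h5
    push_cast at h6 ⊢
    exact h6.symm
  -- The denominator argument is `S + 1 - e`, so the quotient of Gamma values is `Γ(S) / Γ(S) = 1`
  -- or `Γ(S) / Γ(S + 1) = 1 / S`.
  set c : ℚ := if e = 1 then 1 else S⁻¹ with hc
  -- The same dichotomy for the approximants: the two factorials coincide if `e = 1`; if `e = 0`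
  -- their quotient is the inverse of an integer tending to `S`.
  have hcj : Tendsto (fun j => ((((u j / m + v j / m + 1) / p).factorial : ℚ_[p]) /
      ((u j / m / p + v j / m / p + 1).factorial : ℚ_[p]))) atTop (𝓝 (c : ℚ_[p])) := by
    have hfac : ∀ n : ℕ, (n.factorial : ℚ_[p]) ≠ 0 := fun n => by
      exact_mod_cast n.factorial_ne_zero
    rcases he01 with h0 | h1
    · rw [hc, if_neg (by rw [h0]; exact zero_ne_one)]
      have h2 := hSj.inv₀ (by exact_mod_cast hS0)
      push_cast at h2 ⊢
      refine h2.congr fun j => ?_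
      have h3 := hej j
      rw [h0] at h3
      have h4 : u j / m / p + v j / m / p = (u j / m + v j / m + 1) / p := by
        simp only [hu, hv] at h3 ⊢
        omega
      rw [h4, Nat.factorial_succ, Nat.cast_mul, eq_comm, div_mul_cancel_right₀ (hfac _)]
      push_cast
      rfl
    · rw [hc, if_pos h1, Rat.cast_one]
      refine tendsto_const_nhds.congr fun j => ?_
      have h3 := hej j
      rw [h1] at h3
      have h4 : u j / m / p + v j / m / p + 1 = (u j / m + v j / m + 1) / p := by
        simp only [hu, hv] at h3 ⊢
        omega
      rw [h4, div_self (hfac _)]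
  refine ⟨e, c, he, ?_, ?_⟩
  · have h1 : ratBracket (p * m) α + ratBracket (p * m) β = S + 1 - e := by
      rw [he]; ring
    rw [h1]
    rcases he01 with h0 | h1
    · rw [hc, if_neg (by rw [h0]; exact zero_ne_one), h0]
      push_cast
      rw [sub_zero, Real.Gamma_add_one (by exact_mod_cast hS0), div_mul_cancel_right₀ hSΓ]
    · rw [hc, if_pos h1, h1]
      push_cast
      rw [add_sub_cancel_right, div_self hSΓ]
  · obtain ⟨hΓA, hΓA0⟩ := tendsto_moritaGamma hA
    obtain ⟨hΓB, hΓB0⟩ := tendsto_moritaGamma hB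
    obtain ⟨hΓAB, hΓAB0⟩ := tendsto_moritaGamma hAB
    have h1 := ((hΓAB.div (hΓA.mul hΓB) (mul_ne_zero hΓA0 hΓB0)).const_mul ((p : ℚ_[p]) ^ e)).mul hcj
    refine h1.congr fun j => ?_
    simp only [Pi.div_apply]
    have h2 := congrArg (Rat.cast : ℚ → ℚ_[p]) (betaConst_eq_morita (p := p) (u j / m) (v j / m))
    rw [hej j] at h2
    simp only [Nat.div_div_eq_div_mul] at h2 ⊢
    rw [mul_comm m p] at h2 ⊢
    have hκ : (betaConst (u j / (p * m)) (v j / (p * m)) : ℚ_[p]) ≠ 0 := by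
      rw [Rat.cast_ne_zero, betaConst]
      have hfac : ∀ n : ℕ, (n.factorial : ℚ) ≠ 0 := fun n => by exact_mod_cast n.factorial_ne_zero
      exact div_ne_zero (hfac _) (mul_ne_zero (hfac _) (hfac _))
    rw [eq_div_iff hκ, h2]
    push_cast
    ring

end Constants

/-! ### Functions polynomial in two rational variables, and descent of coefficients -/

section PolynomialFunctions

variable {K : Type*} [Field K]

/-- A function of two rational variables that is given by a polynomial. -/
def IsPoly₂ (f : ℚ → ℚ → K) : Prop :=
  ∃ P : MvPolynomial (Fin 2) K, ∀ α β : ℚ, f α β = MvPolynomial.eval ![(α : K), (β : K)] P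

namespace IsPoly₂

variable {f g : ℚ → ℚ → K}

theorem const (c : K) : IsPoly₂ fun _ _ => c := ⟨MvPolynomial.C c, fun _ _ => by simp⟩

theorem fst : IsPoly₂ fun α _ => (α : K) := ⟨MvPolynomial.X 0, fun _ _ => by simp⟩

theorem snd : IsPoly₂ fun _ β => (β : K) := ⟨MvPolynomial.X 1, fun _ _ => by simp⟩

theorem add (hf : IsPoly₂ f) (hg : IsPoly₂ g) : IsPoly₂ fun α β => f α β + g α β := by
  obtain ⟨P, hP⟩ := hf
  obtain ⟨Q, hQ⟩ := hg
  exact ⟨P + Q, fun α β => by simp only [hP, hQ, map_add]⟩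

theorem mul (hf : IsPoly₂ f) (hg : IsPoly₂ g) : IsPoly₂ fun α β => f α β * g α β := by
  obtain ⟨P, hP⟩ := hf
  obtain ⟨Q, hQ⟩ := hg
  exact ⟨P * Q, fun α β => by simp only [hP, hQ, map_mul]⟩

theorem sum {ι : Type*} (s : Finset ι) {F : ι → ℚ → ℚ → K} (h : ∀ i ∈ s, IsPoly₂ (F i)) :
    IsPoly₂ fun α β => ∑ i ∈ s, F i α β := by
  classical
  induction s using Finset.induction_on with
  | empty => simpa using const 0
  | insert a s ha ih =>
    simp only [Finset.sum_insert ha]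
    exact (h a (by simp)).add (ih fun i hi => h i (by simp [hi]))

theorem pow (hf : IsPoly₂ f) (n : ℕ) : IsPoly₂ fun α β => f α β ^ n := by
  obtain ⟨P, hP⟩ := hf
  exact ⟨P ^ n, fun α β => by simp only [hP, map_pow]⟩

theorem eval [CharZero K] (P : Polynomial ℚ) {g : ℚ → ℚ → ℚ} (hg : IsPoly₂ fun α β => (g α β : K)) :
    IsPoly₂ fun α β => ((P.eval (g α β) : ℚ) : K) := by
  have : (fun α β => ((P.eval (g α β) : ℚ) : K)) =
      fun α β => ∑ i ∈ Finset.range (P.natDegree + 1), (P.coeff i : K) * (g α β : K) ^ i := by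
    funext α β
    rw [Polynomial.eval_eq_sum_range]
    push_cast
    rfl
  rw [this]
  exact sum _ fun i _ => (const _).mul (hg.pow i)

theorem eval_fst [CharZero K] (P : Polynomial ℚ) : IsPoly₂ fun α _ => ((P.eval α : ℚ) : K) :=
  eval P fst

theorem eval_snd [CharZero K] (P : Polynomial ℚ) : IsPoly₂ fun _ β => ((P.eval β : ℚ) : K) :=
  eval P snd

theorem map {L : Type*} [Field L] (φ : K →+* L) (hf : IsPoly₂ f) : IsPoly₂ fun α β => φ (f α β) := by
  obtain ⟨P, hP⟩ := hf
  refine ⟨MvPolynomial.map φ P, fun α β => ?_⟩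
  simp only [hP]
  rw [MvPolynomial.eval_map, MvPolynomial.eval, MvPolynomial.coe_eval₂Hom,
    MvPolynomial.hom_eval₂, RingHom.comp_id]
  congr 1
  ext i
  fin_cases i <;> simp

/-- A polynomial function is determined by its values on a sufficiently large grid. -/
theorem exists_degree (hf : IsPoly₂ f) :
    ∃ d : ℕ, (∀ β : ℚ, ∃ A : Polynomial K, A.natDegree ≤ d ∧ ∀ α : ℚ, f α β = A.eval (α : K)) ∧
      (∀ α : ℚ, ∃ A : Polynomial K, A.natDegree ≤ d ∧ ∀ β : ℚ, f α β = A.eval (β : K)) := by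
  obtain ⟨P, hP⟩ := hf
  simp only [hP]
  clear hP
  induction P using MvPolynomial.induction_on with
  | C a =>
    refine ⟨0, fun β => ⟨Polynomial.C a, by simp, by simp⟩,
      fun α => ⟨Polynomial.C a, by simp, by simp⟩⟩
  | add P Q hP hQ =>
    obtain ⟨d, h1, h2⟩ := hP
    obtain ⟨d', h1', h2'⟩ := hQ
    refine ⟨max d d', fun β => ?_, fun α => ?_⟩
    · obtain ⟨A, hA, hA'⟩ := h1 β
      obtain ⟨B, hB, hB'⟩ := h1' β
      refine ⟨A + B, (Polynomial.natDegree_add_le _ _).trans (max_le_max hA hB), fun α => ?_⟩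
      rw [map_add, hA', hB', Polynomial.eval_add]
    · obtain ⟨A, hA, hA'⟩ := h2 α
      obtain ⟨B, hB, hB'⟩ := h2' α
      refine ⟨A + B, (Polynomial.natDegree_add_le _ _).trans (max_le_max hA hB), fun β => ?_⟩
      rw [map_add, hA', hB', Polynomial.eval_add]
  | mul_X P i hP =>
    obtain ⟨d, h1, h2⟩ := hP
    refine ⟨d + 1, fun β => ?_, fun α => ?_⟩
    · obtain ⟨A, hA, hA'⟩ := h1 β
      fin_cases i
      · refine ⟨A * Polynomial.X, (Polynomial.natDegree_mul_le.trans
          (add_le_add hA Polynomial.natDegree_X_le)), fun α => ?_⟩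
        rw [map_mul, hA']; simp
      · refine ⟨A * Polynomial.C (β : K), (Polynomial.natDegree_mul_C_le _ _).trans (by omega),
          fun α => ?_⟩
        rw [map_mul, hA']; simp
    · obtain ⟨A, hA, hA'⟩ := h2 α
      fin_cases i
      · refine ⟨A * Polynomial.C (α : K), (Polynomial.natDegree_mul_C_le _ _).trans (by omega),
          fun α => ?_⟩
        rw [map_mul, hA']; simp
      · refine ⟨A * Polynomial.X, (Polynomial.natDegree_mul_le.trans
          (add_le_add hA Polynomial.natDegree_X_le)), fun α => ?_⟩
        rw [map_mul, hA']; simp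

theorem tendsto {p : ℕ} [Fact p.Prime] {f : ℚ → ℚ → ℂ_[p]} (hf : IsPoly₂ f) {a b : ℕ → ℚ}
    {α β : ℚ}
    (ha : Tendsto (fun j => (a j : ℚ_[p])) atTop (𝓝 (α : ℚ_[p])))
    (hb : Tendsto (fun j => (b j : ℚ_[p])) atTop (𝓝 (β : ℚ_[p]))) :
    Tendsto (fun j => f (a j) (b j)) atTop (𝓝 (f α β)) := by
  have hcont : Continuous (algebraMap ℚ_[p] ℂ_[p]) := continuous_algebraMap _ _
  have ha' : Tendsto (fun j => (a j : ℂ_[p])) atTop (𝓝 (α : ℂ_[p])) := by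
    have := (hcont.tendsto _).comp ha
    simpa only [Function.comp_def, map_ratCast] using this
  have hb' : Tendsto (fun j => (b j : ℂ_[p])) atTop (𝓝 (β : ℂ_[p])) := by
    have := (hcont.tendsto _).comp hb
    simpa only [Function.comp_def, map_ratCast] using this
  obtain ⟨P, hP⟩ := hf
  simp only [hP]
  clear hP
  induction P using MvPolynomial.induction_on with
  | C a => simp
  | add P Q hP hQ => simp only [map_add]; exact hP.add hQ
  | mul_X P i hP =>
    simp only [map_mul]
    refine hP.mul ?_
    fin_cases i
    · simpa using ha'
    · simpa using hb'

end IsPoly₂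

/-- Lagrange interpolation is exact on polynomials of small degree. -/
theorem sum_lagrange_basis_mul_eval [CharZero K] {M : ℕ} {v : ℕ → ℚ} (hv : Function.Injective v)
    {A : Polynomial K} (hA : A.natDegree < M) (x : ℚ) :
    A.eval (x : K) = ∑ i ∈ Finset.range M,
      (((Lagrange.basis (Finset.range M) v i).eval x : ℚ) : K) * A.eval (v i : K) := by
  have h1 : ∀ k < M, (x ^ k : ℚ) = ∑ i ∈ Finset.range M,
      (Lagrange.basis (Finset.range M) v i).eval x * v i ^ k := by
    intro k hk
    have hdeg : (Polynomial.X ^ k : Polynomial ℚ).degree < (Finset.range M).card := by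
      rw [Polynomial.degree_X_pow, Finset.card_range]
      exact_mod_cast hk
    have h2 := Lagrange.eq_interpolate (s := Finset.range M) (v := v) hv.injOn hdeg
    have h3 := congrArg (Polynomial.eval x) h2
    rw [Lagrange.interpolate_apply, Polynomial.eval_finsetSum] at h3
    simp only [Polynomial.eval_pow, Polynomial.eval_X, Polynomial.eval_mul, Polynomial.eval_C] at h3
    rw [h3]
    exact Finset.sum_congr rfl fun i _ => mul_comm _ _
  rw [Polynomial.eval_eq_sum_range' hA]
  have h2 : ∀ i ∈ Finset.range M, (((Lagrange.basis (Finset.range M) v i).eval x : ℚ) : K) *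
      A.eval (v i : K) = ∑ k ∈ Finset.range M,
        (((Lagrange.basis (Finset.range M) v i).eval x : ℚ) : K) * (A.coeff k * (v i : K) ^ k) := by
    intro i _
    rw [Polynomial.eval_eq_sum_range' hA, Finset.mul_sum]
  rw [Finset.sum_congr rfl h2, Finset.sum_comm]
  refine Finset.sum_congr rfl fun k hk => ?_
  have h3 := congrArg (Rat.cast : ℚ → K) (h1 k (Finset.mem_range.mp hk))
  push_cast at h3
  rw [h3, Finset.mul_sum]
  exact Finset.sum_congr rfl fun i _ => by ring

/-- A polynomial function over `L` with values in the subfield `K` on a grid has coefficients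
in `K`. -/
theorem IsPoly₂.exists_map_eq [CharZero K] {L : Type*} [Field L] [CharZero L] (φ : K →+* L)
    {f : ℚ → ℚ → L} (hf : IsPoly₂ f) {u v : ℕ → ℚ} (hu : Function.Injective u)
    (hv : Function.Injective v) {y : ℕ → ℕ → K} (hy : ∀ i j, f (u i) (v j) = φ (y i j)) :
    ∃ g : ℚ → ℚ → K, IsPoly₂ g ∧ ∀ α β, f α β = φ (g α β) := by
  obtain ⟨d, h1, h2⟩ := hf.exists_degree
  refine ⟨fun α β => ∑ i ∈ Finset.range (d + 1), ∑ j ∈ Finset.range (d + 1),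
    (((Lagrange.basis (Finset.range (d + 1)) u i).eval α : ℚ) : K) *
      ((((Lagrange.basis (Finset.range (d + 1)) v j).eval β : ℚ) : K) * y i j), ?_, fun α β => ?_⟩
  · exact IsPoly₂.sum _ fun i _ => IsPoly₂.sum _ fun j _ =>
      (IsPoly₂.eval_fst _).mul ((IsPoly₂.eval_snd _).mul (IsPoly₂.const _))
  · obtain ⟨A, hA, hA'⟩ := h1 β
    rw [hA', sum_lagrange_basis_mul_eval hu (Nat.lt_succ_of_le hA) α, map_sum]
    refine Finset.sum_congr rfl fun i _ => ?_
    obtain ⟨B, hB, hB'⟩ := h2 (u i)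
    rw [← hA', hB', sum_lagrange_basis_mul_eval hv (Nat.lt_succ_of_le hB) β, map_sum, Finset.mul_sum]
    refine Finset.sum_congr rfl fun j _ => ?_
    rw [← hB', hy, map_mul, map_mul, map_ratCast, map_ratCast]

/-- Division of power series preserves the field of coefficients. -/
theorem exists_map_eq_of_mul_eq {L : Type*} [Field L] (φ : K →+* L) {D R : K⟦X⟧} {Y : L⟦X⟧}
    (hD : D ≠ 0) (h : PowerSeries.map φ D * Y = PowerSeries.map φ R) :
    ∃ Y₀ : K⟦X⟧, Y = PowerSeries.map φ Y₀ := by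
  obtain ⟨n, U, hU, hDU⟩ : ∃ (n : ℕ) (U : K⟦X⟧), PowerSeries.constantCoeff U ≠ 0 ∧
      D = PowerSeries.X ^ n * U := by
    refine ⟨D.order.toNat, PowerSeries.divXPowOrder D, ?_, (PowerSeries.X_pow_order_mul_divXPowOrder).symm⟩
    rw [PowerSeries.constantCoeff_divXPowOrder]
    exact PowerSeries.coeff_order hD
  obtain ⟨R', hR'⟩ : PowerSeries.X ^ n ∣ R := by
    rw [PowerSeries.X_pow_dvd_iff]
    intro i hi
    have h1 : (PowerSeries.X ^ n : L⟦X⟧) ∣ PowerSeries.map φ R := by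
      rw [← h, hDU, map_mul, map_pow, PowerSeries.map_X, mul_assoc]
      exact dvd_mul_right _ _
    have h2 := PowerSeries.X_pow_dvd_iff.mp h1 i hi
    rw [PowerSeries.coeff_map] at h2
    exact (map_eq_zero φ).mp h2
  refine ⟨U⁻¹ * R', ?_⟩
  have hX : (PowerSeries.X ^ n : L⟦X⟧) ≠ 0 := pow_ne_zero _ PowerSeries.X_ne_zero
  rw [hDU, hR', map_mul, map_mul, map_pow, PowerSeries.map_X, mul_assoc] at h
  have h3 := mul_left_cancel₀ hX h
  rw [map_mul, ← h3, ← mul_assoc, ← map_mul, PowerSeries.inv_mul_cancel _ hU, map_one, one_mul]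

end PolynomialFunctions

/-! ### Uniqueness of asymptotic expansions -/

section Uniqueness

theorem tendsto_mul_exp_sub_div (z : ℂ) :
    Tendsto (fun h : ℝ => (z * Complex.exp h - z) / h) (𝓝[<] 0) (𝓝 z) := by
  have h1 : HasDerivAt (fun h : ℝ => z * Complex.exp h) (z * Complex.exp (0 : ℝ)) 0 := by
    have := ((Complex.hasDerivAt_exp ((0 : ℝ) : ℂ)).comp_ofReal).const_mul z
    simpa using this
  have h2 := h1.tendsto_slope
  simp only [Complex.ofReal_zero, Complex.exp_zero, mul_one] at h2
  refine (h2.mono_left (nhdsWithin_mono _ fun x hx => (ne_of_lt hx))).congr fun h => ?_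
  rw [slope_def_module]
  simp only [sub_zero, Complex.ofReal_zero, Complex.exp_zero, mul_one, Complex.real_smul,
    Complex.ofReal_inv]
  rw [div_eq_inv_mul]

theorem isTheta_mul_exp_sub {z : ℂ} (hz : z ≠ 0) :
    (fun h : ℝ => z * Complex.exp h - z) =Θ[𝓝[<] 0] fun h : ℝ => h := by
  have h1 := tendsto_mul_exp_sub_div z
  have h2 : (fun h : ℝ => z * Complex.exp h - z) =Θ[𝓝[<] 0] fun h : ℝ => (h : ℂ) := by
    exact (isTheta_of_div_tendsto_nhds_ne_zero h1 hz).symm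
  refine h2.trans ?_
  refine ⟨IsBigO.of_bound 1 ?_, IsBigO.of_bound 1 ?_⟩ <;> simp

/-- Since `z e^h - z` is of exact order `h`, the lowest nonzero coefficient of `P` dictates the
order of vanishing. -/
theorem polynomial_coeff_eq_zero_of_isBigO {z : ℂ} (hz : z ≠ 0) {P : Polynomial ℂ} {M : ℕ}
    (h : (fun h : ℝ => P.eval (z * Complex.exp h - z)) =O[𝓝[<] 0] fun h : ℝ => h ^ M) (n : ℕ)
    (hn : n < M) : P.coeff n = 0 := by
  by_contra hne
  have hP : P ≠ 0 := fun h0 => hne (by simp [h0])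
  set k := P.natTrailingDegree with hk
  have hkn : k ≤ n := Polynomial.natTrailingDegree_le_of_ne_zero hne
  obtain ⟨Q, hQ⟩ : Polynomial.X ^ k ∣ P := by
    rw [Polynomial.X_pow_dvd_iff]
    exact fun d hd => Polynomial.coeff_eq_zero_of_lt_natTrailingDegree hd
  have hQ0 : Q.eval 0 ≠ 0 := by
    rw [← Polynomial.coeff_zero_eq_eval_zero]
    have h1 : P.coeff k = Q.coeff 0 := by
      conv_lhs => rw [hQ]
      have := Polynomial.coeff_X_pow_mul Q k 0
      rwa [zero_add] at this
    rw [← h1]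
    exact Polynomial.trailingCoeff_nonzero_iff_nonzero.mpr hP
  have hΘ := isTheta_mul_exp_sub hz
  have hw0 : Tendsto (fun h : ℝ => z * Complex.exp h - z) (𝓝[<] 0) (𝓝 0) := by
    have : Continuous fun h : ℝ => z * Complex.exp h - z := by fun_prop
    have h1 := this.tendsto 0
    simp only [Complex.ofReal_zero, Complex.exp_zero, mul_one, sub_self] at h1
    exact h1.mono_left nhdsWithin_le_nhds
  have h1 : Tendsto (fun h : ℝ => Q.eval (z * Complex.exp h - z)) (𝓝[<] 0) (𝓝 (Q.eval 0)) :=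
    (Q.continuous.tendsto 0).comp hw0
  have h2 : (fun _ : ℝ => (1 : ℝ)) =O[𝓝[<] 0] fun h : ℝ => Q.eval (z * Complex.exp h - z) :=
    by
    refine (isBigO_const_left_iff_pos_le_norm one_ne_zero).mpr ⟨‖Q.eval 0‖ / 2, by positivity, ?_⟩
    exact (h1.norm.eventually (lt_mem_nhds (half_lt_self (norm_pos_iff.mpr hQ0)))).mono
      fun _ h => h.le
  have h3 : (fun h : ℝ => h ^ k) =O[𝓝[<] 0] fun h : ℝ => h ^ M := by
    have h4 := (hΘ.2.pow k).mul h2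
    simp only [mul_one] at h4
    refine h4.trans (IsBigO.trans ?_ h)
    refine IsBigO.of_bound 1 (Eventually.of_forall fun h => ?_)
    conv_rhs => rw [hQ]
    simp
  have h5 : (fun h : ℝ => h ^ M) =o[𝓝[<] 0] fun h : ℝ => h ^ k :=
    (isLittleO_pow_pow (hkn.trans_lt hn)).mono nhdsWithin_le_nhds
  have h6 := h3.trans_isLittleO h5
  refine isLittleO_irrefl (Filter.Eventually.frequently ?_) h6
  filter_upwards [self_mem_nhdsWithin] with h hh
  exact pow_ne_zero _ (ne_of_lt hh)

end Uniqueness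

/-! ### Infinite Pochhammer symbols -/

section Pochhammer

variable {q : ℂ}

theorem summable_norm_neg_mul_pow (x : ℂ) (hq : ‖q‖ < 1) : Summable fun k : ℕ => ‖-(x * q ^ k)‖ := by
  simp only [norm_neg, norm_mul, norm_pow]
  exact (summable_geometric_of_lt_one (norm_nonneg _) hq).mul_left _

theorem multipliable_one_sub_mul_pow (x : ℂ) (hq : ‖q‖ < 1) :
    Multipliable fun k : ℕ => 1 - x * q ^ k := by
  simpa only [sub_eq_add_neg] using multipliable_one_add_of_summable (summable_norm_neg_mul_pow x hq)

theorem tendsto_qPochInf (x : ℂ) (hq : ‖q‖ < 1) :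
    Tendsto (fun n : ℕ => ∏ k ∈ Finset.range n, (1 - x * q ^ k)) atTop (𝓝 (qPochInf x q)) :=
  (multipliable_one_sub_mul_pow x hq).hasProd.tendsto_prod_nat

theorem qPochInf_ne_zero {x : ℂ} (hq : ‖q‖ < 1) (h : ∀ k : ℕ, 1 - x * q ^ k ≠ 0) :
    qPochInf x q ≠ 0 := by
  have := tprod_one_add_ne_zero_of_summable (f := fun k : ℕ => -(x * q ^ k))
    (by simpa only [← sub_eq_add_neg] using h) (summable_norm_neg_mul_pow x hq)
  simp only [← sub_eq_add_neg] at this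
  exact this

theorem qPochInf_eq_prod_mul (x : ℂ) (hq : ‖q‖ < 1) (n : ℕ) :
    qPochInf x q = (∏ k ∈ Finset.range n, (1 - x * q ^ k)) * qPochInf (x * q ^ n) q := by
  refine tendsto_nhds_unique ((tendsto_add_atTop_iff_nat n).mpr (tendsto_qPochInf x hq)) ?_
  refine ((tendsto_qPochInf (x * q ^ n) hq).const_mul _).congr fun j => ?_
  rw [add_comm j n, Finset.prod_range_add]
  congr 1
  exact Finset.prod_congr rfl fun k _ => by rw [pow_add]; ring

theorem qFac_mul_qPochInf (hq : ‖q‖ < 1) (n : ℕ) :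
    qFac q n * qPochInf (q ^ (n + 1)) q = qPochInf q q := by
  rw [qPochInf_eq_prod_mul q hq n, qFac]
  congr 1
  · exact Finset.prod_congr rfl fun k _ => by rw [pow_succ']
  · rw [pow_succ']

theorem qPochInf_self_ne_zero (hq : ‖q‖ < 1) : qPochInf q q ≠ 0 := by
  refine qPochInf_ne_zero hq fun k h => ?_
  have h1 : ‖q ^ (k + 1)‖ < 1 := by
    rw [norm_pow]; exact pow_lt_one₀ (norm_nonneg _) hq (Nat.succ_ne_zero k)
  rw [pow_succ', ← sub_eq_zero.mp h, norm_one] at h1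
  exact lt_irrefl _ h1

end Pochhammer

/-! ### The `q`-beta function at positive integers -/

section Integers

variable {m : ℕ} {z : ℂ}

theorem norm_mul_exp_lt_one (hm : 0 < m) (hz : IsPrimitiveRoot z m) {h : ℝ} (hh : h < 0) :
    ‖z * Complex.exp h‖ < 1 := by
  rw [norm_mul, hz.norm'_eq_one hm.ne', one_mul, Complex.norm_exp, Complex.ofReal_re]
  exact Real.exp_lt_one_iff.mpr hh

theorem ratResidue_natCast (m n : ℕ) : ratResidue m n = n % m := by
  simp [ratResidue, ZMod.val_natCast]

theorem qPower_natCast (hz : IsPrimitiveRoot z m) (h : ℝ) (n : ℕ) :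
    qPower z m h n = (z * Complex.exp h) ^ n := by
  rw [qPower, ratResidue_natCast, mul_pow, ← Complex.exp_nat_mul, hz.eq_orderOf, pow_mod_orderOf,
    Rat.cast_natCast]

theorem qBetaFun_natCast (hm : 0 < m) (hz : IsPrimitiveRoot z m) (a b : ℕ) {h : ℝ} (hh : h < 0) :
    qFac (z * Complex.exp h) (a + b + 1) * qBetaFun z m ((a + 1 : ℕ) : ℚ) ((b + 1 : ℕ) : ℚ) h =
      betaConst (a / m) (b / m) * qFac (z * Complex.exp h) a * qFac (z * Complex.exp h) b := by
  have hq := norm_mul_exp_lt_one hm hz hh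
  have hab : ((a + 1 : ℕ) : ℚ) + ((b + 1 : ℕ) : ℚ) = ((a + b + 1 + 1 : ℕ) : ℚ) := by
    push_cast; ring
  rw [qBetaFun, hab, qPower_natCast hz, qPower_natCast hz, qPower_natCast hz,
    ratBracket_natCast_succ hm, ratBracket_natCast_succ hm]
  set q := z * Complex.exp h
  have h0 := qPochInf_self_ne_zero hq
  have h1 := qFac_mul_qPochInf hq a
  have h2 := qFac_mul_qPochInf hq b
  have h3 := qFac_mul_qPochInf hq (a + b + 1)
  have h1' : qPochInf (q ^ (a + 1)) q ≠ 0 := right_ne_zero_of_mul (h1.trans_ne h0)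
  have h2' : qPochInf (q ^ (b + 1)) q ≠ 0 := right_ne_zero_of_mul (h2.trans_ne h0)
  have hΓ : ((Real.Gamma (((a / m + 1 : ℕ) : ℚ) + ((b / m + 1 : ℕ) : ℚ) : ℚ) /
      (Real.Gamma ((a / m + 1 : ℕ) : ℚ) * Real.Gamma ((b / m + 1 : ℕ) : ℚ)) : ℝ) : ℂ) =
      betaConst (a / m) (b / m) := by
    have e : (((((a / m + 1 : ℕ) : ℚ) + ((b / m + 1 : ℕ) : ℚ) : ℚ)) : ℝ) =
      ((a / m + b / m + 1 : ℕ) : ℝ) + 1 := by push_cast; ring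
    rw [e, Real.Gamma_nat_eq_factorial]
    simp only [Nat.cast_succ, Rat.cast_add, Rat.cast_natCast, Rat.cast_one,
      Real.Gamma_nat_eq_factorial]
    rw [betaConst]
    push_cast
    rfl
  rw [hΓ, mul_left_comm, mul_assoc (betaConst _ _ : ℂ)]
  congr 1
  rw [mul_div_assoc', div_eq_iff (mul_ne_zero h1' h2'), ← mul_assoc, h3]
  rw [mul_mul_mul_comm, h1, h2]

end Integers

/-! ### Smooth logarithms of the Pochhammer factors and decay of their derivatives -/

section LogFactor

open scoped ContDiff

/-- `1 - w e^(-u)` if `w ≠ 1`, and the smooth extension of `(1 - e^(-u)) / u` if `w = 1`. -/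
noncomputable def phiFactor (w : ℂ) (u : ℝ) : ℂ :=
  if w = 1 then dslope (fun x : ℂ => -Complex.exp (-x)) 0 u else 1 - w * Complex.exp (-u)

theorem phiFactor_one_zero : phiFactor 1 0 = 1 := by
  rw [phiFactor, if_pos rfl, Complex.ofReal_zero, dslope_same]
  have : HasDerivAt (fun x : ℂ => -Complex.exp (-x)) (-(Complex.exp (-0) * -1)) 0 :=
    ((hasDerivAt_neg (0 : ℂ)).cexp).neg
  rw [this.deriv]; simp

theorem phiFactor_one_of_ne_zero {u : ℝ} (hu : u ≠ 0) :
    phiFactor 1 u = (((1 - Real.exp (-u)) / u : ℝ) : ℂ) := by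
  rw [phiFactor, if_pos rfl, dslope_of_ne _ (by exact_mod_cast hu), slope_def_field]
  push_cast
  simp
  ring

theorem phiFactor_of_ne {w : ℂ} (hw : w ≠ 1) (u : ℝ) : phiFactor w u = 1 - w * Complex.exp (-u) :=
  if_neg hw

theorem div_pos_one_sub_exp_neg {u : ℝ} (hu : u ≠ 0) : 0 < (1 - Real.exp (-u)) / u := by
  rcases lt_or_gt_of_ne hu with h | h
  · exact div_pos_of_neg_of_neg (by have := Real.one_lt_exp_iff.mpr (neg_pos.mpr h); linarith) h
  · exact div_pos (by have := Real.exp_lt_one_iff.mpr (neg_neg_iff_pos.mpr h); linarith) h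

/-- For `w = 1` the value is a positive real, for `w = -1` it is `1 + e^(-u)`, and otherwise its
imaginary part is nonzero. So the principal logarithm is smooth along the whole real line, including
negative `u`. -/
theorem phiFactor_mem_slitPlane {w : ℂ} (hw : ‖w‖ = 1) (u : ℝ) :
    phiFactor w u ∈ Complex.slitPlane := by
  by_cases h1 : w = 1
  · subst h1
    rcases eq_or_ne u 0 with rfl | hu
    · rw [phiFactor_one_zero]; exact Complex.one_mem_slitPlane
    · rw [phiFactor_one_of_ne_zero hu]
      exact Complex.ofReal_mem_slitPlane.mpr (div_pos_one_sub_exp_neg hu)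
  · rw [phiFactor_of_ne h1, Complex.mem_slitPlane_iff]
    have he : Complex.exp (-u) = ((Real.exp (-u) : ℝ) : ℂ) := by push_cast; rfl
    rw [he]
    by_cases him : w.im = 0
    · left
      have hre : w.re = -1 := by
        have h2 : w.re ^ 2 = 1 := by
          have := Complex.sq_norm w
          rw [hw, Complex.normSq_apply, him] at this
          nlinarith
        rcases eq_or_eq_neg_of_sq_eq_sq w.re 1 (by rw [h2, one_pow]) with h | h
        · exact absurd (Complex.ext h him) h1
        · exact h
      rw [Complex.sub_re, Complex.re_mul_ofReal, hre, Complex.one_re]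
      have := Real.exp_pos (-u)
      linarith
    · right
      rw [Complex.sub_im, Complex.im_mul_ofReal, Complex.one_im, zero_sub]
      exact neg_ne_zero.mpr (mul_ne_zero him (Real.exp_pos _).ne')

theorem contDiff_phiFactor (w : ℂ) : ContDiff ℝ ∞ (phiFactor w) := by
  by_cases h1 : w = 1
  · have h2 : DifferentiableOn ℂ (dslope (fun x : ℂ => -Complex.exp (-x)) 0) Set.univ :=
      (Complex.differentiableOn_dslope univ_mem).mpr (by fun_prop)
    have h3 : ContDiff ℂ ∞ (dslope (fun x : ℂ => -Complex.exp (-x)) 0) :=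
      (differentiableOn_univ.mp h2).contDiff
    have h4 : phiFactor w = fun u : ℝ => dslope (fun x : ℂ => -Complex.exp (-x)) 0 u := by
      funext u; rw [phiFactor, if_pos h1]
    rw [h4]
    exact (h3.restrict_scalars ℝ).comp Complex.ofRealCLM.contDiff
  · have h4 : phiFactor w = fun u : ℝ => 1 - w * Complex.exp (-u) :=
      funext fun u => phiFactor_of_ne h1 u
    rw [h4]
    have : ContDiff ℝ ∞ fun u : ℝ => (u : ℂ) := Complex.ofRealCLM.contDiff
    exact contDiff_const.sub (contDiff_const.mul this.neg.cexp)

/-- A smooth logarithm of `phiFactor w`. -/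
noncomputable def logFactor (w : ℂ) (u : ℝ) : ℂ := Complex.log (phiFactor w u)

variable {w : ℂ}

theorem exp_logFactor (hw : ‖w‖ = 1) (u : ℝ) : Complex.exp (logFactor w u) = phiFactor w u :=
  Complex.exp_log (Complex.slitPlane_ne_zero (phiFactor_mem_slitPlane hw u))

theorem logFactor_one_zero : logFactor 1 0 = 0 := by
  rw [logFactor, phiFactor_one_zero, Complex.log_one]

theorem contDiff_logFactor (hw : ‖w‖ = 1) : ContDiff ℝ ∞ (logFactor w) := by
  refine contDiff_iff_contDiffAt.mpr fun u => ?_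
  have h1 : ContDiffAt ℂ ∞ Complex.log (phiFactor w u) :=
    Complex.contDiffAt_log (phiFactor_mem_slitPlane hw u)
  exact (h1.restrict_scalars ℝ).comp u (contDiff_phiFactor w).contDiffAt

theorem tendsto_cexp_neg_atTop : Tendsto (fun u : ℝ => Complex.exp (-u)) atTop (𝓝 0) := by
  rw [tendsto_zero_iff_norm_tendsto_zero]
  simpa [Complex.norm_exp] using Real.tendsto_exp_neg_atTop_nhds_zero

theorem tendsto_logFactor (hw : w ≠ 1) : Tendsto (logFactor w) atTop (𝓝 0) := by
  have h1 : Tendsto (fun u : ℝ => 1 - w * Complex.exp (-u)) atTop (𝓝 1) := by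
    simpa using (tendsto_cexp_neg_atTop.const_mul w).const_sub 1
  have h2 := h1.clog Complex.one_mem_slitPlane
  rw [Complex.log_one] at h2
  exact h2.congr fun u => by rw [logFactor, phiFactor_of_ne hw]

theorem logFactor_one_of_pos {u : ℝ} (hu : 0 < u) :
    logFactor 1 u = ((Real.log (1 - Real.exp (-u)) - Real.log u : ℝ) : ℂ) := by
  have h1 : 0 < 1 - Real.exp (-u) := by
    have := Real.exp_lt_one_iff.mpr (neg_neg_iff_pos.mpr hu); linarith
  rw [logFactor, phiFactor_one_of_ne_zero hu.ne', ← Real.log_div h1.ne' hu.ne', Complex.ofReal_log]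
  exact (div_pos h1 hu).le

theorem tendsto_logFactor_one :
    Tendsto (fun u : ℝ => logFactor 1 u + (Real.log u : ℂ)) atTop (𝓝 0) := by
  have h1 : Tendsto (fun u : ℝ => 1 - Real.exp (-u)) atTop (𝓝 1) := by
    simpa using Real.tendsto_exp_neg_atTop_nhds_zero.const_sub 1
  have h2 := h1.log one_ne_zero
  rw [Real.log_one] at h2
  have h3 : Tendsto (fun u : ℝ => ((Real.log (1 - Real.exp (-u)) : ℝ) : ℂ)) atTop (𝓝 0) := by
    exact_mod_cast (Complex.continuous_ofReal.tendsto 0).comp h2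
  refine h3.congr' ?_
  filter_upwards [eventually_gt_atTop 0] with u hu
  rw [logFactor_one_of_pos hu]
  push_cast
  ring

/-- `w e^(-u) / (1 - w e^(-u))`. -/
noncomputable def expRatio (w : ℂ) (u : ℝ) : ℂ :=
  w * Complex.exp (-u) / (1 - w * Complex.exp (-u))

theorem one_sub_mul_exp_ne_zero (hw : ‖w‖ = 1) {u : ℝ} (hu : 0 < u) :
    1 - w * Complex.exp (-u) ≠ 0 := by
  intro h
  have h1 := congrArg norm (sub_eq_zero.mp h)
  rw [norm_one, norm_mul, hw, one_mul, Complex.norm_exp] at h1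
  have h2 := Real.exp_lt_one_iff.mpr (neg_neg_iff_pos.mpr hu)
  rw [Complex.neg_re, Complex.ofReal_re] at h1
  exact absurd h1.symm h2.ne

theorem hasDerivAt_mul_cexp_neg (w : ℂ) (u : ℝ) :
    HasDerivAt (fun u : ℝ => w * Complex.exp (-u)) (-(w * Complex.exp (-u))) u := by
  have h1 : HasDerivAt (fun u : ℝ => (u : ℂ)) 1 u := Complex.ofRealCLM.hasDerivAt
  have h2 := (h1.neg.cexp).const_mul w
  exact h2.congr_deriv (by simp)

theorem hasDerivAt_expRatio (hw : ‖w‖ = 1) {u : ℝ} (hu : 0 < u) :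
    HasDerivAt (expRatio w) (-(expRatio w u + expRatio w u ^ 2)) u := by
  have h0 := one_sub_mul_exp_ne_zero hw hu
  have h1 := hasDerivAt_mul_cexp_neg w u
  refine (h1.div (h1.const_sub 1) h0).congr_deriv ?_
  rw [expRatio]
  field_simp
  ring

theorem hasDerivAt_logFactor (hw : ‖w‖ = 1) {u : ℝ} (hu : 0 < u) :
    HasDerivAt (logFactor w) (expRatio w u - (if w = 1 then 1 else 0) * (u : ℂ)⁻¹) u := by
  have h0 := one_sub_mul_exp_ne_zero hw hu
  have h1 := (hasDerivAt_mul_cexp_neg w u).const_sub 1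
  have hu' : (u : ℂ) ≠ 0 := by exact_mod_cast hu.ne'
  by_cases hw1 : w = 1
  · subst hw1
    have hd : HasDerivAt (fun u : ℝ => (1 - 1 * Complex.exp (-u)) / u)
        ((1 * Complex.exp (-u) * u - (1 - 1 * Complex.exp (-u)) * 1) / (u : ℂ) ^ 2) u := by
      have := h1.div (Complex.ofRealCLM.hasDerivAt (x := u)) hu'
      refine this.congr_deriv ?_
      simp
    have hE : phiFactor 1 =ᶠ[𝓝 u] fun u : ℝ => (1 - 1 * Complex.exp (-u)) / u := by
      filter_upwards [lt_mem_nhds hu] with x hx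
      rw [phiFactor_one_of_ne_zero hx.ne']; push_cast; rw [one_mul]
    have h2 := (hd.congr_of_eventuallyEq hE).clog_real (phiFactor_mem_slitPlane hw u)
    refine h2.congr_deriv ?_
    rw [hE.eq_of_nhds, if_pos rfl, expRatio]
    simp only [one_mul] at h0 ⊢
    field_simp
  · have hE : phiFactor w = fun u : ℝ => 1 - w * Complex.exp (-u) :=
      funext fun u => phiFactor_of_ne hw1 u
    rw [← hE] at h1
    have h2 := h1.clog_real (phiFactor_mem_slitPlane hw u)
    refine h2.congr_deriv ?_
    rw [if_neg hw1, zero_mul, sub_zero, expRatio, phiFactor_of_ne hw1, neg_neg]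

/-- With `E = expRatio w` one has `E' = -(E + E^2)`, so derivatives remain multiples of `E` by
polynomials in `E`. The powers of `1 / u` come from dividing by `u` when `w = 1`. -/
theorem iteratedDeriv_logFactor (hw : ‖w‖ = 1) (n : ℕ) :
    ∃ (P : Polynomial ℂ) (c : ℂ), ∀ u : ℝ, 0 < u →
      iteratedDeriv (n + 1) (logFactor w) u =
        expRatio w u * P.eval (expRatio w u) + c * (u : ℂ)⁻¹ ^ (n + 1) := by
  induction n with
  | zero =>
    refine ⟨1, -(if w = 1 then 1 else 0), fun u hu => ?_⟩
    rw [zero_add, iteratedDeriv_one, (hasDerivAt_logFactor hw hu).deriv]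
    simp
    ring
  | succ n ih =>
    obtain ⟨P, c, h⟩ := ih
    refine ⟨-((1 + Polynomial.X) * (P + Polynomial.X * Polynomial.derivative P)), -(c * (n + 1)),
      fun u hu => ?_⟩
    rw [iteratedDeriv_succ]
    have hu' : (u : ℂ) ≠ 0 := by exact_mod_cast hu.ne'
    have hE : iteratedDeriv (n + 1) (logFactor w) =ᶠ[𝓝 u] fun u : ℝ =>
        expRatio w u * P.eval (expRatio w u) + c * (u : ℂ)⁻¹ ^ (n + 1) := by
      filter_upwards [lt_mem_nhds hu] with x hx using h x hx
    rw [hE.deriv_eq]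
    have h1 := hasDerivAt_expRatio hw hu
    have h2 := (P.hasDerivAt (expRatio w u)).comp u h1
    have h3 : HasDerivAt (fun u : ℝ => (u : ℂ)⁻¹) (-((u : ℂ) ^ 2)⁻¹) u := by
      have := (hasDerivAt_inv hu').comp_ofReal
      simpa using this
    have h4 := (h1.mul h2).add ((h3.pow (n + 1)).const_mul c)
    refine (HasDerivAt.deriv h4).trans ?_
    simp only [Function.comp_def, Polynomial.eval_neg, Polynomial.eval_mul, Polynomial.eval_add,
      Polynomial.eval_one, Polynomial.eval_X, Nat.add_sub_cancel]
    push_cast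
    rw [← inv_pow]
    ring

theorem isBigO_expRatio (hw : ‖w‖ = 1) :
    expRatio w =O[atTop] fun u : ℝ => Real.exp (-u) := by
  have h1 : Tendsto (fun u : ℝ => (1 - w * Complex.exp (-u))⁻¹) atTop (𝓝 1) := by
    have : Tendsto (fun u : ℝ => 1 - w * Complex.exp (-u)) atTop (𝓝 1) := by
      simpa using (tendsto_cexp_neg_atTop.const_mul w).const_sub 1
    simpa using this.inv₀ one_ne_zero
  have h2 : (fun u : ℝ => w * Complex.exp (-u)) =O[atTop] fun u : ℝ => Real.exp (-u) := by
    refine IsBigO.of_bound 1 (Eventually.of_forall fun u => ?_)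
    rw [norm_mul, hw, Complex.norm_exp]
    simp
  have h3 := h2.mul (h1.isBigO_one ℝ)
  simp only [mul_one] at h3
  exact h3

theorem isBigO_exp_neg_inv_sq : (fun u : ℝ => Real.exp (-u)) =O[atTop] fun u : ℝ => (u ^ 2)⁻¹ := by
  have := (isLittleO_exp_neg_mul_rpow_atTop one_pos (-2)).isBigO
  refine (this.congr' ?_ ?_)
  · exact Eventually.of_forall fun u => by simp
  · filter_upwards [eventually_gt_atTop 0] with u hu
    rw [Real.rpow_neg hu.le]
    norm_cast

/-- For `w = 1` the first derivative decays only like `1 / u`, which is not integrable; hence the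
restriction on `M`. -/
theorem isBigO_iteratedDeriv_logFactor (hw : ‖w‖ = 1) {M : ℕ} (hM : 2 ≤ M) :
    iteratedDeriv M (logFactor w) =O[atTop] fun u : ℝ => (u ^ 2)⁻¹ := by
  obtain ⟨n, rfl⟩ : ∃ n, M = n + 1 := ⟨M - 1, by omega⟩
  obtain ⟨P, c, h⟩ := iteratedDeriv_logFactor hw n
  have h1 := (isBigO_expRatio hw).trans isBigO_exp_neg_inv_sq
  have h2 : Tendsto (expRatio w) atTop (𝓝 0) :=
    (isBigO_expRatio hw).trans_tendsto Real.tendsto_exp_neg_atTop_nhds_zero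
  have h3 : Tendsto (fun u => P.eval (expRatio w u)) atTop (𝓝 (P.eval 0)) :=
    (P.continuous.tendsto 0).comp h2
  have h4 := h1.mul (h3.isBigO_one ℝ)
  simp only [mul_one] at h4
  have h5 : (fun u : ℝ => c * (u : ℂ)⁻¹ ^ (n + 1)) =O[atTop] fun u : ℝ => (u ^ 2)⁻¹ := by
    refine IsBigO.of_bound ‖c‖ ?_
    filter_upwards [eventually_ge_atTop 1] with u hu
    rw [norm_mul, norm_pow, norm_inv, Complex.norm_real, norm_inv, norm_pow, ← inv_pow]
    refine mul_le_mul_of_nonneg_left (pow_le_pow_of_le_one (by positivity) ?_ hM) (norm_nonneg _)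
    refine inv_le_one_of_one_le₀ ?_
    rw [Real.norm_of_nonneg (by linarith)]; exact hu
  refine (h4.add h5).congr' ?_ EventuallyEq.rfl
  filter_upwards [eventually_gt_atTop 0] with u hu
  exact (h u hu).symm

/-- The points `(x + k) t` may be slightly negative when `x < 0`, but stay above `-1` for small `t`;
the denominator `2 + u` is at least 1 there. -/
theorem exists_bound_of_isBigO {f : ℝ → ℂ} (hf : Continuous f)
    (h : f =O[atTop] fun u : ℝ => (u ^ 2)⁻¹) :
    ∃ C, 0 ≤ C ∧ ∀ u, -1 ≤ u → ‖f u‖ ≤ C / (2 + u) ^ 2 := by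
  obtain ⟨C₁, hC₁, h1⟩ := h.exists_nonneg
  obtain ⟨U, hU⟩ := eventually_atTop.mp h1.bound
  obtain ⟨C₂, hC₂⟩ := (isCompact_Icc (a := (-1 : ℝ)) (b := max U 1)).exists_bound_of_continuousOn
    hf.continuousOn
  have hC₂' : 0 ≤ C₂ := (norm_nonneg _).trans
    (hC₂ (-1) ⟨le_rfl, by have := le_max_right U 1; linarith⟩)
  refine ⟨max (9 * C₁) (C₂ * (2 + max U 1) ^ 2), le_max_of_le_left (by positivity), fun u hu => ?_⟩
  have hpos : 0 < (2 + u) ^ 2 := by have : 0 < 2 + u := by linarith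
                                    positivity
  rw [le_div_iff₀ hpos]
  rcases le_total u (max U 1) with h | h
  · refine le_trans ?_ (le_max_right _ _)
    refine mul_le_mul (hC₂ u ⟨hu, h⟩) ?_ hpos.le hC₂'
    exact pow_le_pow_left₀ (by linarith) (by linarith) 2
  · refine le_trans ?_ (le_max_left _ _)
    have h2 := hU u ((le_max_left _ _).trans h)
    have hu1 : 1 ≤ u := (le_max_right _ _).trans h
    have hu2 : 0 < u ^ 2 := by positivity
    rw [Real.norm_of_nonneg (by positivity), ← div_eq_mul_inv, le_div_iff₀ hu2] at h2
    have h3 : (2 + u) ^ 2 ≤ 9 * u ^ 2 := by nlinarith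
    calc ‖f u‖ * (2 + u) ^ 2 ≤ ‖f u‖ * (9 * u ^ 2) := by gcongr
      _ = 9 * (‖f u‖ * u ^ 2) := by ring
      _ ≤ 9 * C₁ := by gcongr

theorem exists_bound_iteratedDeriv_logFactor (hw : ‖w‖ = 1) {M : ℕ} (hM : 2 ≤ M) :
    ∃ C, 0 ≤ C ∧ ∀ u, -1 ≤ u → ‖iteratedDeriv M (logFactor w) u‖ ≤ C / (2 + u) ^ 2 :=
  exists_bound_of_isBigO ((contDiff_logFactor hw).continuous_iteratedDeriv M (by exact_mod_cast le_top))
    (isBigO_iteratedDeriv_logFactor hw hM)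

end LogFactor

/-! ### Lagrange interpolation of Riemann sums -/

section LagrangeError

open scoped ContDiff

/-- The Taylor polynomial approximates a function with decaying derivative of order `M`. -/
theorem norm_sub_taylorWithinEval_le {g : ℝ → ℂ} (hg : ContDiff ℝ ∞ g) {n : ℕ} {C : ℝ} (hC0 : 0 ≤ C)
    (hC : ∀ u, -1 ≤ u → ‖iteratedDeriv (n + 1) g u‖ ≤ C / (2 + u) ^ 2) {u b y : ℝ} (hu : -1 ≤ u)
    (hub : u < b) (hy : y ∈ Set.Icc u b) :
    ‖g y - taylorWithinEval g n (Set.Icc u b) u y‖ ≤ C / (2 + u) ^ 2 * (y - u) ^ (n + 1) := by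
  have hpos : 0 < 2 + u := by linarith
  have h1 := taylor_mean_remainder_bound (f := g) (n := n) (C := C / (2 + u) ^ 2) hub.le
    (hg.contDiffOn.of_le (by exact_mod_cast le_top)) hy (fun x hx => by
      rw [iteratedDerivWithin_eq_iteratedDeriv (uniqueDiffOn_Icc hub)
        (hg.contDiffAt.of_le (by exact_mod_cast le_top)) hx]
      refine (hC x (hu.trans hx.1)).trans ?_
      have := hx.1
      gcongr)
  refine h1.trans (div_le_self ?_ (by exact_mod_cast Nat.one_le_iff_ne_zero.mpr n.factorial_ne_zero))
  have : 0 ≤ y - u := by linarith [hy.1]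
  positivity

/-- Interpolation at `n + 1` nodes is exact on the Taylor polynomial of degree `n`, so only Taylor
remainders enter. All evaluation points lie in a window of length `2 K t` starting at `u = (k - K)
t`. -/
theorem norm_sub_sum_lagrange_le {g : ℝ → ℂ} (hg : ContDiff ℝ ∞ g) {n : ℕ} {C : ℝ} (hC0 : 0 ≤ C)
    (hC : ∀ u, -1 ≤ u → ‖iteratedDeriv (n + 1) g u‖ ≤ C / (2 + u) ^ 2) {v : ℕ → ℚ}
    (hv : Function.Injective v) {x : ℚ} {K : ℝ} (hK : 0 < K) (hx : |(x : ℝ)| ≤ K)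
    (hvK : ∀ i ∈ Finset.range (n + 1), |(v i : ℝ)| ≤ K) {t : ℝ} (ht : 0 < t) (hKt : K * t ≤ 1)
    (k : ℕ) :
    ‖g ((x + k) * t) - ∑ i ∈ Finset.range (n + 1),
        (((Lagrange.basis (Finset.range (n + 1)) v i).eval x : ℚ) : ℂ) * g ((v i + k) * t)‖ ≤
      (1 + ∑ i ∈ Finset.range (n + 1),
        ‖(((Lagrange.basis (Finset.range (n + 1)) v i).eval x : ℚ) : ℂ)‖) *
        (C / (2 + (k - K) * t) ^ 2 * (2 * K * t) ^ (n + 1)) := by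
  set u : ℝ := (k - K) * t with hu
  set b : ℝ := u + 2 * K * t with hb
  have hKt0 : 0 < K * t := mul_pos hK ht
  have hk0 : 0 ≤ (k : ℝ) * t := by positivity
  have hu1 : -1 ≤ u := by rw [hu, sub_mul]; linarith
  have hub : u < b := by rw [hb]; linarith
  have hmem : ∀ y : ℝ, |y| ≤ K → (y + k) * t ∈ Set.Icc u b := by
    intro y hy
    obtain ⟨h1, h2⟩ := abs_le.mp hy
    constructor
    · rw [hu]; exact mul_le_mul_of_nonneg_right (by linarith) ht.le
    · rw [hb, hu, ← sub_nonneg]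
      have : (k - K) * t + 2 * K * t - (y + k) * t = (K - y) * t := by ring
      rw [this]
      exact mul_nonneg (by linarith) ht.le
  set E : ℝ := C / (2 + u) ^ 2 * (2 * K * t) ^ (n + 1) with hE
  have hbound : ∀ y : ℝ, |y| ≤ K →
      ‖g ((y + k) * t) - taylorWithinEval g n (Set.Icc u b) u ((y + k) * t)‖ ≤ E := by
    intro y hy
    refine (norm_sub_taylorWithinEval_le hg hC0 hC hu1 hub (hmem y hy)).trans ?_
    have h1 := (hmem y hy).2
    have h2 := (hmem y hy).1
    rw [hE]
    refine mul_le_mul_of_nonneg_left (pow_le_pow_left₀ (by linarith) ?_ _) (by positivity)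
    rw [hb] at h1; linarith
  -- The Taylor polynomial at `u`, rewritten as a polynomial in the shift `y` through `(y + k) t`.
  let A : Polynomial ℂ := ∑ j ∈ Finset.range (n + 1),
    Polynomial.C (((j.factorial : ℂ))⁻¹ * iteratedDerivWithin j g (Set.Icc u b) u) *
      (Polynomial.C (t : ℂ) * (Polynomial.X + Polynomial.C (k : ℂ)) - Polynomial.C (u : ℂ)) ^ j
  have hAdeg : A.natDegree < n + 1 := by
    refine Nat.lt_succ_of_le (Polynomial.natDegree_sum_le_of_forall_le _ _ fun j hj => ?_)
    have h1 : (Polynomial.C (t : ℂ) * (Polynomial.X + Polynomial.C (k : ℂ)) -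
        Polynomial.C (u : ℂ)).natDegree ≤ 1 := by compute_degree
    have h2 := Polynomial.natDegree_pow_le_of_le j h1
    have h3 : j ≤ n := Nat.lt_succ_iff.mp (Finset.mem_range.mp hj)
    exact (Polynomial.natDegree_C_mul_le _ _).trans (h2.trans (by omega))
  have hA : ∀ y : ℚ, A.eval (y : ℂ) = taylorWithinEval g n (Set.Icc u b) u ((y + k) * t) := by
    intro y
    rw [taylor_within_apply, Polynomial.eval_finsetSum]
    refine Finset.sum_congr rfl fun j _ => ?_
    simp only [Polynomial.eval_mul, Polynomial.eval_C, Polynomial.eval_pow, Polynomial.eval_sub,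
      Polynomial.eval_add, Polynomial.eval_X, Complex.real_smul]
    push_cast
    ring
  have hlag := sum_lagrange_basis_mul_eval hv hAdeg x
  set lam : ℕ → ℂ := fun i => (((Lagrange.basis (Finset.range (n + 1)) v i).eval x : ℚ) : ℂ)
  have hsplit : g ((x + k) * t) - ∑ i ∈ Finset.range (n + 1), lam i * g ((v i + k) * t) =
      (g ((x + k) * t) - A.eval (x : ℂ)) -
        ∑ i ∈ Finset.range (n + 1), lam i * (g ((v i + k) * t) - A.eval (v i : ℂ)) := by
    simp only [mul_sub, Finset.sum_sub_distrib]
    rw [hlag]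
    ring
  rw [hsplit, add_mul (1 : ℝ), one_mul, Finset.sum_mul]
  refine (norm_sub_le _ _).trans (add_le_add ?_ ((norm_sum_le _ _).trans
    (Finset.sum_le_sum fun i hi => ?_)))
  · rw [hA]; exact hbound x hx
  · rw [norm_mul, hA]
    exact mul_le_mul_of_nonneg_left (hbound (v i) (hvK i hi)) (norm_nonneg _)

/-- With `w = 2 + (k - K) t ≥ 1 ≥ t`, each term is at most `2 (1 / w - 1 / (w + t))`, and these
telescope. -/
theorem sum_div_sq_le {K t : ℝ} (ht : 0 < t) (ht1 : t ≤ 1) (hKt : K * t ≤ 1) (n : ℕ) :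
    ∑ k ∈ Finset.range n, t / (2 + (k - K) * t) ^ 2 ≤ 2 := by
  have hv : ∀ k : ℕ, 1 ≤ 2 + ((k : ℝ) - K) * t := fun k => by
    have : 0 ≤ (k : ℝ) * t := by positivity
    rw [sub_mul]; linarith
  have h1 : ∑ k ∈ Finset.range n, t / (2 + (k - K) * t) ^ 2 ≤
      ∑ k ∈ Finset.range n, 2 * (1 / (2 + ((k : ℝ) - K) * t) -
        1 / (2 + (((k + 1 : ℕ) : ℝ) - K) * t)) := by
    refine Finset.sum_le_sum fun k _ => ?_
    have h2 := hv k
    have e : 2 + (((k + 1 : ℕ) : ℝ) - K) * t = 2 + ((k : ℝ) - K) * t + t := by push_cast; ring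
    rw [e]
    set w := 2 + ((k : ℝ) - K) * t
    have hw : 0 < w := by linarith
    have hwt : 0 < w + t := by linarith
    rw [div_sub_div _ _ hw.ne' hwt.ne', mul_div_assoc', div_le_div_iff₀ (by positivity) (by positivity)]
    have h3 : 0 ≤ t * w * (w - t) := by
      have : 0 ≤ w - t := by linarith
      positivity
    nlinarith
  refine h1.trans ?_
  rw [← Finset.mul_sum, Finset.sum_range_sub']
  have h2 : 1 / (2 + (((0 : ℕ) : ℝ) - K) * t) ≤ 1 := by
    rw [div_le_one (by linarith [hv 0])]; exact hv 0
  have h3 : 0 ≤ 1 / (2 + ((n : ℝ) - K) * t) := by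
    have := hv n; positivity
  linarith

/-- Lagrange interpolation in the shift of a Riemann sum has an error of high order. -/
theorem exists_norm_sum_lagrange_le {g : ℕ → ℝ → ℂ} (hg : ∀ k, ContDiff ℝ ∞ (g k)) {n : ℕ} {C : ℝ}
    (hC0 : 0 ≤ C)
    (hC : ∀ k u, -1 ≤ u → ‖iteratedDeriv (n + 1) (g k) u‖ ≤ C / (2 + u) ^ 2) {v : ℕ → ℚ}
    (hv : Function.Injective v) (x : ℚ) :
    ∃ C' t₀ : ℝ, 0 < t₀ ∧ ∀ t : ℝ, 0 < t → t ≤ t₀ → ∀ L : ℕ,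
      ‖∑ k ∈ Finset.range L, (g k ((x + k) * t) - ∑ i ∈ Finset.range (n + 1),
        (((Lagrange.basis (Finset.range (n + 1)) v i).eval x : ℚ) : ℂ) * g k ((v i + k) * t))‖ ≤
        C' * t ^ n := by
  set K : ℝ := 1 + |(x : ℝ)| + ∑ i ∈ Finset.range (n + 1), |(v i : ℝ)| with hKdef
  have hsum0 : 0 ≤ ∑ i ∈ Finset.range (n + 1), |(v i : ℝ)| :=
    Finset.sum_nonneg fun i _ => abs_nonneg _
  have hx0 := abs_nonneg (x : ℝ)
  have hK1 : 1 ≤ K := by rw [hKdef]; linarith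
  have hK : 0 < K := by linarith
  have hx : |(x : ℝ)| ≤ K := by rw [hKdef]; linarith
  have hvK : ∀ i ∈ Finset.range (n + 1), |(v i : ℝ)| ≤ K := fun i hi => by
    have := Finset.single_le_sum (f := fun i => |(v i : ℝ)|) (fun i _ => abs_nonneg _) hi
    rw [hKdef]; linarith
  set Λ : ℝ := 1 + ∑ i ∈ Finset.range (n + 1),
        ‖(((Lagrange.basis (Finset.range (n + 1)) v i).eval x : ℚ) : ℂ)‖ with hΛ
  have hΛ0 : 0 ≤ Λ := by
    have : 0 ≤ ∑ i ∈ Finset.range (n + 1),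
        ‖(((Lagrange.basis (Finset.range (n + 1)) v i).eval x : ℚ) : ℂ)‖ :=
      Finset.sum_nonneg fun i _ => norm_nonneg _
    rw [hΛ]; linarith
  -- One of the `n + 1` powers of `t` serves as the mesh of the Riemann sum, which is why the error
  -- is `t ^ n`, uniformly in `L`.
  refine ⟨Λ * C * (2 * K) ^ (n + 1) * 2, 1 / K, by positivity, fun t ht htK L => ?_⟩
  have hKt : K * t ≤ 1 := by
    rw [mul_comm]; exact (le_div_iff₀ hK).mp htK
  have ht1 : t ≤ 1 := by nlinarith
  refine (norm_sum_le_of_le _ fun k _ => norm_sub_sum_lagrange_le (hg k) hC0 (hC k) hv hK hx hvK ht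
    hKt k).trans ?_
  have h1 : ∀ k ∈ Finset.range L, Λ * (C / (2 + ((k : ℝ) - K) * t) ^ 2 * (2 * K * t) ^ (n + 1)) =
      Λ * C * (2 * K) ^ (n + 1) * t ^ n * (t / (2 + ((k : ℝ) - K) * t) ^ 2) := by
    intro k _
    rw [mul_pow (2 * K) t, pow_succ t n]
    ring
  rw [Finset.sum_congr rfl h1, ← Finset.mul_sum]
  have h2 := sum_div_sq_le ht ht1 hKt L
  calc Λ * C * (2 * K) ^ (n + 1) * t ^ n * ∑ k ∈ Finset.range L, t / (2 + ((k : ℝ) - K) * t) ^ 2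
      ≤ Λ * C * (2 * K) ^ (n + 1) * t ^ n * 2 := by gcongr
    _ = _ := by ring

end LagrangeError

/-! ### Asymptotics of a Pochhammer symbol by interpolation -/

section InfiniteProduct

open scoped ContDiff

variable {m : ℕ} {z : ℂ}

theorem prod_range_mul_ite_dvd {R : Type*} [CommMonoid R] {ρ k₀ : ℕ} (hk₀ : k₀ < m) (hρ : m ∣ ρ + k₀)
    (f : ℕ → R) (L : ℕ) :
    ∏ k ∈ Finset.range (m * L), (if m ∣ ρ + k then f k else 1) =
      ∏ j ∈ Finset.range L, f (k₀ + m * j) := by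
  induction L with
  | zero => simp
  | succ L ih =>
    rw [mul_add, mul_one, Finset.prod_range_add, ih, Finset.prod_range_succ]
    congr 1
    rw [Finset.prod_eq_single_of_mem k₀ (Finset.mem_range.mpr hk₀)]
    · rw [if_pos, add_comm]
      rw [add_left_comm]; exact (dvd_mul_right m L).add hρ
    · intro b hb hne
      rw [if_neg]
      intro h
      rw [add_left_comm, Nat.dvd_add_right (dvd_mul_right m L)] at h
      have hb' := Finset.mem_range.mp hb
      have h1 : (m : ℤ) ∣ (b : ℤ) - k₀ := by
        have h2 : (m : ℤ) ∣ (ρ + b : ℤ) := by exact_mod_cast h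
        have h3 : (m : ℤ) ∣ (ρ + k₀ : ℤ) := by exact_mod_cast hρ
        exact (dvd_sub h2 h3).trans (dvd_of_eq (by ring))
      have h4 := Int.eq_zero_of_abs_lt_dvd h1 (by rw [abs_lt]; omega)
      omega

/-- The sum of the logarithms of the factors with index below `a`. -/
noncomputable def sumLog (z : ℂ) (a : ℕ) (t : ℝ) : ℂ :=
  ∑ l ∈ Finset.range a, logFactor (z ^ l) (l * t)

/-- The truncated logarithm of a Pochhammer symbol. -/
noncomputable def shiftedSumLog (z : ℂ) (ρ : ℕ) (x t : ℝ) (L : ℕ) : ℂ :=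
  ∑ k ∈ Finset.range L, logFactor (z ^ (ρ + k)) ((x + k) * t)

theorem phiFactor_pow (hz : IsPrimitiveRoot z m) (j : ℕ) {u : ℝ} (hu : u ≠ 0) :
    phiFactor (z ^ j) u * (if m ∣ j then (u : ℂ) else 1) = 1 - z ^ j * Complex.exp (-u) := by
  by_cases h : m ∣ j
  · have hu' : (u : ℂ) ≠ 0 := by exact_mod_cast hu
    rw [if_pos h, (hz.pow_eq_one_iff_dvd j).mpr h, phiFactor_one_of_ne_zero hu]
    push_cast
    rw [div_mul_cancel₀ _ hu', one_mul]
  · rw [if_neg h, mul_one, phiFactor_of_ne]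
    rwa [Ne, hz.pow_eq_one_iff_dvd]

theorem norm_pow_eq_one (hm : 0 < m) (hz : IsPrimitiveRoot z m) (j : ℕ) : ‖z ^ j‖ = 1 := by
  rw [norm_pow, hz.norm'_eq_one hm.ne', one_pow]

/-- At the indices `k = k₀ + m j`, where the root of unity is 1, `phiFactor` has been divided by `(x
+ k) t = m t (κ + j)`. The product of the `κ + j` is the denominator of `Real.GammaSeq κ N`;
truncating at `m (N + 1)` factors yields exactly the `N + 1` indices `j` needed. -/
theorem exp_shiftedSumLog (hm : 0 < m) (hz : IsPrimitiveRoot z m) {ρ k₀ : ℕ} (hk₀ : k₀ < m)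
    (hρ : m ∣ ρ + k₀) {x κ t : ℝ} (hx : ∀ n : ℕ, x ≠ -n) (hκ : m * κ = x + k₀) (ht : 0 < t) {N : ℕ}
    (hN : 0 < N) :
    Complex.exp (shiftedSumLog z ρ x t (m * (N + 1))) *
        (((m * t) ^ (N + 1) * N.factorial * Real.exp (κ * Real.log N) : ℝ) : ℂ) =
      (∏ k ∈ Finset.range (m * (N + 1)),
        (1 - z ^ ρ * Complex.exp (-(x * t : ℝ)) * (z * Complex.exp (-t)) ^ k)) *
        (Real.GammaSeq κ N : ℂ) := by
  have hxk : ∀ k : ℕ, x + k ≠ 0 := fun k h => hx k (by linarith)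
  have hκj : ∀ j : ℕ, (m * t) * (κ + j) = (x + ((k₀ + m * j : ℕ) : ℝ)) * t := by
    intro j; push_cast; linear_combination t * hκ
  have hP : ∏ j ∈ Finset.range (N + 1), (κ + j) ≠ 0 := by
    refine Finset.prod_ne_zero_iff.mpr fun j _ h => ?_
    have := hκj j
    rw [h, mul_zero] at this
    exact mul_ne_zero (hxk _) ht.ne' this.symm
  have h1 : Complex.exp (shiftedSumLog z ρ x t (m * (N + 1))) *
      ∏ k ∈ Finset.range (m * (N + 1)), (if m ∣ ρ + k then (((x + k) * t : ℝ) : ℂ) else 1) =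
      ∏ k ∈ Finset.range (m * (N + 1)),
        (1 - z ^ ρ * Complex.exp (-(x * t : ℝ)) * (z * Complex.exp (-t)) ^ k) := by
    rw [shiftedSumLog, Complex.exp_sum, ← Finset.prod_mul_distrib]
    refine Finset.prod_congr rfl fun k _ => ?_
    rw [exp_logFactor (norm_pow_eq_one hm hz _), phiFactor_pow hz _ (mul_ne_zero (hxk k) ht.ne')]
    rw [pow_add, mul_pow, ← Complex.exp_nat_mul, mul_mul_mul_comm, ← Complex.exp_add]
    congr 3
    push_cast
    ring
  rw [prod_range_mul_ite_dvd hk₀ hρ (fun k => (((x + k) * t : ℝ) : ℂ))] at h1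
  have h2 : ∏ j ∈ Finset.range (N + 1), (((x + ((k₀ + m * j : ℕ) : ℝ)) * t : ℝ) : ℂ) =
      (((m * t) ^ (N + 1) * ∏ j ∈ Finset.range (N + 1), (κ + j) : ℝ) : ℂ) := by
    rw [← Complex.ofReal_prod, Finset.prod_congr rfl fun j _ => (hκj j).symm,
      Finset.prod_mul_distrib, Finset.prod_const, Finset.card_range]
  rw [h2] at h1
  rw [← h1, mul_assoc (Complex.exp _), ← Complex.ofReal_mul]
  congr 2
  have hN' : (0 : ℝ) < N := by exact_mod_cast hN
  rw [Real.GammaSeq, Real.rpow_def_of_pos hN', mul_comm (Real.log N)]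
  field_simp

/-- For a natural shift the sum is the unshifted one with the first `a` terms removed and `a` terms
added at the far end. -/
theorem shiftedSumLog_natCast (hz : IsPrimitiveRoot z m) {ρ a : ℕ} (ha : z ^ a = z ^ ρ) (t : ℝ)
    (L : ℕ) :
    shiftedSumLog z ρ a t (m * L) = sumLog z (m * L) t - sumLog z a t +
      ∑ l ∈ Finset.range a, logFactor (z ^ l) (((m * L + l : ℕ) : ℝ) * t) := by
  have h1 : shiftedSumLog z ρ a t (m * L) = ∑ k ∈ Finset.range (m * L),
      logFactor (z ^ (a + k)) (((a + k : ℕ) : ℝ) * t) := by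
    refine Finset.sum_congr rfl fun k _ => ?_
    rw [pow_add, ← ha, ← pow_add, Nat.cast_add]
  have h2 := Finset.sum_range_add (fun l => logFactor (z ^ l) ((l : ℝ) * t)) a (m * L)
  have h3 := Finset.sum_range_add (fun l => logFactor (z ^ l) ((l : ℝ) * t)) (m * L) a
  have h4 : ∑ l ∈ Finset.range a, logFactor (z ^ (m * L + l)) (((m * L + l : ℕ) : ℝ) * t) =
      ∑ l ∈ Finset.range a, logFactor (z ^ l) (((m * L + l : ℕ) : ℝ) * t) := by
    refine Finset.sum_congr rfl fun l _ => ?_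
    rw [pow_add, pow_mul, hz.pow_eq_one, one_pow, one_mul]
  rw [h1, ← h4, sumLog, sumLog]
  rw [add_comm (m * L) a] at h3
  linear_combination h3 - h2

/-- Terms at the far end tend to 0, except that for `z ^ l = 1` the division by `u` leaves `-log u`,
and `u` is asymptotic to `m t N`. -/
theorem tendsto_logFactor_add (hm : 0 < m) (hz : IsPrimitiveRoot z m) {t : ℝ} (ht : 0 < t) (l : ℕ) :
    Tendsto (fun N : ℕ => logFactor (z ^ l) (((m * (N + 1) + l : ℕ) : ℝ) * t) +
      (if m ∣ l then 1 else 0) * ((Real.log N + Real.log (m * t) : ℝ) : ℂ)) atTop (𝓝 0) := by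
  have hmt : 0 < m * t := by positivity
  have hu : Tendsto (fun N : ℕ => ((m * (N + 1) + l : ℕ) : ℝ) * t) atTop atTop := by
    refine Tendsto.atTop_mul_const ht (tendsto_natCast_atTop_atTop.comp ?_)
    exact tendsto_atTop_mono (fun N => show N ≤ m * (N + 1) + l by nlinarith) tendsto_id
  by_cases h : m ∣ l
  · simp only [if_pos h, one_mul, (hz.pow_eq_one_iff_dvd l).mpr h]
    have h1 := tendsto_logFactor_one.comp hu
    have h2 : Tendsto (fun N : ℕ => Real.log N + Real.log (m * t) -
        Real.log (((m * (N + 1) + l : ℕ) : ℝ) * t)) atTop (𝓝 0) := by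
      have h3 : Tendsto (fun N : ℕ => 1 + ((m : ℝ) + l) / m * (1 / N : ℝ)) atTop (𝓝 1) := by
        simpa using (tendsto_one_div_atTop_nhds_zero_nat.const_mul (((m : ℝ) + l) / m)).const_add 1
      have h4 := (h3.log one_ne_zero).neg
      rw [Real.log_one, neg_zero] at h4
      refine h4.congr' ?_
      filter_upwards [eventually_gt_atTop 0] with N hN
      have hN' : (0 : ℝ) < N := by exact_mod_cast hN
      have hm' : (0 : ℝ) < m := by exact_mod_cast hm
      rw [← Real.log_mul hN'.ne' hmt.ne', ← Real.log_inv, ← Real.log_div (by positivity) (by positivity)]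
      congr 1
      push_cast
      field_simp
      ring
    have h5 : Tendsto (fun N : ℕ => ((Real.log N + Real.log (m * t) -
        Real.log (((m * (N + 1) + l : ℕ) : ℝ) * t) : ℝ) : ℂ)) atTop (𝓝 0) := by
      exact_mod_cast (Complex.continuous_ofReal.tendsto 0).comp h2
    have h6 := h1.add h5
    rw [add_zero] at h6
    refine h6.congr fun N => ?_
    simp only [Function.comp_apply]
    push_cast
    ring
  · simp only [if_neg h, zero_mul, add_zero]
    exact (tendsto_logFactor (by rwa [Ne, hz.pow_eq_one_iff_dvd])).comp hu

theorem Function.Periodic.sum_range_add {f : ℕ → ℂ} (hf : Function.Periodic f m) (c : ℕ) :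
    ∑ l ∈ Finset.range m, f (c + l) = ∑ l ∈ Finset.range m, f l := by
  induction c with
  | zero => simp
  | succ c ih =>
    rw [← ih]
    have h1 := Finset.sum_range_succ (fun l => f (c + l)) m
    rw [Finset.sum_range_succ', add_zero, hf c] at h1
    rw [← add_right_cancel h1]
    exact Finset.sum_congr rfl fun l _ => by rw [add_right_comm, add_assoc]

theorem Function.Periodic.sum_range_add_mul {f : ℕ → ℂ} (hf : Function.Periodic f m) (ρ i : ℕ) :
    ∑ l ∈ Finset.range (ρ + m * i), f l =
      ∑ l ∈ Finset.range ρ, f l + i * ∑ l ∈ Finset.range m, f l := by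
  induction i with
  | zero => simp
  | succ i ih =>
    rw [mul_add, mul_one, ← add_assoc, Finset.sum_range_add, ih, hf.sum_range_add]
    push_cast
    ring

/-- The number of multiples of `m` below a node is affine in the node, so interpolation reproduces
it exactly. -/
theorem sum_range_ite_dvd {ρ k₀ : ℕ} (hρm : ρ < m) (hk₀ : k₀ < m) (hρ : m ∣ ρ + k₀) (i : ℕ) :
    m * ∑ l ∈ Finset.range (ρ + m * i), (if m ∣ l then (1 : ℂ) else 0) = ρ + m * i + k₀ := by
  have hper : Function.Periodic (fun l => if m ∣ l then (1 : ℂ) else 0) m := fun l => by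
    simp only [Nat.dvd_add_self_right]
  have h1 : ∀ a, 0 < a → a ≤ m → ∑ l ∈ Finset.range a, (if m ∣ l then (1 : ℂ) else 0) = 1 := by
    intro a ha ham
    rw [Finset.sum_eq_single_of_mem 0 (Finset.mem_range.mpr ha)]
    · simp
    · intro b hb hb0
      have := Finset.mem_range.mp hb
      exact if_neg fun h => absurd (Nat.le_of_dvd (Nat.pos_of_ne_zero hb0) h) (by omega)
  rw [hper.sum_range_add_mul, h1 m (by omega) le_rfl]
  rcases Nat.eq_zero_or_pos ρ with rfl | h0
  · obtain rfl : k₀ = 0 := Nat.eq_zero_of_dvd_of_lt (by simpa using hρ) hk₀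
    simp
  · rw [h1 ρ h0 hρm.le]
    obtain ⟨c, hc⟩ := hρ
    have hc1 : c = 1 := by
      have h2 : m * c < m * 2 := by omega
      have h3 : c < 2 := Nat.lt_of_mul_lt_mul_left h2
      have h4 : c ≠ 0 := by rintro rfl; omega
      omega
    have h5 : (ρ : ℂ) + k₀ = m := by
      rw [hc1, mul_one] at hc; exact_mod_cast hc
    linear_combination -h5

/-- The nodes of interpolation in a residue class. -/
def node (m ρ : ℕ) (i : ℕ) : ℚ := ((ρ + m * i : ℕ) : ℚ)

theorem node_injective (hm : 0 < m) (ρ : ℕ) : Function.Injective (node m ρ) := by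
  intro i j h
  have h1 : ρ + m * i = ρ + m * j := by simpa only [node, Nat.cast_inj] using h
  exact Nat.eq_of_mul_eq_mul_left hm (by omega)

/-- The weights of interpolation at `n` nodes. -/
noncomputable def weight (m ρ n : ℕ) (x : ℚ) (i : ℕ) : ℂ :=
  (((Lagrange.basis (Finset.range n) (node m ρ) i).eval x : ℚ) : ℂ)

theorem sum_weight_mul_linear (hm : 0 < m) (ρ : ℕ) {n : ℕ} (hn : 2 ≤ n) (x : ℚ) (a b : ℂ) :
    ∑ i ∈ Finset.range n, weight m ρ n x i * (a * (node m ρ i : ℂ) + b) = a * x + b := by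
  have hA : (Polynomial.C a * Polynomial.X + Polynomial.C b : Polynomial ℂ).natDegree < n :=
    lt_of_le_of_lt Polynomial.natDegree_linear_le (by omega)
  have := sum_lagrange_basis_mul_eval (node_injective hm ρ) hA x
  simp only [Polynomial.eval_add, Polynomial.eval_mul, Polynomial.eval_C, Polynomial.eval_X] at this
  exact this.symm

theorem sum_weight (hm : 0 < m) (ρ : ℕ) {n : ℕ} (hn : 2 ≤ n) (x : ℚ) :
    ∑ i ∈ Finset.range n, weight m ρ n x i = 1 := by
  simpa using sum_weight_mul_linear hm ρ hn x 0 1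

/-- The interpolated sum of logarithms. -/
noncomputable def interpLog (z : ℂ) (m ρ n : ℕ) (x : ℚ) (t : ℝ) : ℂ :=
  ∑ i ∈ Finset.range n, weight m ρ n x i * sumLog z (ρ + m * i) t

/-- The Pochhammer symbol `(z ^ ρ * q ^ x; q)_∞ * Γ(κ)` relative to `(q; q)_∞`, normalized. -/
noncomputable def normalizedPoch (z : ℂ) (m ρ : ℕ) (x κ t : ℝ) : ℂ :=
  qPochInf (z ^ ρ * Complex.exp (-(x * t : ℝ))) (z * Complex.exp (-t)) * Real.Gamma κ /
    qPochInf (z * Complex.exp (-t)) (z * Complex.exp (-t)) *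
    Complex.exp (((κ - 1) * Real.log (m * t) : ℝ))

/-- Up to a relative error `O(t^n)`, the normalized symbol is the exponential of minus the
interpolated finite sums. The interpolation error is bounded uniformly in the truncation, and in the
limit over truncations the divergent logarithms cancel against those of `(q; q)_∞`, leaving `Γ(κ)`
and a power of `m t`. -/
theorem exists_norm_normalizedPoch_sub_one_le (hm : 0 < m) (hz : IsPrimitiveRoot z m) {ρ k₀ : ℕ}
    (hρm : ρ < m) (hk₀ : k₀ < m) (hρ : m ∣ ρ + k₀) {x : ℚ} {κ : ℝ} (hx : ∀ n : ℕ, x ≠ -n)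
    (hκ : m * κ = x + k₀) {n : ℕ} (hn : 1 ≤ n) :
    ∃ C t₀ : ℝ, 0 < t₀ ∧ ∀ t : ℝ, 0 < t → t ≤ t₀ →
      ‖normalizedPoch z m ρ x κ t * Complex.exp (interpLog z m ρ (n + 1) x t) - 1‖ ≤ C * t ^ n := by
  have hxR : ∀ j : ℕ, (x : ℝ) ≠ -j := fun j h => hx j (by exact_mod_cast h)
  have hnorm := norm_pow_eq_one hm hz
  have hbd : ∀ l, ∃ C, 0 ≤ C ∧ ∀ u, -1 ≤ u →
      ‖iteratedDeriv (n + 1) (logFactor (z ^ l)) u‖ ≤ C / (2 + u) ^ 2 := fun l =>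
    exists_bound_iteratedDeriv_logFactor (hnorm l) (by omega)
  choose D hD0 hD using hbd
  have hmodz : ∀ l, z ^ l = z ^ (l % m) := fun l => by
    conv_lhs => rw [← Nat.div_add_mod l m, pow_add, pow_mul, hz.pow_eq_one, one_pow, one_mul]
  set C₀ : ℝ := ∑ l ∈ Finset.range m, D l with hC₀
  have hC₀0 : 0 ≤ C₀ := Finset.sum_nonneg fun l _ => hD0 l
  have hC₀b : ∀ k u, -1 ≤ u →
      ‖iteratedDeriv (n + 1) (logFactor (z ^ (ρ + k))) u‖ ≤ C₀ / (2 + u) ^ 2 := by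
    intro k u hu
    rw [hmodz]
    refine (hD _ u hu).trans ?_
    have h1 : D ((ρ + k) % m) ≤ C₀ := Finset.single_le_sum (f := D) (fun i _ => hD0 i)
      (Finset.mem_range.mpr (Nat.mod_lt _ hm))
    gcongr
  obtain ⟨C, t₀, ht₀, hC⟩ := exists_norm_sum_lagrange_le
    (g := fun k => logFactor (z ^ (ρ + k))) (fun k => contDiff_logFactor (hnorm _)) hC₀0 hC₀b
    (node_injective hm ρ) x
  set C' : ℝ := max C 0 with hC'
  have hC'0 : 0 ≤ C' := le_max_right _ _
  refine ⟨2 * C', min t₀ (min 1 (1 / (C' + 1))), by positivity, fun t ht htt => ?_⟩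
  have htt₀ : t ≤ t₀ := htt.trans (min_le_left _ _)
  have ht1 : t ≤ 1 := htt.trans ((min_le_right _ _).trans (min_le_left _ _))
  have htC : t ≤ 1 / (C' + 1) := htt.trans ((min_le_right _ _).trans (min_le_right _ _))
  have hsmall : C' * t ^ n ≤ 1 := by
    have h1 : t ^ n ≤ t := by
      calc t ^ n ≤ t ^ 1 := pow_le_pow_of_le_one ht.le ht1 hn
        _ = t := pow_one t
    rw [le_div_iff₀ (by positivity)] at htC
    nlinarith
  -- the error term
  set R : ℕ → ℂ := fun N => shiftedSumLog z ρ x t (m * (N + 1)) -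
    ∑ i ∈ Finset.range (n + 1), weight m ρ (n + 1) x i *
      shiftedSumLog z ρ ((ρ + m * i : ℕ) : ℝ) t (m * (N + 1)) with hR
  have hRb : ∀ N, ‖R N‖ ≤ C' * t ^ n := by
    intro N
    have h1 := hC t ht htt₀ (m * (N + 1))
    have h2 : R N = ∑ k ∈ Finset.range (m * (N + 1)), (logFactor (z ^ (ρ + k)) ((x + k) * t) -
        ∑ i ∈ Finset.range (n + 1),
          (((Lagrange.basis (Finset.range (n + 1)) (node m ρ) i).eval x : ℚ) : ℂ) *
            logFactor (z ^ (ρ + k)) (((node m ρ i : ℚ) + k) * t)) := by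
      rw [Finset.sum_sub_distrib, Finset.sum_comm]
      simp only [hR, shiftedSumLog, Finset.mul_sum, weight, node, Rat.cast_natCast]
    rw [h2]
    exact h1.trans (mul_le_mul_of_nonneg_right (le_max_left _ _) (by positivity))
  have hmt : 0 < m * t := by positivity
  set T : ℕ → ℕ → ℂ := fun l N => logFactor (z ^ l) (((m * (N + 1) + l : ℕ) : ℝ) * t) +
      (if m ∣ l then 1 else 0) * ((Real.log N + Real.log (m * t) : ℝ) : ℂ) with hT
  have hT0 : ∀ l, Tendsto (T l) atTop (𝓝 0) := fun l => tendsto_logFactor_add hm hz ht l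
  set D' : ℕ → ℂ := fun N => ∑ i ∈ Finset.range (n + 1), weight m ρ (n + 1) x i *
    ∑ l ∈ Finset.range (ρ + m * i), T l N - T 0 N with hD'
  have hD'0 : Tendsto D' atTop (𝓝 0) := by
    have h1 : Tendsto (fun N => ∑ i ∈ Finset.range (n + 1), weight m ρ (n + 1) x i *
        ∑ l ∈ Finset.range (ρ + m * i), T l N) atTop (𝓝 0) := by
      have := tendsto_finsetSum (Finset.range (n + 1)) fun i _ =>
        (tendsto_finsetSum (Finset.range (ρ + m * i)) fun l _ => hT0 l).const_mul
          (weight m ρ (n + 1) x i)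
      simpa using this
    simpa using h1.sub (hT0 0)
  -- This interpolated count is the coefficient of the divergent term `log N + log (m t)`.
  have hcount : ∑ i ∈ Finset.range (n + 1), weight m ρ (n + 1) x i *
      ∑ l ∈ Finset.range (ρ + m * i), (if m ∣ l then (1 : ℂ) else 0) = (κ : ℂ) := by
    have hm' : (m : ℂ) ≠ 0 := by exact_mod_cast hm.ne'
    have h1 := sum_weight_mul_linear hm ρ (show 2 ≤ n + 1 by omega) x 1 (k₀ : ℂ)
    have h2 : (m : ℂ) * κ = x + k₀ := by exact_mod_cast congrArg (Complex.ofReal) hκ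
    refine mul_left_cancel₀ hm' ?_
    rw [h2, ← one_mul (x : ℂ), ← h1, Finset.mul_sum]
    refine Finset.sum_congr rfl fun i _ => ?_
    rw [mul_left_comm, sum_range_ite_dvd hρm hk₀ hρ, node]
    push_cast
    ring
  have hS1 : ∀ N : ℕ, shiftedSumLog z 1 1 t (m * (N + 1)) = sumLog z (m * (N + 1)) t + T 0 N -
      ((Real.log N + Real.log (m * t) : ℝ) : ℂ) := by
    intro N
    have h1 := shiftedSumLog_natCast hz (ρ := 1) (a := 1) rfl t (N + 1)
    rw [Nat.cast_one] at h1
    rw [h1, hT, sumLog, sumLog, Finset.sum_range_one, Finset.sum_range_one]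
    simp only [pow_zero, Nat.cast_zero, zero_mul, logFactor_one_zero, dvd_zero, if_true]
    ring
  have hSx : ∀ N : ℕ, shiftedSumLog z ρ x t (m * (N + 1)) = R N + D' N - interpLog z m ρ (n + 1) x t +
      shiftedSumLog z 1 1 t (m * (N + 1)) - (κ - 1) * ((Real.log N + Real.log (m * t) : ℝ) : ℂ) := by
    intro N
    set ell : ℂ := ((Real.log N + Real.log (m * t) : ℝ) : ℂ) with hell
    have h1 : ∀ i, shiftedSumLog z ρ ((ρ + m * i : ℕ) : ℝ) t (m * (N + 1)) =
        sumLog z (m * (N + 1)) t - sumLog z (ρ + m * i) t + ∑ l ∈ Finset.range (ρ + m * i), T l N -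
          (∑ l ∈ Finset.range (ρ + m * i), (if m ∣ l then (1 : ℂ) else 0)) * ell := by
      intro i
      rw [shiftedSumLog_natCast hz (by rw [pow_add, pow_mul, hz.pow_eq_one, one_pow, mul_one])]
      simp only [hT, Finset.sum_add_distrib, ← Finset.sum_mul]
      ring
    have h2 : ∑ i ∈ Finset.range (n + 1), weight m ρ (n + 1) x i *
        shiftedSumLog z ρ ((ρ + m * i : ℕ) : ℝ) t (m * (N + 1)) =
        (∑ i ∈ Finset.range (n + 1), weight m ρ (n + 1) x i) * sumLog z (m * (N + 1)) t -
          interpLog z m ρ (n + 1) x t +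
          ∑ i ∈ Finset.range (n + 1), weight m ρ (n + 1) x i *
            ∑ l ∈ Finset.range (ρ + m * i), T l N -
          (∑ i ∈ Finset.range (n + 1), weight m ρ (n + 1) x i *
            ∑ l ∈ Finset.range (ρ + m * i), (if m ∣ l then (1 : ℂ) else 0)) * ell := by
      rw [interpLog, Finset.sum_mul, Finset.sum_mul, ← Finset.sum_sub_distrib,
        ← Finset.sum_add_distrib, ← Finset.sum_sub_distrib]
      refine Finset.sum_congr rfl fun i _ => ?_
      rw [h1]
      ring
    rw [sum_weight hm ρ (by omega), hcount] at h2
    simp only [hR, hD']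
    rw [h2, hS1]
    ring
  -- comparison with the case `x = 1`
  have hq : ‖z * Complex.exp (-t)‖ < 1 := by
    have := norm_mul_exp_lt_one hm hz (neg_neg_iff_pos.mpr ht)
    rwa [Complex.ofReal_neg] at this
  set P : ℕ → ℂ := fun N => ∏ k ∈ Finset.range (m * (N + 1)),
    (1 - z ^ ρ * Complex.exp (-(x * t : ℝ)) * (z * Complex.exp (-t)) ^ k) with hP
  set P₁ : ℕ → ℂ := fun N => ∏ k ∈ Finset.range (m * (N + 1)),
    (1 - z * Complex.exp (-t) * (z * Complex.exp (-t)) ^ k) with hP₁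
  have hmain : ∀ N : ℕ, 0 < N → Complex.exp (R N + D' N) * (P₁ N * (Real.GammaSeq 1 N : ℂ)) =
      P N * (Real.GammaSeq κ N : ℂ) *
        (Complex.exp (interpLog z m ρ (n + 1) x t) *
          Complex.exp (((κ - 1) * Real.log (m * t) : ℝ))) := by
    intro N hN
    have h1 := exp_shiftedSumLog hm hz hk₀ hρ hxR hκ ht hN
    have h2 := exp_shiftedSumLog hm hz (ρ := 1) (k₀ := m - 1) (x := 1) (κ := 1) (by omega)
      (by rw [Nat.add_sub_cancel' hm]) (fun j h => by
        have : (0 : ℝ) ≤ j := by positivity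
        linarith) (by rw [Nat.cast_sub hm]; push_cast; ring) ht hN
    simp only [pow_one, one_mul] at h2
    rw [← h1, ← h2, hSx N]
    push_cast
    rw [show ∀ a b c d e : ℂ, a * (b * (c * d * e)) = (c * d) * (a * b * e) by intros; ring,
      show ∀ a b c d e f : ℂ, a * (b * c * d) * (e * f) = (b * c) * (a * d * e * f) by intros; ring]
    congr 1
    simp only [← Complex.exp_add]
    congr 1
    ring
  have hmulN : Tendsto (fun N : ℕ => m * (N + 1)) atTop atTop :=
    tendsto_atTop_mono (fun N => show N ≤ m * (N + 1) by nlinarith) tendsto_id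
  have hPlim : Tendsto P atTop (𝓝 (qPochInf (z ^ ρ * Complex.exp (-(x * t : ℝ)))
      (z * Complex.exp (-t)))) := (tendsto_qPochInf _ hq).comp hmulN
  have hP₁lim : Tendsto P₁ atTop (𝓝 (qPochInf (z * Complex.exp (-t)) (z * Complex.exp (-t)))) :=
    (tendsto_qPochInf _ hq).comp hmulN
  have hΓ : ∀ s : ℝ, Tendsto (fun N => (Real.GammaSeq s N : ℂ)) atTop (𝓝 (Real.Gamma s : ℂ)) :=
    fun s => (Complex.continuous_ofReal.tendsto _).comp (Real.GammaSeq_tendsto_Gamma s)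
  have hden := hP₁lim.mul (hΓ 1)
  rw [Real.Gamma_one, Complex.ofReal_one, mul_one] at hden
  have hq0 := qPochInf_self_ne_zero hq
  have hlim : Tendsto (fun N => Complex.exp (R N + D' N)) atTop
      (𝓝 (normalizedPoch z m ρ x κ t * Complex.exp (interpLog z m ρ (n + 1) x t))) := by
    have h1 := ((hPlim.mul (hΓ κ)).mul_const (Complex.exp (interpLog z m ρ (n + 1) x t) *
          Complex.exp (((κ - 1) * Real.log (m * t) : ℝ)))).div hden hq0
    have h2 : normalizedPoch z m ρ x κ t * Complex.exp (interpLog z m ρ (n + 1) x t) =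
        qPochInf (z ^ ρ * Complex.exp (-(x * t : ℝ))) (z * Complex.exp (-t)) * (Real.Gamma κ : ℂ) *
        (Complex.exp (interpLog z m ρ (n + 1) x t) *
          Complex.exp (((κ - 1) * Real.log (m * t) : ℝ))) /
          qPochInf (z * Complex.exp (-t)) (z * Complex.exp (-t)) := by
      rw [normalizedPoch]; ring
    rw [h2]
    refine h1.congr' ?_
    filter_upwards [eventually_gt_atTop 0, hden.eventually_ne hq0] with N hN hN0
    rw [Pi.div_apply, div_eq_iff hN0]
    exact (hmain N hN).symm
  -- Since `D' → 0`, the limit is that of `exp (R N)` alone, and the uniform bound on `R N` passes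
  -- to it.
  have hlimR : Tendsto (fun N => Complex.exp (R N)) atTop
      (𝓝 (normalizedPoch z m ρ x κ t * Complex.exp (interpLog z m ρ (n + 1) x t))) := by
    have h1 := hlim.mul hD'0.neg.cexp
    rw [neg_zero, Complex.exp_zero, mul_one] at h1
    refine h1.congr fun N => ?_
    rw [← Complex.exp_add]
    congr 1
    ring
  refine le_of_tendsto (hlimR.sub_const 1).norm (Eventually.of_forall fun N => ?_)
  refine (Complex.norm_exp_sub_one_le ((hRb N).trans hsmall)).trans ?_
  rw [mul_assoc]
  exact mul_le_mul_of_nonneg_left (hRb N) zero_le_two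

end InfiniteProduct

/-! ### Asymptotic expansions with polynomial dependence on the parameters -/

section PolyExpansion

open scoped ContDiff

/-- `F α β h` has an expansion in powers of `z * exp h - z` up to order `M` as `h → 0⁻` for all
`(α, β)` in `V`, with coefficients that depend polynomially on `(α, β)`. -/
def HasPolyExpansion (z : ℂ) (V : ℚ → ℚ → Prop) (M : ℕ) (F : ℚ → ℚ → ℝ → ℂ) : Prop :=
  ∃ P : Polynomial (MvPolynomial (Fin 2) ℂ), ∀ α β : ℚ, V α β →
    (fun h : ℝ => F α β h - (P.map (MvPolynomial.eval ![(α : ℂ), (β : ℂ)])).eval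
      (z * Complex.exp h - z)) =O[𝓝[<] 0] fun h : ℝ => h ^ M

theorem tendsto_polynomial_eval_mul_exp (z : ℂ) (Q : Polynomial ℂ) :
    Tendsto (fun h : ℝ => Q.eval (z * Complex.exp h - z)) (𝓝[<] 0) (𝓝 (Q.eval 0)) := by
  have hc : Continuous fun h : ℝ => Q.eval (z * Complex.exp h - z) := by fun_prop
  have := hc.tendsto 0
  simp only [Complex.ofReal_zero, Complex.exp_zero, mul_one, sub_self] at this
  exact this.mono_left nhdsWithin_le_nhds

theorem isBigO_pow_of_le {M n : ℕ} (h : M ≤ n) :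
    (fun x : ℝ => x ^ n) =O[𝓝[<] 0] fun x : ℝ => x ^ M :=
  by
    refine IsBigO.of_bound 1 (nhdsWithin_le_nhds ?_)
    filter_upwards [Metric.ball_mem_nhds (0 : ℝ) one_pos] with x hx
    rw [norm_pow, norm_pow, one_mul]
    exact pow_le_pow_of_le_one (norm_nonneg _) (mem_ball_zero_iff.mp hx).le h

namespace HasPolyExpansion

variable {z : ℂ} {V : ℚ → ℚ → Prop} {M : ℕ} {F G : ℚ → ℚ → ℝ → ℂ}

theorem congr_isBigO (hF : HasPolyExpansion z V M F)
    (h : ∀ α β, V α β → (fun h : ℝ => G α β h - F α β h) =O[𝓝[<] 0] fun h : ℝ => h ^ M) :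
    HasPolyExpansion z V M G := by
  obtain ⟨P, hP⟩ := hF
  refine ⟨P, fun α β hV => ((h α β hV).add (hP α β hV)).congr_left fun t => ?_⟩
  ring

theorem congr (hF : HasPolyExpansion z V M F)
    (h : ∀ α β, V α β → ∀ t < 0, G α β t = F α β t) : HasPolyExpansion z V M G := by
  refine hF.congr_isBigO fun α β hV => ?_
  refine (isBigO_zero _ _).congr' ?_ EventuallyEq.rfl
  filter_upwards [self_mem_nhdsWithin] with t ht
  rw [h α β hV t ht, sub_self]

theorem of_isPoly₂ {c : ℚ → ℚ → ℂ} (hc : IsPoly₂ c) :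
    HasPolyExpansion z V M fun α β _ => c α β := by
  obtain ⟨P, hP⟩ := hc
  refine ⟨Polynomial.C P, fun α β _ => ?_⟩
  simp only [Polynomial.map_C, Polynomial.eval_C, hP, sub_self]
  exact isBigO_zero _ _

theorem const (c : ℂ) : HasPolyExpansion z V M fun _ _ _ => c := of_isPoly₂ (IsPoly₂.const c)

theorem var : HasPolyExpansion z V M fun _ _ h => z * Complex.exp h - z := by
  refine ⟨Polynomial.X, fun α β _ => ?_⟩
  simp only [Polynomial.map_X, Polynomial.eval_X, sub_self]
  exact isBigO_zero _ _

theorem add (hF : HasPolyExpansion z V M F) (hG : HasPolyExpansion z V M G) :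
    HasPolyExpansion z V M fun α β h => F α β h + G α β h := by
  obtain ⟨P, hP⟩ := hF
  obtain ⟨Q, hQ⟩ := hG
  refine ⟨P + Q, fun α β hV => ((hP α β hV).add (hQ α β hV)).congr_left fun t => ?_⟩
  rw [Polynomial.map_add, Polynomial.eval_add]
  ring

theorem mul (hF : HasPolyExpansion z V M F) (hG : HasPolyExpansion z V M G) :
    HasPolyExpansion z V M fun α β h => F α β h * G α β h := by
  obtain ⟨P, hP⟩ := hF
  obtain ⟨Q, hQ⟩ := hG
  refine ⟨P * Q, fun α β hV => ?_⟩
  set p := P.map (MvPolynomial.eval ![(α : ℂ), (β : ℂ)]) with hp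
  set q := Q.map (MvPolynomial.eval ![(α : ℂ), (β : ℂ)]) with hq
  have h1 := (tendsto_polynomial_eval_mul_exp z p).isBigO_one ℝ
  have h2 := (tendsto_polynomial_eval_mul_exp z q).isBigO_one ℝ
  have h0 : (fun h : ℝ => h ^ M) =O[𝓝[<] 0] fun _ => (1 : ℝ) := by
    simpa using isBigO_pow_of_le (Nat.zero_le M)
  have h3 : (fun h => F α β h) =O[𝓝[<] 0] fun _ => (1 : ℝ) :=
    (((hP α β hV).trans h0).add h1).congr_left fun t => by ring
  have h4 := h3.mul (hQ α β hV)
  have h5 := (hP α β hV).mul h2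
  simp only [one_mul, mul_one] at h4 h5
  refine (h4.add h5).congr_left fun t => ?_
  rw [Polynomial.map_mul, Polynomial.eval_mul]
  ring

theorem sum {ι : Type*} (s : Finset ι) {F : ι → ℚ → ℚ → ℝ → ℂ}
    (h : ∀ i ∈ s, HasPolyExpansion z V M (F i)) :
    HasPolyExpansion z V M fun α β t => ∑ i ∈ s, F i α β t := by
  classical
  induction s using Finset.induction_on with
  | empty => simpa using const 0
  | insert a s ha ih =>
    simp only [Finset.sum_insert ha]
    exact (h a (by simp)).add (ih fun i hi => h i (by simp [hi]))

theorem pow (hF : HasPolyExpansion z V M F) (n : ℕ) :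
    HasPolyExpansion z V M fun α β h => F α β h ^ n := by
  induction n with
  | zero => simpa using const 1
  | succ n ih => simpa only [pow_succ] using ih.mul hF

theorem const_mul (c : ℂ) (hF : HasPolyExpansion z V M F) :
    HasPolyExpansion z V M fun α β h => c * F α β h := (const c).mul hF

theorem neg (hF : HasPolyExpansion z V M F) : HasPolyExpansion z V M fun α β h => -F α β h := by
  simpa only [neg_one_mul] using hF.const_mul (-1)

theorem sub (hF : HasPolyExpansion z V M F) (hG : HasPolyExpansion z V M G) :
    HasPolyExpansion z V M fun α β h => F α β h - G α β h := by
  simpa only [sub_eq_add_neg] using hF.add hG.neg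

/-- The variable `h = log (1 + w / z)` expands in powers of `w = z * exp h - z`. -/
theorem id (hz : z ≠ 0) : HasPolyExpansion z V M fun _ _ h => (h : ℂ) := by
  have hw : HasPolyExpansion z V M fun _ _ h => Complex.logTaylor (M + 1) (Complex.exp h - 1) := by
    have h1 : HasPolyExpansion z V M fun _ _ h => Complex.exp h - 1 := by
      refine (var.const_mul z⁻¹).congr fun _ _ _ t _ => ?_
      field_simp
    exact sum _ fun j _ => by
      refine ((h1.pow j).const_mul ((-1) ^ (j + 1) / j)).congr fun _ _ _ t _ => ?_
      ring
  refine hw.congr_isBigO fun α β _ => ?_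
  have h1 : (fun h : ℝ => Complex.exp h - 1) =O[𝓝[<] 0] fun h : ℝ => h := by
    simpa using (isTheta_mul_exp_sub (z := 1) one_ne_zero).1
  have h2 : Tendsto (fun h : ℝ => Complex.exp h - 1) (𝓝[<] 0) (𝓝 0) := by
    simpa using tendsto_polynomial_eval_mul_exp 1 Polynomial.X
  have h3 : (fun h : ℝ => (h : ℂ) - Complex.logTaylor (M + 1) (Complex.exp h - 1)) =O[𝓝[<] 0]
      fun h : ℝ => (Complex.exp h - 1) ^ (M + 1) := by
    refine IsBigO.of_bound 2 ?_
    filter_upwards [h2.eventually (Metric.ball_mem_nhds 0 (by norm_num : (0 : ℝ) < 1 / 2))] with h hh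
    have hh' : ‖Complex.exp h - 1‖ < 1 / 2 := by simpa using hh
    have h4 := Complex.norm_log_sub_logTaylor_le M (z := Complex.exp h - 1) (by linarith)
    rw [add_sub_cancel, ← Complex.ofReal_exp, ← Complex.ofReal_log (Real.exp_pos h).le,
      Real.log_exp, Complex.ofReal_exp] at h4
    refine h4.trans ?_
    rw [norm_pow]
    have h5 : (1 - ‖Complex.exp h - 1‖)⁻¹ ≤ 2 := by
      rw [inv_le_comm₀ (by linarith) two_pos]; linarith
    have h6 : (0 : ℝ) ≤ ‖Complex.exp h - 1‖ ^ (M + 1) := by positivity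
    have h7 : (0 : ℝ) ≤ (1 - ‖Complex.exp h - 1‖)⁻¹ := inv_nonneg.mpr (by linarith)
    calc ‖Complex.exp h - 1‖ ^ (M + 1) * (1 - ‖Complex.exp h - 1‖)⁻¹ / (M + 1)
        ≤ ‖Complex.exp h - 1‖ ^ (M + 1) * (1 - ‖Complex.exp h - 1‖)⁻¹ :=
          div_le_self (by positivity) (by linarith [(Nat.cast_nonneg M : (0 : ℝ) ≤ M)])
      _ ≤ 2 * ‖Complex.exp h - 1‖ ^ (M + 1) := by nlinarith
  exact (h3.trans (h1.pow (M + 1))).trans (isBigO_pow_of_le (Nat.le_succ M))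

theorem of_contDiff (hz : z ≠ 0) {f : ℝ → ℂ} (hf : ContDiff ℝ ∞ f) :
    HasPolyExpansion z V M fun _ _ h => f (-h) := by
  obtain ⟨C, hC⟩ := exists_taylor_mean_remainder_bound (f := f) (a := 0) (b := 1) (n := M)
    zero_le_one (hf.contDiffOn.of_le (by exact_mod_cast le_top))
  have h1 : HasPolyExpansion z V M fun _ _ h => taylorWithinEval f M (Set.Icc 0 1) 0 (-h) := by
    simp only [taylor_within_apply]
    refine sum _ fun j _ => ?_
    refine (((id hz).neg.pow j).const_mul
      ((j.factorial : ℂ)⁻¹ * iteratedDerivWithin j f (Set.Icc 0 1) 0)).congr fun _ _ _ t _ => ?_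
    rw [Complex.real_smul]
    push_cast
    ring
  refine h1.congr_isBigO fun α β _ => ?_
  have h2 : (fun h : ℝ => f (-h) - taylorWithinEval f M (Set.Icc 0 1) 0 (-h)) =O[𝓝[<] 0]
      fun h : ℝ => h ^ (M + 1) := by
    refine IsBigO.of_bound C ?_
    have h3 : ∀ᶠ h : ℝ in 𝓝[<] 0, -1 < h := nhdsWithin_le_nhds (lt_mem_nhds (by norm_num))
    filter_upwards [h3, self_mem_nhdsWithin] with h h4 h5
    have h5' : h < 0 := h5
    refine (hC (-h) ⟨by linarith, by linarith⟩).trans (le_of_eq ?_)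
    rw [sub_zero, norm_pow, Real.norm_of_nonpos h5'.le]
  exact h2.trans (isBigO_pow_of_le (Nat.le_succ M))

/-- Vanishing at `h = 0` makes the truncated exponential series accurate to order `M`, and keeps the
coefficients polynomial. -/
theorem exp (hF : HasPolyExpansion z V M F)
    (h0 : ∀ α β, V α β → (fun h => F α β h) =O[𝓝[<] 0] fun h : ℝ => h) :
    HasPolyExpansion z V M fun α β h => Complex.exp (F α β h) := by
  have h1 : HasPolyExpansion z V M fun α β h =>
      ∑ j ∈ Finset.range M, F α β h ^ j / (j.factorial : ℂ) :=
    sum _ fun j _ => by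
      simpa only [div_eq_inv_mul] using (hF.pow j).const_mul (j.factorial : ℂ)⁻¹
  refine h1.congr_isBigO fun α β hV => ?_
  have h2 : Tendsto (fun h => F α β h) (𝓝[<] 0) (𝓝 0) :=
    (h0 α β hV).trans_tendsto (tendsto_id.mono_left nhdsWithin_le_nhds)
  exact ((Complex.exp_sub_sum_range_isBigO_pow M).comp_tendsto h2).trans ((h0 α β hV).pow M)

end HasPolyExpansion

/-- A polynomial in `z * exp h - z` can be truncated. -/
theorem isBigO_polynomial_eval_sub_sum {z : ℂ} (hz : z ≠ 0) (Q : Polynomial ℂ) (M : ℕ) :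
    (fun h : ℝ => Q.eval (z * Complex.exp h - z) -
      ∑ n ∈ Finset.range M, Q.coeff n * (z * Complex.exp h - z) ^ n) =O[𝓝[<] 0]
      fun h : ℝ => h ^ M := by
  have h1 : ∀ h : ℝ, Q.eval (z * Complex.exp h - z) -
      ∑ n ∈ Finset.range M, Q.coeff n * (z * Complex.exp h - z) ^ n =
      ∑ j ∈ Finset.range (Q.natDegree + 1), Q.coeff (M + j) * (z * Complex.exp h - z) ^ (M + j) := by
    intro h
    rw [Polynomial.eval_eq_sum_range' (show Q.natDegree < M + (Q.natDegree + 1) by omega),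
      Finset.sum_range_add, add_sub_cancel_left]
  simp only [h1]
  refine IsBigO.fun_sum fun j _ => IsBigO.const_mul_left ?_ _
  exact ((isTheta_mul_exp_sub hz).1.pow (M + j)).trans (isBigO_pow_of_le (Nat.le_add_right M j))

/-- The polynomials found for different orders `M` need not be related, but by uniqueness their low
coefficients agree on `V`; the n-th coefficient is taken from order `n + 1`. -/
theorem exists_coefficients_of_hasPolyExpansion {z : ℂ} (hz : z ≠ 0) {V : ℚ → ℚ → Prop}
    {F : ℚ → ℚ → ℝ → ℂ} (hF : ∀ M, HasPolyExpansion z V M F) :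
    ∃ Φ : ℕ → ℚ → ℚ → ℂ, (∀ n, IsPoly₂ (Φ n)) ∧ ∀ α β : ℚ, V α β → ∀ M : ℕ,
      (fun h : ℝ => F α β h - ∑ n ∈ Finset.range M, Φ n α β * (z * Complex.exp h - z) ^ n)
        =O[𝓝[<] 0] fun h => h ^ M := by
  choose P hP using hF
  refine ⟨fun n α β => MvPolynomial.eval ![(α : ℂ), (β : ℂ)] ((P (n + 1)).coeff n),
    fun n => ⟨_, fun _ _ => rfl⟩, fun α β hV M => ?_⟩
  set ev := MvPolynomial.eval ![(α : ℂ), (β : ℂ)] with hev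
  have hcoef : ∀ n ∈ Finset.range M, ev ((P (n + 1)).coeff n) = ((P M).map ev).coeff n := by
    intro n hn
    have hn' := Finset.mem_range.mp hn
    have h1 := ((hP M α β hV).trans (isBigO_pow_of_le (show n + 1 ≤ M from hn'))).sub
      (hP (n + 1) α β hV)
    have h2 := polynomial_coeff_eq_zero_of_isBigO hz
      (P := (P (n + 1)).map ev - (P M).map ev) (M := n + 1)
      (h1.congr_left fun t => by rw [Polynomial.eval_sub]; ring) n (Nat.lt_succ_self n)
    rw [Polynomial.coeff_sub, sub_eq_zero, Polynomial.coeff_map] at h2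
    exact h2
  refine ((hP M α β hV).add (isBigO_polynomial_eval_sub_sum hz ((P M).map ev) M)).congr_left
    fun t => ?_
  have h1 := Finset.sum_congr (rfl : Finset.range M = Finset.range M) fun n hn =>
    congrArg (· * (z * Complex.exp t - z) ^ n) (hcoef n hn)
  rw [h1]
  ring

end PolyExpansion

/-! ### Residues of negatives and sums -/

section Residues

variable {N m : ℕ}

theorem dvd_add_sub_mod {ρ : ℕ} (hρ : ρ < m) : m ∣ ρ + (m - ρ) % m := by
  have h1 : (ρ + (m - ρ)) % m = 0 := by rw [Nat.add_sub_cancel' hρ.le, Nat.mod_self]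
  exact Nat.dvd_of_mod_eq_zero (by rw [Nat.add_mod_mod, h1])

theorem ratResidue_neg (hN : 0 < N) (hm : 0 < m) (hmN : m.Coprime N) {α : ℚ} {a : ℤ}
    (hα : α = a / N) : ratResidue m (-α) = (m - ratResidue m α) % m := by
  refine ratResidue_eq hN hm hmN (neg_eq_div hα) (Nat.mod_lt _ hm) ?_
  have h1 := ratResidue_spec hN hm hmN hα
  have h2 : (m : ℤ) ∣ ((ratResidue m α + (m - ratResidue m α) % m : ℕ) : ℤ) :=
    Int.natCast_dvd_natCast.mpr (dvd_add_sub_mod (ratResidue_lt hm α))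
  rw [Nat.cast_add] at h2
  exact (dvd_sub (dvd_neg.mpr h1) (h2.mul_right N)).trans (dvd_of_eq (by ring))

theorem ratResidue_add (hN : 0 < N) (hm : 0 < m) (hmN : m.Coprime N) {α β : ℚ} {a b : ℤ}
    (hα : α = a / N) (hβ : β = b / N) :
    ratResidue m (α + β) = (ratResidue m α + ratResidue m β) % m := by
  have hαβ : α + β = ((a + b : ℤ) : ℚ) / N := by rw [hα, hβ]; push_cast; ring
  refine ratResidue_eq hN hm hmN hαβ (Nat.mod_lt _ hm) ?_
  have h1 := ratResidue_spec hN hm hmN hα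
  have h2 := ratResidue_spec hN hm hmN hβ
  obtain ⟨k, hk⟩ : ∃ k : ℕ, (ratResidue m α + ratResidue m β) % m + m * k =
    ratResidue m α + ratResidue m β := ⟨_, Nat.mod_add_div _ _⟩
  generalize (ratResidue m α + ratResidue m β) % m = u at hk ⊢
  have hk' : (u : ℤ) + m * k = ratResidue m α + ratResidue m β := by exact_mod_cast hk
  obtain ⟨c, hc⟩ := h1
  obtain ⟨d, hd⟩ := h2
  exact ⟨c + d + k * N, by linear_combination hc + hd - N * hk'⟩

/-- The carry `c` measures the failure of additivity of brackets: `[α] + [β] = [α + β] + c`. -/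
theorem exists_carry {r s : ℕ} (hr : r < m) (hs : s < m) :
    ∃ c : ℕ, (c = 0 ∨ c = 1) ∧
      (m - r) % m + (m - s) % m = (m - (r + s) % m) % m + m * c := by
  have hm : 0 < m := by omega
  have h1 : ∀ ρ < m, (m - ρ) % m = if ρ = 0 then 0 else m - ρ := by
    intro ρ hρ
    split_ifs with h
    · rw [h, Nat.sub_zero, Nat.mod_self]
    · exact Nat.mod_eq_of_lt (by omega)
  rw [h1 r hr, h1 s hs, h1 _ (Nat.mod_lt _ hm)]
  by_cases hlt : r + s < m
  · rw [Nat.mod_eq_of_lt hlt]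
    by_cases h : r = 0 ∨ s = 0
    · refine ⟨0, Or.inl rfl, ?_⟩
      rcases h with rfl | rfl <;> simp
    · push Not at h
      refine ⟨1, Or.inr rfl, ?_⟩
      rw [if_neg h.1, if_neg h.2, if_neg (by omega)]
      omega
  · rw [Nat.mod_eq_sub_mod (by omega), Nat.mod_eq_of_lt (by omega)]
    rw [if_neg (show r ≠ 0 by omega), if_neg (show s ≠ 0 by omega)]
    by_cases h : r + s - m = 0
    · exact ⟨1, Or.inr rfl, by rw [if_pos h]; omega⟩
    · exact ⟨0, Or.inl rfl, by rw [if_neg h]; omega⟩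

end Residues

/-! ### The `q`-beta function as a quotient of normalized symbols -/

section QBeta

variable {m : ℕ} {z : ℂ}

/-- The function `qBetaFun` in terms of normalized Pochhammer symbols. -/
theorem qBetaFun_mul_eq (hm : 0 < m) (hz : IsPrimitiveRoot z m) {α β : ℚ} {c : ℕ}
    (hc : c = 0 ∨ c = 1) (hcarry : ratBracket m α + ratBracket m β = ratBracket m (α + β) + c)
    (hα : ∀ n : ℕ, α ≠ -n) (hβ : ∀ n : ℕ, β ≠ -n) (hαβ : ∀ n : ℕ, α + β ≠ -n) {t : ℝ} (ht : 0 < t) :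
    qBetaFun z m α β (-t) * (m * t) =
      (ratBracket m (α + β) * (m * t)) ^ c *
        (normalizedPoch z m (ratResidue m (α + β)) ((α + β : ℚ) : ℝ) (ratBracket m (α + β) : ℚ) t /
          (normalizedPoch z m (ratResidue m α) α (ratBracket m α : ℚ) t *
            normalizedPoch z m (ratResidue m β) β (ratBracket m β : ℚ) t)) := by
  have hmt : 0 < m * t := by positivity
  have hq : ‖z * Complex.exp (-t)‖ < 1 := by
    have := norm_mul_exp_lt_one hm hz (neg_neg_iff_pos.mpr ht)
    rwa [Complex.ofReal_neg] at this
  have hqq := qPochInf_self_ne_zero hq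
  have hpow : ∀ a : ℚ, qPower z m ((-t : ℝ) : ℂ) a =
      z ^ ratResidue m a * Complex.exp (-((a : ℝ) * t : ℝ)) := by
    intro a
    rw [qPower]
    congr 2
    push_cast
    ring
  have hΓ : ∀ a : ℚ, (∀ n : ℕ, a ≠ -n) → (Real.Gamma ((ratBracket m a : ℚ) : ℝ) : ℂ) ≠ 0 := by
    intro a ha
    rw [Complex.ofReal_ne_zero]
    refine Real.Gamma_ne_zero fun n h => ratBracket_ne_neg hm ha n ?_
    exact_mod_cast h
  have hΓab : (Real.Gamma (ratBracket m α + ratBracket m β : ℚ) : ℂ) =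
      (ratBracket m (α + β) : ℂ) ^ c * (Real.Gamma ((ratBracket m (α + β) : ℚ) : ℝ) : ℂ) := by
    have h0 : ((ratBracket m (α + β) : ℚ) : ℝ) ≠ 0 := by
      have := ratBracket_ne_neg hm hαβ 0
      exact_mod_cast (by simpa using this : ratBracket m (α + β) ≠ 0)
    rw [hcarry]
    rcases hc with rfl | rfl
    · simp
    · rw [Rat.cast_add, Nat.cast_one, Rat.cast_one, Real.Gamma_add_one h0]
      push_cast
      ring
  have hE : Complex.exp (((((ratBracket m (α + β) : ℚ) : ℝ) - 1) * Real.log (m * t) : ℝ)) *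
      (m * t : ℂ) ^ c = (m * t : ℂ) *
      (Complex.exp (((((ratBracket m α : ℚ) : ℝ) - 1) * Real.log (m * t) : ℝ)) *
        Complex.exp (((((ratBracket m β : ℚ) : ℝ) - 1) * Real.log (m * t) : ℝ))) := by
    have h1 : (m * t : ℂ) = Complex.exp (Real.log (m * t) : ℝ) := by
      rw [← Complex.ofReal_exp, Real.exp_log hmt]; push_cast; rfl
    have h2 : ((ratBracket m α : ℚ) : ℂ) + (ratBracket m β : ℚ) = (ratBracket m (α + β) : ℚ) + c := by
      exact_mod_cast congrArg (Rat.cast : ℚ → ℂ) hcarry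
    rw [h1, ← Complex.exp_nat_mul, ← Complex.exp_add, ← Complex.exp_add, ← Complex.exp_add]
    congr 1
    push_cast
    linear_combination (-(Real.log (m * t) : ℂ)) * h2
  rw [qBetaFun, hpow, hpow, hpow, Complex.ofReal_div, Complex.ofReal_mul, hΓab]
  simp only [normalizedPoch]
  rw [Complex.ofReal_neg]
  have hΓα := hΓ α hα
  have hΓβ := hΓ β hβ
  generalize Complex.exp (((((ratBracket m (α + β) : ℚ) : ℝ) - 1) * Real.log (m * t) : ℝ)) = Eab at *
  have hEa := Complex.exp_ne_zero (((((ratBracket m α : ℚ) : ℝ) - 1) * Real.log (m * t) : ℝ) : ℂ)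
  have hEb := Complex.exp_ne_zero (((((ratBracket m β : ℚ) : ℝ) - 1) * Real.log (m * t) : ℝ) : ℂ)
  generalize Complex.exp (((((ratBracket m α : ℚ) : ℝ) - 1) * Real.log (m * t) : ℝ)) = Ea at *
  generalize Complex.exp (((((ratBracket m β : ℚ) : ℝ) - 1) * Real.log (m * t) : ℝ)) = Eb at *
  generalize qPochInf (z * Complex.exp (-t)) (z * Complex.exp (-t)) = Q at *
  generalize qPochInf (z ^ ratResidue m (α + β) * _) _ = Qab
  generalize qPochInf (z ^ ratResidue m α * _) _ = Qa
  generalize qPochInf (z ^ ratResidue m β * _) _ = Qb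
  generalize (Real.Gamma ((ratBracket m α : ℚ) : ℝ) : ℂ) = Ga at *
  generalize (Real.Gamma ((ratBracket m β : ℚ) : ℝ) : ℂ) = Gb at *
  generalize (Real.Gamma ((ratBracket m (α + β) : ℚ) : ℝ) : ℂ) = Gab at *
  generalize ((ratBracket m (α + β) : ℚ) : ℂ) = κ
  -- A vanishing denominator need not be excluded: with division by zero equal to zero, both sides
  -- vanish.
  rcases eq_or_ne Qa 0 with rfl | hQa
  · simp
  rcases eq_or_ne Qb 0 with rfl | hQb
  · simp
  rw [mul_pow]
  generalize (m * t : ℂ) ^ c = T at *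
  generalize (m * t : ℂ) = T₁ at *
  field_simp
  linear_combination (-(κ ^ c * Gab * Qab)) * hE

theorem isBigO_div_mul_sub_one {f₁ f₂ f₃ : ℝ → ℂ} {n : ℕ} (hn : 1 ≤ n)
    (h₁ : (fun h => f₁ h - 1) =O[𝓝[<] 0] fun h : ℝ => h ^ n)
    (h₂ : (fun h => f₂ h - 1) =O[𝓝[<] 0] fun h : ℝ => h ^ n)
    (h₃ : (fun h => f₃ h - 1) =O[𝓝[<] 0] fun h : ℝ => h ^ n) :
    (fun h => f₁ h / (f₂ h * f₃ h) - 1) =O[𝓝[<] 0] fun h : ℝ => h ^ n := by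
  have h0 : Tendsto (fun h : ℝ => h ^ n) (𝓝[<] 0) (𝓝 0) := by
    have : Tendsto (fun h : ℝ => h ^ n) (𝓝 0) (𝓝 (0 ^ n)) := (continuous_pow n).tendsto 0
    rw [zero_pow (by omega)] at this
    exact this.mono_left nhdsWithin_le_nhds
  have ht : ∀ {f : ℝ → ℂ}, ((fun h => f h - 1) =O[𝓝[<] 0] fun h : ℝ => h ^ n) →
      Tendsto f (𝓝[<] 0) (𝓝 1) := by
    intro f hf
    simpa using (hf.trans_tendsto h0).add_const 1
  have h4 := (ht h₂).mul (ht h₃)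
  rw [mul_one] at h4
  have h5 : (fun h => f₁ h - 1 - (f₂ h - 1) * f₃ h - (f₃ h - 1)) =O[𝓝[<] 0]
      fun h : ℝ => h ^ n := by
    have := h₂.mul ((ht h₃).isBigO_one ℝ)
    simp only [mul_one] at this
    exact (h₁.sub this).sub h₃
  have h6 := h5.mul ((h4.inv₀ one_ne_zero).isBigO_one ℝ)
  simp only [mul_one] at h6
  refine h6.congr' ?_ EventuallyEq.rfl
  filter_upwards [h4.eventually_ne one_ne_zero] with h hne
  have h7 : f₂ h ≠ 0 := left_ne_zero_of_mul hne
  have h8 : f₃ h ≠ 0 := right_ne_zero_of_mul hne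
  field_simp
  ring

end QBeta

/-! ### Polynomial dependence of the expansion of the `q`-beta function -/

section Expansion

open scoped ContDiff

variable {m : ℕ} {z : ℂ}

theorem contDiff_sumLog (hm : 0 < m) (hz : IsPrimitiveRoot z m) (a : ℕ) :
    ContDiff ℝ ∞ (sumLog z a) :=
  ContDiff.sum fun l _ => (contDiff_logFactor (norm_pow_eq_one hm hz l)).comp
    (contDiff_const.mul contDiff_id)

theorem contDiff_interpLog (hm : 0 < m) (hz : IsPrimitiveRoot z m) (ρ n : ℕ) (x : ℚ) :
    ContDiff ℝ ∞ (interpLog z m ρ n x) :=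
  ContDiff.sum fun _ _ => contDiff_const.mul (contDiff_sumLog hm hz _)

/-- At `t = 0` the summands are periodic in `l`, so the finite sums are affine in the node and
interpolate exactly. -/
theorem interpLog_zero (hm : 0 < m) (hz : IsPrimitiveRoot z m) (ρ : ℕ) {n : ℕ} (hn : 2 ≤ n)
    (x : ℚ) :
    interpLog z m ρ n x 0 = sumLog z ρ 0 + (x - ρ) / m * sumLog z m 0 := by
  have hm' : (m : ℂ) ≠ 0 := by exact_mod_cast hm.ne'
  have h1 : ∀ i, sumLog z (ρ + m * i) 0 =
      sumLog z m 0 / m * (node m ρ i : ℂ) + (sumLog z ρ 0 - ρ / m * sumLog z m 0) := by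
    intro i
    have hper : Function.Periodic (fun l => logFactor (z ^ l) 0) m := fun l => by
      simp only [pow_add, hz.pow_eq_one, mul_one]
    have h2 := hper.sum_range_add_mul ρ i
    simp only [sumLog, mul_zero, node]
    rw [h2]
    push_cast
    field_simp
    ring
  rw [interpLog, Finset.sum_congr rfl fun i _ => by rw [h1 i], sum_weight_mul_linear hm ρ hn]
  ring

theorem hasPolyExpansion_interpLog (hm : 0 < m) (hz : IsPrimitiveRoot z m) {V : ℚ → ℚ → Prop}
    {M : ℕ} (ρ n : ℕ) {g : ℚ → ℚ → ℚ} (hg : IsPoly₂ fun α β => (g α β : ℂ)) :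
    HasPolyExpansion z V M fun α β h => interpLog z m ρ n (g α β) (-h) := by
  simp only [interpLog]
  exact HasPolyExpansion.sum _ fun i _ =>
    (HasPolyExpansion.of_isPoly₂ (IsPoly₂.eval (Lagrange.basis (Finset.range n) (node m ρ) i) hg)).mul
      (HasPolyExpansion.of_contDiff (hz.ne_zero hm.ne') (contDiff_sumLog hm hz _))

theorem isBigO_neg_of_le {f : ℝ → ℂ} {C t₀ : ℝ} {n : ℕ} (ht₀ : 0 < t₀)
    (h : ∀ t : ℝ, 0 < t → t ≤ t₀ → ‖f t‖ ≤ C * t ^ n) :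
    (fun h : ℝ => f (-h)) =O[𝓝[<] 0] fun h : ℝ => h ^ n := by
  refine IsBigO.of_bound C ?_
  have h3 : ∀ᶠ h : ℝ in 𝓝[<] 0, -t₀ < h := nhdsWithin_le_nhds (lt_mem_nhds (by linarith))
  filter_upwards [h3, self_mem_nhdsWithin] with x h4 h5
  have h5' : x < 0 := h5
  refine (h (-x) (by linarith) (by linarith)).trans (le_of_eq ?_)
  rw [norm_pow, Real.norm_of_nonpos h5'.le]

theorem mul_exp_sub_eq (z : ℂ) {t : ℝ} (ht : 0 < t) :
    z * Complex.exp ((-t : ℝ) : ℂ) - z = -z * phiFactor 1 t * t := by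
  have ht' : (t : ℂ) ≠ 0 := by exact_mod_cast ht.ne'
  rw [phiFactor_one_of_ne_zero ht.ne']
  push_cast
  field_simp
  ring

/-- The asymptotic expansions of `qBetaFun` have coefficients that depend polynomially on the
parameters, as long as these lie in fixed residue classes modulo `m`. -/
theorem exists_expansion {N : ℕ} (hN : 0 < N) (hm : 0 < m) (hmN : m.Coprime N)
    (hz : IsPrimitiveRoot z m) {r s : ℕ} (hr : r < m) (hs : s < m) :
    ∃ Φ : ℕ → ℚ → ℚ → ℂ, (∀ n, IsPoly₂ (Φ n)) ∧ ∀ α β : ℚ, (∃ a : ℤ, α = a / N) →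
      (∃ b : ℤ, β = b / N) → (∀ n : ℕ, α ≠ -n) → (∀ n : ℕ, β ≠ -n) → (∀ n : ℕ, α + β ≠ -n) →
      ratResidue m α = r → ratResidue m β = s → ∀ M : ℕ,
      (fun h : ℝ => qBetaFun z m α β h * (z * Complex.exp h - z) -
        ∑ n ∈ Finset.range M, Φ n α β * (z * Complex.exp h - z) ^ n) =O[𝓝[<] 0]
        fun h => h ^ M := by
  have hz0 := hz.ne_zero hm.ne'
  let V : ℚ → ℚ → Prop := fun α β => (∃ a : ℤ, α = a / N) ∧ (∃ b : ℤ, β = b / N) ∧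
    (∀ n : ℕ, α ≠ -n) ∧ (∀ n : ℕ, β ≠ -n) ∧ (∀ n : ℕ, α + β ≠ -n) ∧ ratResidue m α = r ∧
    ratResidue m β = s
  suffices h : ∀ M, HasPolyExpansion z V M fun α β h =>
      qBetaFun z m α β h * (z * Complex.exp h - z) by
    obtain ⟨Φ, hΦ, h1⟩ := exists_coefficients_of_hasPolyExpansion hz0 h
    exact ⟨Φ, hΦ, fun α β a1 a2 a3 a4 a5 a6 a7 => h1 α β ⟨a1, a2, a3, a4, a5, a6, a7⟩⟩
  intro M
  obtain ⟨c, hc01, hc⟩ := exists_carry hr hs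
  set u := (r + s) % m with hu
  have hum : u < m := Nat.mod_lt _ hm
  have hmQ : (m : ℚ) ≠ 0 := by exact_mod_cast hm.ne'
  have hmC : (m : ℂ) ≠ 0 := by exact_mod_cast hm.ne'
  have hbr : ∀ α β, V α β →
      ratBracket m α = (α + ((m - r) % m : ℕ)) / m ∧ ratBracket m β = (β + ((m - s) % m : ℕ)) / m ∧
      ratBracket m (α + β) = (α + β + ((m - u) % m : ℕ)) / m ∧ ratResidue m (α + β) = u := by
    rintro α β ⟨⟨a, ha⟩, ⟨b, hb⟩, -, -, -, hαr, hβs⟩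
    have hαβ : α + β = ((a + b : ℤ) : ℚ) / N := by rw [ha, hb]; push_cast; ring
    have h1 : ratResidue m (α + β) = u := by rw [ratResidue_add hN hm hmN ha hb, hαr, hβs]
    refine ⟨?_, ?_, ?_, h1⟩
    · rw [ratBracket, ratResidue_neg hN hm hmN ha, hαr]
    · rw [ratBracket, ratResidue_neg hN hm hmN hb, hβs]
    · rw [ratBracket, ratResidue_neg hN hm hmN hαβ, h1]
  -- the exponent
  set J : ℚ → ℚ → ℝ → ℂ := fun α β t => interpLog z m r (M + 1 + 1) α t +
    interpLog z m s (M + 1 + 1) β t - interpLog z m u (M + 1 + 1) (α + β) t with hJ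
  -- The value of the exponent at `t = 0`; the parts linear in `α` and `β` cancel. Hence `exp γ` is
  -- a constant factor, and what remains vanishes at 0 as `HasPolyExpansion.exp` demands.
  set γ : ℂ := sumLog z r 0 + sumLog z s 0 - sumLog z u 0 + (u - r - s) / m * sumLog z m 0 with hγ
  have hJ0 : ∀ α β, J α β 0 = γ := by
    intro α β
    simp only [hJ]
    rw [interpLog_zero hm hz r (by omega), interpLog_zero hm hz s (by omega),
      interpLog_zero hm hz u (by omega), hγ]
    push_cast
    field_simp
    ring
  have hadd : IsPoly₂ fun α β => ((α + β : ℚ) : ℂ) := by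
    simpa only [Rat.cast_add] using IsPoly₂.fst.add IsPoly₂.snd
  have hJexp : HasPolyExpansion z V M fun α β h => J α β (-h) :=
    ((hasPolyExpansion_interpLog hm hz r _ IsPoly₂.fst).add
      (hasPolyExpansion_interpLog hm hz s _ IsPoly₂.snd)).sub
      (hasPolyExpansion_interpLog hm hz u _ hadd)
  have hJd : ∀ α β, ContDiff ℝ ∞ (J α β) := fun α β =>
    ((contDiff_interpLog hm hz r _ α).add (contDiff_interpLog hm hz s _ β)).sub
      (contDiff_interpLog hm hz u _ (α + β))
  have hJO : ∀ α β, (fun h : ℝ => J α β (-h) - γ) =O[𝓝[<] 0] fun h : ℝ => h := by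
    intro α β
    have h1 : DifferentiableAt ℝ (fun h : ℝ => J α β (-h)) 0 :=
      (((hJd α β).comp contDiff_neg).differentiable (by simp)).differentiableAt
    have h2 := h1.isBigO_sub
    simp only [neg_zero, hJ0, sub_zero] at h2
    exact h2.mono nhdsWithin_le_nhds
  have hexpJ : HasPolyExpansion z V M fun α β h => Complex.exp (J α β (-h)) := by
    refine (((hJexp.sub (HasPolyExpansion.const γ)).exp fun α β _ => hJO α β).const_mul
      (Complex.exp γ)).congr fun α β _ t _ => ?_
    rw [← Complex.exp_add, add_sub_cancel]
  -- the quotient of normalized Pochhammer symbols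
  have hratio : HasPolyExpansion z V M fun α β h =>
      normalizedPoch z m u ((α + β : ℚ) : ℝ) (ratBracket m (α + β) : ℚ) (-h) /
          (normalizedPoch z m r α (ratBracket m α : ℚ) (-h) *
            normalizedPoch z m s β (ratBracket m β : ℚ) (-h)) := by
    refine hexpJ.congr_isBigO fun α β hV => ?_
    obtain ⟨h1, h2, h3, -⟩ := hbr α β hV
    have hfac : ∀ {ρ : ℕ} {x κ : ℚ}, ρ < m → (∀ n : ℕ, x ≠ -n) →
        κ = (x + ((m - ρ) % m : ℕ)) / m →
        (fun h : ℝ => normalizedPoch z m ρ x κ (-h) *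
          Complex.exp (interpLog z m ρ (M + 1 + 1) x (-h)) - 1) =O[𝓝[<] 0]
          fun h : ℝ => h ^ (M + 1) := by
      intro ρ x κ hρ hx hκ
      obtain ⟨C, t₀, ht₀, hC⟩ := exists_norm_normalizedPoch_sub_one_le hm hz hρ (Nat.mod_lt _ hm)
        (dvd_add_sub_mod hρ) hx (κ := (κ : ℝ)) (by
          have : (m : ℚ) * κ = x + ((m - ρ) % m : ℕ) := by rw [hκ]; field_simp
          exact_mod_cast congrArg (Rat.cast : ℚ → ℝ) this) (n := M + 1) (by omega)
      exact isBigO_neg_of_le (f := fun t => normalizedPoch z m ρ x κ t *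
          Complex.exp (interpLog z m ρ (M + 1 + 1) x t) - 1) ht₀ hC
    have hmain := isBigO_div_mul_sub_one (by omega) (hfac hum hV.2.2.2.2.1 h3)
      (hfac hr hV.2.2.1 h1) (hfac hs hV.2.2.2.1 h2)
    have hbdd : (fun h : ℝ => Complex.exp (J α β (-h))) =O[𝓝[<] 0] fun _ => (1 : ℝ) := by
      have hc : Continuous fun h : ℝ => Complex.exp (J α β (-h)) :=
        Complex.continuous_exp.comp ((hJd α β).continuous.comp continuous_neg)
      exact ((hc.tendsto 0).mono_left nhdsWithin_le_nhds).isBigO_one ℝ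
    have h4 := hbdd.mul hmain
    simp only [one_mul] at h4
    refine (h4.trans (isBigO_pow_of_le (Nat.le_succ M))).congr_left fun h => ?_
    simp only [hJ]
    rw [Complex.exp_sub, Complex.exp_add]
    have e1 := Complex.exp_ne_zero (interpLog z m r (M + 1 + 1) α (-h))
    have e2 := Complex.exp_ne_zero (interpLog z m s (M + 1 + 1) β (-h))
    have e3 := Complex.exp_ne_zero (interpLog z m u (M + 1 + 1) (α + β) (-h))
    rw [mul_sub, mul_one]
    congr 1
    rw [mul_mul_mul_comm, mul_div_mul_comm]
    field_simp
  have hκ : IsPoly₂ fun α β => ((α : ℂ) + β + ((m - u) % m : ℕ)) :=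
    (IsPoly₂.fst.add IsPoly₂.snd).add (IsPoly₂.const _)
  have hφ : HasPolyExpansion z V M fun _ _ h => phiFactor 1 (-h) :=
    HasPolyExpansion.of_contDiff hz0 (contDiff_phiFactor 1)
  -- With `t = -h`, `z e^h - z = -z φ(t) t` supplies the factor `t` that `qBetaFun_mul_eq` needs,
  -- and `m [α + β]_m` is an affine polynomial in `α + β`.
  refine ((hφ.const_mul (-z / m)).mul
    (((HasPolyExpansion.of_isPoly₂ hκ).mul (HasPolyExpansion.id hz0).neg).pow c |>.mul hratio)).congr
    fun α β hV h hh => ?_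
  obtain ⟨h1, h2, h3, h4⟩ := hbr α β hV
  have hcarry : ratBracket m α + ratBracket m β = ratBracket m (α + β) + c := by
    rw [h1, h2, h3]
    have hc' : (((m - r) % m : ℕ) : ℚ) + ((m - s) % m : ℕ) = ((m - u) % m : ℕ) + m * c := by
      exact_mod_cast hc
    field_simp
    linear_combination hc'
  obtain ⟨-, -, a3, a4, a5, a6, a7⟩ := hV
  have ht : 0 < -h := by linarith
  have hF := qBetaFun_mul_eq hm hz hc01 hcarry a3 a4 a5 ht
  rw [neg_neg, h4, a6, a7] at hF
  have hw := mul_exp_sub_eq z ht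
  rw [neg_neg] at hw
  rw [hw]
  have h5 : ((ratBracket m (α + β) : ℚ) : ℂ) * (m * ((-h : ℝ) : ℂ)) =
      ((α : ℂ) + β + ((m - u) % m : ℕ)) * -(h : ℂ) := by
    rw [h3]
    push_cast
    field_simp
  rw [h5] at hF
  rw [← hF]
  field_simp

end Expansion

/-! ### Integral parameters and rationality of the coefficients -/

theorem qFac_mul_mk_eq_of_isBigO {z : ℂ} (hz : z ≠ 0) {F : ℝ → ℂ} {κ : ℂ} {a b : ℕ} {φ : ℕ → ℂ}
    (hF : ∀ h : ℝ, h < 0 → qFac (z * Complex.exp h) (a + b + 1) * F h =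
      κ * qFac (z * Complex.exp h) a * qFac (z * Complex.exp h) b)
    (hφ : ∀ M : ℕ, (fun h : ℝ => F h * (z * Complex.exp h - z) -
        ∑ n ∈ Finset.range M, φ n * (z * Complex.exp h - z) ^ n) =O[𝓝[<] 0] fun h => h ^ M) :
    qFac (PowerSeries.C z + PowerSeries.X : ℂ⟦X⟧) (a + b + 1) * PowerSeries.mk φ =
      PowerSeries.C κ * PowerSeries.X * qFac (PowerSeries.C z + PowerSeries.X : ℂ⟦X⟧) a *
        qFac (PowerSeries.C z + PowerSeries.X : ℂ⟦X⟧) b := by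
  have hco : ∀ n, (qFac (PowerSeries.C z + PowerSeries.X : ℂ⟦X⟧) n) =
      ((qFac (Polynomial.C z + Polynomial.X : Polynomial ℂ) n : Polynomial ℂ) : ℂ⟦X⟧) := by
    intro n
    have := map_qFac (Polynomial.coeToPowerSeries.ringHom (R := ℂ))
      (Polynomial.C z + Polynomial.X) n
    simpa using this.symm
  have hev : ∀ n (h : ℝ), (qFac (Polynomial.C z + Polynomial.X : Polynomial ℂ) n).eval
      (z * Complex.exp h - z) = qFac (z * Complex.exp h) n := by
    intro n h
    have := map_qFac (Polynomial.evalRingHom (z * Complex.exp h - z))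
      (Polynomial.C z + Polynomial.X) n
    simpa using this
  ext k
  set D := qFac (Polynomial.C z + Polynomial.X : Polynomial ℂ) (a + b + 1) with hD
  set T : Polynomial ℂ := ∑ n ∈ Finset.range (k + 1), Polynomial.C (φ n) * Polynomial.X ^ n with hT
  set R : Polynomial ℂ := Polynomial.C κ * Polynomial.X *
    qFac (Polynomial.C z + Polynomial.X : Polynomial ℂ) a *
    qFac (Polynomial.C z + Polynomial.X : Polynomial ℂ) b with hR
  have h1 : (R - D * T).coeff k = 0 := by
    refine polynomial_coeff_eq_zero_of_isBigO hz (M := k + 1) ?_ k (Nat.lt_succ_self k)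
    have hb : (fun h : ℝ => D.eval (z * Complex.exp h - z)) =O[𝓝[<] 0] fun _ => (1 : ℝ) := by
      have hc : Continuous fun h : ℝ => D.eval (z * Complex.exp h - z) := by fun_prop
      exact ((hc.tendsto 0).mono_left nhdsWithin_le_nhds).isBigO_one ℝ
    have h2 := hb.mul (hφ (k + 1))
    simp only [one_mul] at h2
    refine h2.congr' ?_ EventuallyEq.rfl
    filter_upwards [self_mem_nhdsWithin] with h hh
    have h3 := hF h hh
    rw [hR, hT, Polynomial.eval_sub, Polynomial.eval_mul, Polynomial.eval_mul, Polynomial.eval_mul,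
      Polynomial.eval_mul, hev, hev, Polynomial.eval_C, Polynomial.eval_X, hev,
      Polynomial.eval_finsetSum]
    simp only [Polynomial.eval_mul, Polynomial.eval_C, Polynomial.eval_pow, Polynomial.eval_X]
    linear_combination (z * Complex.exp h - z) * h3
  have hTk : ∀ i ≤ k, T.coeff i = φ i := by
    intro i hi
    simp only [hT, Polynomial.finsetSum_coeff, Polynomial.coeff_C_mul_X_pow]
    rw [Finset.sum_ite_eq, if_pos (Finset.mem_range.mpr (by omega))]
  have h2 : PowerSeries.coeff k ((D : ℂ⟦X⟧) * PowerSeries.mk φ) = (D * T).coeff k := by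
    rw [PowerSeries.coeff_mul, Polynomial.coeff_mul]
    refine Finset.sum_congr rfl fun i hi => ?_
    rw [PowerSeries.coeff_mk, Polynomial.coeff_coe, hTk]
    have := Finset.HasAntidiagonal.mem_antidiagonal.mp hi
    omega
  have h3 : PowerSeries.C κ * PowerSeries.X *
      ((qFac (Polynomial.C z + Polynomial.X : Polynomial ℂ) a : Polynomial ℂ) : ℂ⟦X⟧) *
      ((qFac (Polynomial.C z + Polynomial.X : Polynomial ℂ) b : Polynomial ℂ) : ℂ⟦X⟧) =
      ((R : Polynomial ℂ) : ℂ⟦X⟧) := by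
    rw [hR]; simp only [Polynomial.coe_mul, Polynomial.coe_C, Polynomial.coe_X]
  rw [hco, hco, hco, h3, h2, Polynomial.coeff_coe]
  rw [Polynomial.coeff_sub, sub_eq_zero] at h1
  exact h1.symm

theorem ratResidue_grid {m r : ℕ} (hr : r < m) (i : ℕ) :
    ratResidue m ((r + m * i + (m - 1) + 1 : ℕ) : ℚ) = r := by
  rw [ratResidue_natCast]
  have : r + m * i + (m - 1) + 1 = r + m * (i + 1) := by rw [mul_add]; omega
  rw [this, Nat.add_mul_mod_self_left, Nat.mod_eq_of_lt hr]

/-- At integral parameters the series is a quotient of power series over `ℚ(z)`, so its coefficients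
lie in that field. Positive integers in the classes `r`, `s` form an infinite grid, which forces the
coefficient polynomials themselves to be defined over `ℚ(z)`. -/
theorem exists_coefficients {N m : ℕ} (hN : 0 < N) (hm : 0 < m) (hmN : m.Coprime N) {z : QCyc}
    (hz : IsPrimitiveRoot z m) {r s : ℕ} (hr : r < m) (hs : s < m) :
    ∃ Ψ : ℕ → ℚ → ℚ → QCyc, (∀ n, IsPoly₂ (Ψ n)) ∧
      (∀ n α β, Ψ n α β ∈ IntermediateField.adjoin ℚ ({z} : Set QCyc)) ∧
      (∀ α β : ℚ, (∃ a : ℤ, α = a / N) →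
        (∃ b : ℤ, β = b / N) → (∀ n : ℕ, α ≠ -n) → (∀ n : ℕ, β ≠ -n) → (∀ n : ℕ, α + β ≠ -n) →
        ratResidue m α = r → ratResidue m β = s → ∀ M : ℕ,
        (fun h : ℝ => qBetaFun z m α β h * ((z : ℂ) * Complex.exp h - z) -
          ∑ n ∈ Finset.range M, (Ψ n α β : ℂ) * ((z : ℂ) * Complex.exp h - z) ^ n) =O[𝓝[<] 0]
          fun h => h ^ M) ∧
      ∀ a b : ℕ, ratResidue m ((a + 1 : ℕ) : ℚ) = r → ratResidue m ((b + 1 : ℕ) : ℚ) = s →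
        qFac (PowerSeries.C z + PowerSeries.X : QCyc⟦X⟧) (a + b + 1) *
          PowerSeries.mk (fun n => Ψ n ((a + 1 : ℕ) : ℚ) ((b + 1 : ℕ) : ℚ)) =
        PowerSeries.C ((betaConst (a / m) (b / m) : ℚ) : QCyc) * PowerSeries.X *
          qFac (PowerSeries.C z + PowerSeries.X : QCyc⟦X⟧) a *
          qFac (PowerSeries.C z + PowerSeries.X : QCyc⟦X⟧) b := by
  have hzC : IsPrimitiveRoot (z : ℂ) m := hz.map_of_injective (f := algebraMap QCyc ℂ)
    (algebraMap QCyc ℂ).injective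
  obtain ⟨Φ, hΦ, hasym⟩ := exists_expansion hN hm hmN hzC hr hs
  have hneg : ∀ (a n : ℕ), ((a + 1 : ℕ) : ℚ) ≠ -n := fun a n h => by
    have h1 : (0 : ℚ) < ((a + 1 : ℕ) : ℚ) := by exact_mod_cast Nat.succ_pos a
    have h2 : (0 : ℚ) ≤ (n : ℚ) := by positivity
    linarith
  have hint : ∀ a b : ℕ, ratResidue m ((a + 1 : ℕ) : ℚ) = r → ratResidue m ((b + 1 : ℕ) : ℚ) = s →
      qFac (PowerSeries.C (z : ℂ) + PowerSeries.X : ℂ⟦X⟧) (a + b + 1) *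
        PowerSeries.mk (fun n => Φ n ((a + 1 : ℕ) : ℚ) ((b + 1 : ℕ) : ℚ)) =
      PowerSeries.C ((betaConst (a / m) (b / m) : ℚ) : ℂ) * PowerSeries.X *
        qFac (PowerSeries.C (z : ℂ) + PowerSeries.X : ℂ⟦X⟧) a *
        qFac (PowerSeries.C (z : ℂ) + PowerSeries.X : ℂ⟦X⟧) b := by
    intro a b ha hb
    refine qFac_mul_mk_eq_of_isBigO (hzC.ne_zero hm.ne')
      (fun h hh => qBetaFun_natCast hm hzC a b hh) ?_
    refine hasym _ _ ⟨_, natCast_eq_div hN _⟩ ⟨_, natCast_eq_div hN _⟩ (hneg a) (hneg b)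
      (fun n => ?_) ha hb
    have := hneg (a + b + 1) n
    intro h
    exact this (by rw [← h]; push_cast; ring)
  let K₀ := IntermediateField.adjoin ℚ ({z} : Set QCyc)
  let φ : K₀ →+* ℂ := (algebraMap QCyc ℂ).comp (algebraMap K₀ QCyc)
  let z₀ : K₀ := ⟨z, IntermediateField.mem_adjoin_simple_self ℚ z⟩
  have hcoef : ∀ a b : ℕ, ratResidue m ((a + 1 : ℕ) : ℚ) = r → ratResidue m ((b + 1 : ℕ) : ℚ) = s →
      ∃ Y₀ : K₀⟦X⟧, PowerSeries.mk (fun n => Φ n ((a + 1 : ℕ) : ℚ) ((b + 1 : ℕ) : ℚ)) =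
        PowerSeries.map φ Y₀ := by
    intro a b ha hb
    refine exists_map_eq_of_mul_eq φ
      (D := qFac (PowerSeries.C z₀ + PowerSeries.X : K₀⟦X⟧) (a + b + 1))
      (R := PowerSeries.C ((betaConst (a / m) (b / m) : ℚ) : K₀) * PowerSeries.X *
          qFac (PowerSeries.C z₀ + PowerSeries.X : K₀⟦X⟧) a *
          qFac (PowerSeries.C z₀ + PowerSeries.X : K₀⟦X⟧) b)
      (qFac_C_add_X_ne_zero _ _) ?_
    simp only [map_mul, map_qFac, map_add, PowerSeries.map_C, PowerSeries.map_X, map_ratCast]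
    exact hint a b ha hb
  have hgrid : ∀ i j : ℕ, ∃ Y₀ : K₀⟦X⟧,
      ∀ n, Φ n ((r + m * i + (m - 1) + 1 : ℕ) : ℚ) ((s + m * j + (m - 1) + 1 : ℕ) : ℚ) =
        φ (PowerSeries.coeff n Y₀) := by
    intro i j
    obtain ⟨Y₀, hY₀⟩ := hcoef _ _ (ratResidue_grid hr i) (ratResidue_grid hs j)
    refine ⟨Y₀, fun n => ?_⟩
    have := congrArg (PowerSeries.coeff n) hY₀
    rwa [PowerSeries.coeff_mk, PowerSeries.coeff_map] at this
  choose Y hY using hgrid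
  have hinj : ∀ r : ℕ, Function.Injective fun i : ℕ => ((r + m * i + (m - 1) + 1 : ℕ) : ℚ) := by
    intro r i j hij
    have h1 : r + m * i + (m - 1) + 1 = r + m * j + (m - 1) + 1 := by
      simpa only [Nat.cast_inj] using hij
    exact Nat.eq_of_mul_eq_mul_left hm (by omega)
  have hdesc : ∀ n, ∃ g : ℚ → ℚ → K₀, IsPoly₂ g ∧ ∀ α β, Φ n α β = φ (g α β) := fun n =>
    (hΦ n).exists_map_eq φ (hinj r) (hinj s) (y := fun i j => PowerSeries.coeff n (Y i j))
      fun i j => hY i j n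
  choose g hg hgφ using hdesc
  have hco : ∀ n α β, (((g n α β : K₀) : QCyc) : ℂ) = Φ n α β := fun n α β => (hgφ n α β).symm
  refine ⟨fun n α β => (g n α β : QCyc), fun n => (hg n).map (algebraMap K₀ QCyc),
    fun n α β => (g n α β).2, fun α β h1 h2 h3 h4 h5 h6 h7 M => ?_, fun a b ha hb => ?_⟩
  · simp only [hco]
    exact hasym α β h1 h2 h3 h4 h5 h6 h7 M
  · refine PowerSeries.map_injective (algebraMap QCyc ℂ) (algebraMap QCyc ℂ).injective ?_
    simp only [map_mul, map_qFac, map_add, PowerSeries.map_C, PowerSeries.map_X, map_ratCast]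
    refine Eq.trans ?_ (hint a b ha hb)
    congr 1
    ext n
    simp only [PowerSeries.coeff_map, PowerSeries.coeff_mk]
    exact hco n _ _

/-! ### Passage to Laurent series -/

section ToLaurent

variable {K : Type*} [Field K]

/-- The Laurent series `X⁻¹ * f`. -/
noncomputable def invXMul (f : K⟦X⟧) : LaurentSeries K :=
  HahnSeries.single (-1 : ℤ) (1 : K) * (f : LaurentSeries K)

theorem coeff_invXMul_of_lt (f : K⟦X⟧) {n : ℤ} (hn : n < -1) : (invXMul f).coeff n = 0 := by
  rw [invXMul, HahnSeries.coeff_single_mul, one_mul, PowerSeries.coeff_coe, if_pos (by omega)]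

theorem coeff_invXMul_natCast_sub_one (f : K⟦X⟧) (n : ℕ) :
    (invXMul f).coeff (n - 1 : ℤ) = PowerSeries.coeff n f := by
  rw [invXMul, HahnSeries.coeff_single_mul, one_mul, sub_neg_eq_add, sub_add_cancel,
    LaurentSeries.coeff_coe_powerSeries]

theorem map_invXMul {L : Type*} [Field L] (φ : K →+* L) (f : K⟦X⟧) :
    (invXMul f).map φ = invXMul (PowerSeries.map φ f) := by
  ext n
  rw [HahnSeries.map_coeff]
  rcases lt_or_ge n (-1) with hn | hn
  · rw [coeff_invXMul_of_lt _ hn, coeff_invXMul_of_lt _ hn, map_zero]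
  · obtain ⟨k, hk⟩ := Int.eq_ofNat_of_zero_le (show 0 ≤ n + 1 by omega)
    obtain rfl : n = (k : ℤ) - 1 := by omega
    rw [coeff_invXMul_natCast_sub_one, coeff_invXMul_natCast_sub_one, PowerSeries.coeff_map]

theorem coe_eq_mul_invXMul {f g b : K⟦X⟧} (h : PowerSeries.X * f = g * b) :
    (f : LaurentSeries K) = (g : LaurentSeries K) * invXMul b := by
  have h1 : HahnSeries.single (-1 : ℤ) (1 : K) * HahnSeries.single (1 : ℤ) (1 : K) = 1 := by
    rw [HahnSeries.single_mul_single]; simp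
  rw [invXMul, mul_left_comm, ← PowerSeries.coe_mul, ← h, PowerSeries.coe_mul, PowerSeries.coe_X,
    ← mul_assoc, h1, one_mul]

theorem C_mul_invXMul (c : K) (b : K⟦X⟧) : c • invXMul b = invXMul (PowerSeries.C c * b) := by
  rw [invXMul, invXMul, PowerSeries.coe_mul, PowerSeries.coe_C, mul_left_comm,
    HahnSeries.C_mul_eq_smul]

end ToLaurent

theorem sum_Ico_neg_one (M : ℕ) (F : ℤ → ℂ) :
    ∑ n ∈ Finset.Ico (-1 : ℤ) M, F n = ∑ n ∈ Finset.range (M + 1), F (n - 1 : ℤ) := by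
  refine (Finset.sum_bij (fun (n : ℕ) _ => (n - 1 : ℤ)) (fun n hn => ?_) (fun a _ b _ h => ?_)
    (fun n hn => ?_) (fun n _ => rfl)).symm
  · have := Finset.mem_range.mp hn
    exact Finset.mem_Ico.mpr ⟨by omega, by omega⟩
  · omega
  · have := Finset.mem_Ico.mp hn
    exact ⟨(n + 1).toNat, Finset.mem_range.mpr (by omega), by omega⟩

theorem isQBetaExpansion_invXMul {z : QCyc} (hz : z ≠ 0) {m : ℕ} {α β : ℚ} {Ψ : ℕ → QCyc}
    (hmem : ∀ n, Ψ n ∈ IntermediateField.adjoin ℚ ({z} : Set QCyc))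
    (h : ∀ M : ℕ, (fun h : ℝ => qBetaFun z m α β h * ((z : ℂ) * Complex.exp h - z) -
      ∑ n ∈ Finset.range M, (Ψ n : ℂ) * ((z : ℂ) * Complex.exp h - z) ^ n) =O[𝓝[<] 0]
        fun h => h ^ M) :
    IsQBetaExpansion z m α β (invXMul (PowerSeries.mk Ψ)) where
  coeff_eq_zero n hn := coeff_invXMul_of_lt _ hn
  coeff_mem n := by
    rcases lt_or_ge n (-1) with hn | hn
    · rw [coeff_invXMul_of_lt _ hn]; exact zero_mem _
    · obtain ⟨k, hk⟩ := Int.eq_ofNat_of_zero_le (show 0 ≤ n + 1 by omega)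
      obtain rfl : n = (k : ℤ) - 1 := by omega
      rw [coeff_invXMul_natCast_sub_one, PowerSeries.coeff_mk]
      exact hmem k
  asymptotic M := by
    have hz' : (z : ℂ) ≠ 0 := by exact_mod_cast hz
    have hΘ := isTheta_mul_exp_sub hz'
    have h1 := (h (M + 1)).mul hΘ.inv.1
    refine (h1.congr' ?_ ?_)
    · filter_upwards [self_mem_nhdsWithin] with t ht
      have hw : (z : ℂ) * Complex.exp t - z ≠ 0 := by
        intro h0
        have h2 : Complex.exp t = 1 := mul_left_cancel₀ hz' (by rw [mul_one]; exact sub_eq_zero.mp h0)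
        have h3 := congrArg norm h2
        rw [Complex.norm_exp, Complex.ofReal_re, norm_one] at h3
        exact (ne_of_lt ht) (Real.exp_eq_one_iff t |>.mp h3)
      rw [sub_mul, mul_assoc, mul_inv_cancel₀ hw, mul_one, Finset.sum_mul, sum_Ico_neg_one]
      congr 1
      refine Finset.sum_congr rfl fun n _ => ?_
      rw [coeff_invXMul_natCast_sub_one, PowerSeries.coeff_mk, zpow_sub_one₀ hw, zpow_natCast,
        mul_assoc]
    · filter_upwards [self_mem_nhdsWithin] with t ht
      rw [pow_succ, mul_assoc, mul_inv_cancel₀ (ne_of_lt ht), mul_one]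

/-! ### Compatible roots of unity and the final assembly -/

section RootsOfUnity

variable {p : ℕ} [hp : Fact p.Prime]

/-- With `ξ` the image of the root of unity of order `p^(v+1)`, compatibility turns the difference
into a unit times `ξ - ξ^p = ξ (1 - ξ^(p-1))`, and `ξ^(p-1)` has p-power order. -/
theorem IsCompatibleRoots.norm_sub_lt_one {ζ : ℕ → QCyc} (hζ : IsCompatibleRoots ζ)
    (σ : QCyc →+* ℂ_[p]) {d v : ℕ} (hd0 : 0 < d) (hd : p.Coprime d) :
    ‖σ (ζ (d * p ^ (v + 1))) - σ (ζ (d * p ^ v))‖ < 1 := by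
  have hpos : ∀ k, 0 < p ^ k := fun k => pow_pos hp.out.pos k
  have hcop : ∀ k, d.Coprime (p ^ k) := fun k => (hd.pow_left k).symm
  rw [hζ.mul _ _ hd0 (hpos _) (hcop _), hζ.mul _ _ hd0 (hpos _) (hcop _), ← hζ.pow p v hp.out,
    map_mul, map_mul, map_pow, ← mul_sub]
  set ξ := σ (ζ (p ^ (v + 1))) with hξ
  have h1 : ξ ^ p ^ (v + 1) = 1 := by
    rw [hξ, ← map_pow, (hζ.primitive _ (hpos _)).pow_eq_one, map_one]
  have h2 : ξ - ξ ^ p = ξ * (1 - ξ ^ (p - 1)) := by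
    rw [mul_sub, mul_one, ← pow_succ', Nat.sub_add_cancel hp.out.one_le]
  have h3 : ‖1 - ξ ^ (p - 1)‖ < 1 := by
    refine norm_one_sub_lt_one_of_pow_prime_pow (k := v + 1) ?_
    rw [← pow_mul, mul_comm, pow_mul, h1, one_pow]
  have h4 : ‖σ (ζ d)‖ = 1 := PadicComplex.norm_eq_one_of_pow_eq_one (n := d) (by
    rw [← map_pow, (hζ.primitive _ hd0).pow_eq_one, map_one]) hd0.ne'
  have h5 : ‖ξ‖ = 1 := PadicComplex.norm_eq_one_of_pow_eq_one h1 (hpos _).ne'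
  rw [h2, norm_mul, norm_mul, h4, h5, one_mul, one_mul]
  exact h3

theorem logAt_ne_zero {c : ℂ_[p]} (hc : c ≠ 0) : logAt c ≠ 0 := by
  intro h
  have := congrArg (PowerSeries.coeff 1) h
  simp [logAt, hc] at this

end RootsOfUnity

theorem ratResidue_natApprox {N m M : ℕ} (hN : 0 < N) (hm : 0 < m) (hmN : m.Coprime N)
    (hM : 0 < M) (hMN : M.Coprime N) (hmM : m ∣ M) {α : ℚ} {a : ℤ} (hα : α = a / N) :
    ratResidue m ((natApprox M α + 1 : ℕ) : ℚ) = ratResidue m α :=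
  ratResidue_congr hN hm hmN (natCast_eq_div hN _) hα
    ((Int.natCast_dvd_natCast.mpr hmM).trans (natApprox_spec hN hM hMN hα))

theorem betaConst_ne_zero (A B : ℕ) : betaConst A B ≠ 0 := by
  have h1 : ((A + B + 1).factorial : ℚ) ≠ 0 := by exact_mod_cast Nat.factorial_ne_zero _
  have h2 : (A.factorial : ℚ) ≠ 0 := by exact_mod_cast Nat.factorial_ne_zero _
  have h3 : (B.factorial : ℚ) ≠ 0 := by exact_mod_cast Nat.factorial_ne_zero _
  exact div_ne_zero h1 (mul_ne_zero h2 h3)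

theorem theorem2p3 (N : ℕ) (hN : 0 < N) (ζ : ℕ → QCyc) (hζ : IsCompatibleRoots ζ) (α β : ℚ)
    (hα : ∃ a : ℤ, α = a / N) (hβ : ∃ b : ℤ, β = b / N)
    -- the Gamma values and the infinite products in the definition of `B_m` make sense
    (hα0 : ∀ n : ℕ, α ≠ -n) (hβ0 : ∀ n : ℕ, β ≠ -n) (hαβ0 : ∀ n : ℕ, α + β ≠ -n) :
    ∃ B : ℕ → LaurentSeries QCyc,
      (∀ m : ℕ, 0 < m → m.Coprime N → IsQBetaExpansion (ζ m) m α β (B m)) ∧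
      ∀ (p : ℕ) [Fact p.Prime], p.Coprime N → ∀ σ : QCyc →+* ℂ_[p],
        ∀ m : ℕ, 0 < m → m.Coprime N →
          (∃ f : ℂ_[p]⟦X⟧, ConvergesOnUnitDisc f ∧
            (logAt (σ (ζ m)) : LaurentSeries ℂ_[p]) * (B m).map σ = f) ∧
          ‖σ (ζ (p * m)) - σ (ζ m)‖ < 1 ∧
          ∃ (e : ℤ) (c : ℚ),
            (e : ℚ) = ratBracket p (ratBracket m α + ratBracket m β) + 1
              - ratBracket (p * m) α - ratBracket (p * m) β ∧
            (c : ℝ) = Real.Gamma (ratBracket p (ratBracket m α + ratBracket m β)) /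
              Real.Gamma (ratBracket (p * m) α + ratBracket (p * m) β : ℚ) ∧
            IsMeromorphicReexpansion (σ (ζ (p * m)) - σ (ζ m)) ((B m).map σ)
              (algebraMap ℚ_[p] ℂ_[p]
                ((p : ℚ_[p]) ^ e *
                  (moritaGamma p (ratBracket m α + ratBracket m β : ℚ) /
                    (moritaGamma p (ratBracket m α) * moritaGamma p (ratBracket m β))) *
                  (c : ℚ_[p])) •
                (B (p * m)).map σ) := by
  have hex : ∀ m : ℕ, ∃ Ψ : ℕ → ℚ → ℚ → QCyc, 0 < m → m.Coprime N → (∀ n, IsPoly₂ (Ψ n)) ∧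
      IsQBetaExpansion (ζ m) m α β (invXMul (PowerSeries.mk fun n => Ψ n α β)) ∧
      ∀ a b : ℕ, ratResidue m ((a + 1 : ℕ) : ℚ) = ratResidue m α →
        ratResidue m ((b + 1 : ℕ) : ℚ) = ratResidue m β →
        qFac (PowerSeries.C (ζ m) + PowerSeries.X : QCyc⟦X⟧) (a + b + 1) *
          PowerSeries.mk (fun n => Ψ n ((a + 1 : ℕ) : ℚ) ((b + 1 : ℕ) : ℚ)) =
        PowerSeries.C ((betaConst (a / m) (b / m) : ℚ) : QCyc) * PowerSeries.X *
          qFac (PowerSeries.C (ζ m) + PowerSeries.X : QCyc⟦X⟧) a *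
          qFac (PowerSeries.C (ζ m) + PowerSeries.X : QCyc⟦X⟧) b := by
    intro m
    by_cases h : 0 < m ∧ m.Coprime N
    · obtain ⟨Ψ, h1, h2, h3, h4⟩ := exists_coefficients hN h.1 h.2 (hζ.primitive m h.1)
        (ratResidue_lt h.1 α) (ratResidue_lt h.1 β)
      exact ⟨Ψ, fun _ _ => ⟨h1, isQBetaExpansion_invXMul ((hζ.primitive m h.1).ne_zero h.1.ne')
        (fun n => h2 n α β) (h3 α β hα hβ hα0 hβ0 hαβ0 rfl rfl), h4⟩⟩
    · exact ⟨fun _ _ _ => 0, fun h1 h2 => absurd ⟨h1, h2⟩ h⟩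
  choose Ψ hΨ using hex
  refine ⟨fun m => invXMul (PowerSeries.mk fun n => Ψ m n α β), fun m hm hmN => (hΨ m hm hmN).2.1, ?_⟩
  intro p hp hpN σ m hm hmN
  obtain ⟨a₀, hα⟩ := hα
  obtain ⟨b₀, hβ⟩ := hβ
  have hp0 := hp.out.pos
  have hpm : 0 < p * m := Nat.mul_pos hp0 hm
  have hpmN : (p * m).Coprime N := Nat.Coprime.mul_left hpN hmN
  -- `m` and `p m` have the same prime-to-`p` part `d`, so the same approximations of the logarithm
  -- serve at both centres.
  obtain ⟨v, d, hpd, hmd⟩ := Nat.exists_eq_pow_mul_and_not_dvd hm.ne' p hp.out.ne_one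
  rw [mul_comm] at hmd
  have hd : p.Coprime d := (Nat.Prime.coprime_iff_not_dvd hp.out).mpr hpd
  have hd0 : 0 < d := Nat.pos_of_ne_zero fun h => hpd (h ▸ dvd_zero p)
  have hmd' : p * m = d * p ^ (v + 1) := by rw [hmd, pow_succ]; ring
  have hδ : ‖σ (ζ (p * m)) - σ (ζ m)‖ < 1 := by
    rw [hmd', hmd]; exact hζ.norm_sub_lt_one σ hd0 hd
  have hc : IsPrimitiveRoot (σ (ζ m)) (d * p ^ v) := by
    rw [← hmd]; exact (hζ.primitive m hm).map_of_injective σ.injective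
  have hc' : IsPrimitiveRoot (σ (ζ (p * m))) (d * p ^ (v + 1)) := by
    rw [← hmd']; exact (hζ.primitive _ hpm).map_of_injective σ.injective
  obtain ⟨e, c, he, hcΓ, hlimκ⟩ := tendsto_betaConst_ratio (p := p) hN hm hmN hpN hα hβ hαβ0
  set κ : ℚ_[p] := (p : ℚ_[p]) ^ e *
    (moritaGamma p (ratBracket m α + ratBracket m β : ℚ) /
      (moritaGamma p (ratBracket m α) * moritaGamma p (ratBracket m β))) * (c : ℚ_[p]) with hκdef
  have hM : ∀ j, 0 < p * m * p ^ j := fun j => Nat.mul_pos hpm (pow_pos hp0 j)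
  have hMN : ∀ j, (p * m * p ^ j).Coprime N := fun j =>
    Nat.Coprime.mul_left hpmN (hpN.pow_left j)
  have hval : ∀ M : ℕ, 0 < M → M.Coprime N → M ∣ p * m → ∀ j,
      qFac (PowerSeries.C (σ (ζ M)) + PowerSeries.X : ℂ_[p]⟦X⟧)
        (natApprox (p * m * p ^ j) α + natApprox (p * m * p ^ j) β + 1) *
        PowerSeries.mk (fun n => σ (Ψ M n ((natApprox (p * m * p ^ j) α + 1 : ℕ) : ℚ)
          ((natApprox (p * m * p ^ j) β + 1 : ℕ) : ℚ))) =
      PowerSeries.C ((betaConst (natApprox (p * m * p ^ j) α / M)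
          (natApprox (p * m * p ^ j) β / M) : ℂ_[p])) * PowerSeries.X *
        qFac (PowerSeries.C (σ (ζ M)) + PowerSeries.X) (natApprox (p * m * p ^ j) α) *
        qFac (PowerSeries.C (σ (ζ M)) + PowerSeries.X) (natApprox (p * m * p ^ j) β) := by
    intro M hM0 hM' hMd j
    have h1 := congrArg (PowerSeries.map σ) ((hΨ M hM0 hM').2.2 (natApprox (p * m * p ^ j) α)
      (natApprox (p * m * p ^ j) β)
      (ratResidue_natApprox hN hM0 hM' (hM j) (hMN j) (hMd.mul_right _) hα)
      (ratResidue_natApprox hN hM0 hM' (hM j) (hMN j) (hMd.mul_right _) hβ))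
    simp only [map_mul, map_qFac, map_add, PowerSeries.map_C, PowerSeries.map_X, map_ratCast] at h1
    rw [← h1]
    congr 1
  have hlim : ∀ M : ℕ, 0 < M → M.Coprime N → ∀ n,
      Tendsto (fun j => PowerSeries.coeff n (PowerSeries.mk (fun n => σ (Ψ M n
        ((natApprox (p * m * p ^ j) α + 1 : ℕ) : ℚ)
          ((natApprox (p * m * p ^ j) β + 1 : ℕ) : ℚ))))) atTop
        (𝓝 (PowerSeries.coeff n (PowerSeries.mk fun n => σ (Ψ M n α β)))) := by
    intro M hM0 hM' n
    simp only [PowerSeries.coeff_mk]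
    exact (((hΨ M hM0 hM').1 n).map σ).tendsto (tendsto_natApprox hN hpN hpm hpmN hα)
      (tendsto_natApprox hN hpN hpm hpmN hβ)
  have hκ : Tendsto (fun j => (betaConst (natApprox (p * m * p ^ j) α / (d * p ^ v))
      (natApprox (p * m * p ^ j) β / (d * p ^ v)) : ℂ_[p]) /
      (betaConst (natApprox (p * m * p ^ j) α / (p * m))
        (natApprox (p * m * p ^ j) β / (p * m)) : ℂ_[p])) atTop (𝓝 (algebraMap ℚ_[p] ℂ_[p] κ)) := by
    have hcont : Continuous (algebraMap ℚ_[p] ℂ_[p]) := continuous_algebraMap _ _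
    have := (hcont.tendsto _).comp hlimκ
    simp only [Function.comp_def, map_div₀, map_ratCast] at this
    rw [← hmd]
    exact this
  obtain ⟨f, f', hf, hf', hconv, hre⟩ := isReexpansion_log_mul_of_tendsto hc hc' hd hd0 hδ
    (a := fun j => natApprox (p * m * p ^ j) α) (b := fun j => natApprox (p * m * p ^ j) β)
    (κ' := fun j => (betaConst (natApprox (p * m * p ^ j) α / (p * m))
        (natApprox (p * m * p ^ j) β / (p * m)) : ℂ_[p]))
    (fun j => Rat.cast_ne_zero.mpr (betaConst_ne_zero _ _))
    (by rw [← hmd]; exact hval m hm hmN (Dvd.intro_left p rfl)) (hval (p * m) hpm hpmN dvd_rfl)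
    (hlim m hm hmN) (hlim (p * m) hpm hpmN) hκ
  have hmap : ∀ M, (invXMul (PowerSeries.mk fun n => Ψ M n α β)).map σ =
      invXMul (PowerSeries.mk fun n => σ (Ψ M n α β)) := by
    intro M
    rw [map_invXMul]
    congr 1
  have hlog := isReexpansion_logAt hc hc' hd hd0 hδ
  simp only [hmap]
  -- The meromorphic function is presented as `f / log q`, with the logarithm as denominator at both
  -- centres.
  refine ⟨⟨f, hconv, (coe_eq_mul_invXMul hf).symm⟩, hδ, e, c, he, hcΓ, f, logAt (σ (ζ m)), f',
    logAt (σ (ζ (p * m))), hconv, convergesOnUnitDisc_of_gaussBound hlog.1,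
    logAt_ne_zero (hc.ne_zero (by rw [← hmd]; exact hm.ne')),
    logAt_ne_zero (hc'.ne_zero (by rw [← hmd']; exact hpm.ne')), hre, hlog.2,
    coe_eq_mul_invXMul hf, ?_⟩
  rw [C_mul_invXMul]
  refine coe_eq_mul_invXMul ?_
  rw [hf']
  ring
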